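/- **The theory $\mathsf{EA}^*$.** Its language has the relation symbols $\mathrm{Dom}$, $\in$ (and equality), a constant $\varnothing$, unary function symbols $\mathrm P$ (power set), $\bigcup$ (sum set), $\mathrm R$ (rank), a binary symbol $\{\cdot,\cdot\}$ (pair set), and, for every bounded quantifier formula $\varphi(\vec x,u)$ of the language, a function symbol $\{u\in y:\varphi(\vec x,u)\}$ of $\vec x,y$. A formula is a *bounded quantifier formula* if all its quantifiers have the form $\forall v(v\in t\to\cdots)$ or $\exists v(v\in t\wedge\cdots)$ with $t$ a term not containing $v$; terms and bounded quantifier formulae are generated simultaneously. The axioms are $\forall x\,\mathrm{Dom}(x)$, Extensionality, the usual defining axioms for $\varnothing$, $\{\cdot,\cdot\}$, $\bigcup$ and $\mathrm P$, Foundation, Separation $\forall\vec x\forall y\forall z\,(z\in\{u\in y:\varphi(\vec x,u)\}\leftrightarrow z\in y\wedge\varphi(\vec x,z))$ for bounded quantifier formulae $\varphi$, Dedekind Finiteness (every one-one function from a set to itself is onto), and the Weak Hierarchy Principle: $\mathrm R(x)$ is a level of the cumulative hierarchy, $x\in\mathrm R(x)$, and $\mathrm R(x)\subseteq y$ for every level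 $y$ with $x\in y$. Here $S$ is a *level* if there is a linear ordering $[V_0,\dots,V_n]$ of subsets of $S$ with $V_0=\varnothing$, $V_n=S$ and $V_{k+1}=\mathrm P(V_k)$ for each $k<n$. (Linear orderings are reflexive ones, coded as sets of ordered pairs.) **The Ackermann ordering.** For a linear ordering $L$, $\mathrm{Lex}(L)$ is the ordering of the power set of its field in which $X$ precedes $Y$ iff the $L$-greatest element of the symmetric difference of $X$ and $Y$ is in $Y$. For a level $S$ with $[V_0,\dots,V_n]$ as above, $\mathrm{Ack}(S)$ is given by recursion along $[V_0,\dots,V_n]$: $\mathrm{Ack}(V_0)$ is the empty ordering and $\mathrm{Ack}(V_{k+1})=\mathrm{Lex}(\mathrm{Ack}(V_k))$. Put $x<_{\mathrm a}y$ iff $\mathrm R(x)\subseteq\mathrm R(y)$ and $x$ strictly precedes $y$ in $\mathrm{Ack}(\mathrm R(y))$. **The arithmetic on $V$.** Let $0_{\mathrm a}=\varnothing$, and let $S_{\mathrm a}(x)$ be the immediate successor of $x$ in $\mathrm{Ack}(\mathrm P(\mathrm R(x)))$. Let $R=\mathrm R(x)\cup\mathrm R(y)$ be the larger of the two ranks,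 and for an ordering $L$ let $[x]_L$ be the set of all $w$ with $\{\varnothing\}\le_L w\le_L x$. With $L=\mathrm{Ack}(\mathrm P(R))$, $x+_{\mathrm a}y$ (respectively $x\times_{\mathrm a}y$) is the unique $z$ in the field of $L$ such that $[z]_L$ is equinumerous (injections both ways) with the disjoint sum (respectively the Cartesian product) of $[x]_L$ and $[y]_L$. With $L=\mathrm{Ack}(\mathrm P(\mathrm P(R)))$, $\mathrm{Exp}_{\mathrm a}(x,y)$ is the unique $z$ in the field of $L$ such that $[z]_L$ is equinumerous with the set of functions from $[y]_L$ to $[x]_L$. All of these are expressed by terms and bounded quantifier formulae of $\mathsf{EA}^*$. **The interpretation $\mathfrak d$.** The mapping $\mathfrak d$ translates formulae of the language $\mathrm{Dom},<,0,S,+,\cdot,\mathrm{Exp}$ of $\mathsf I\Delta_0+\mathsf{exp}$ into formulae of $\mathsf{EA}^*$: it leaves $\mathrm{Dom}(x)$ and $x=y$ unchanged, replaces $0,<,S,+,\cdot,\mathrm{Exp}$ by $0_{\mathrm a},<_{\mathrm a},S_{\mathrm a},+_{\mathrm a},\times_{\mathrm a},\mathrm{Exp}_{\mathrm a}$, commutes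 with the connectives, and relativizes quantifiers to $\mathrm{Dom}$. "The $x$-th bit of $y$ is $1$" is the arithmetical formula $(\exists n<y)(\exists m<2^x)\,[\,y=2^{x+1}n+2^x+m\,]$, where $2^t$ is $\mathrm{Exp}(S(S(0)),t)$ and $x+1$ is $S(x)$; it is the Ackermann translation $(x\in y)^{\mathfrak a}$ of $x\in y$. **Theorem.** $$\mathsf{EA}^*\vdash\; x\in y\;\leftrightarrow\;(\text{the } x\text{-th bit of } y \text{ is } 1)^{\mathfrak d},$$ that is, this biconditional, with free variables $x,y$, holds in every model of $\mathsf{EA}^*$ for all $x,y$. In other words, every set is its own Ackermann code in the arithmetic $\langle V,0_{\mathrm a},<_{\mathrm a},S_{\mathrm a},+_{\mathrm a},\times_{\mathrm a},\mathrm{Exp}_{\mathrm a}\rangle$. -/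

import Mathlib

open FirstOrder FirstOrder.Language

namespace FinSetTheory

/-! ## The language of the bounded theory of finite sets

Function symbols, terms and bounded quantifier formulae are generated simultaneously, because every
bounded quantifier formula `φ(x₁, …, xₖ, u)` yields a function symbol `{u ∈ _ : φ(x₁, …, xₖ, u)}`.
Variables are de Bruijn levels: in a context of size `n` they are `0, …, n - 1`, and a quantifier
binds the new variable `n`. -/

mutual

/-- The function symbols of each arity. The arguments of `sep φ` are the parameters `x₁, …, xₖ` of
`φ`, followed by the set `y` from which a subset is separated: `{u ∈ y : φ(x₁, …, xₖ, u)}`. -/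
inductive Fn : ℕ → Type
  | empty : Fn 0
  | power : Fn 1
  | union : Fn 1
  | rank : Fn 1
  | pair : Fn 2
  | sep {k : ℕ} (φ : BForm (k + 1)) : Fn (k + 1)

/-- Terms in the variables `0, …, n - 1`. -/
inductive Tm : ℕ → Type
  | var {n : ℕ} (i : Fin n) : Tm n
  | app {n k : ℕ} (f : Fn k) (ts : Fin k → Tm n) : Tm n

/-- Bounded quantifier formulae in the variables `0, …, n - 1`. Here `ball t φ` is
`∀ v, v ∈ t → φ` and `bex t φ` is `∃ v, v ∈ t ∧ φ`, for the new variable `v = n`, which does not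
occur in `t`. -/
inductive BForm : ℕ → Type
  | falsum {n : ℕ} : BForm n
  | dom {n : ℕ} (t : Tm n) : BForm n
  | eq {n : ℕ} (s t : Tm n) : BForm n
  | mem {n : ℕ} (s t : Tm n) : BForm n
  | imp {n : ℕ} (φ ψ : BForm n) : BForm n
  | ball {n : ℕ} (t : Tm n) (φ : BForm (n + 1)) : BForm n
  | bex {n : ℕ} (t : Tm n) (φ : BForm (n + 1)) : BForm n

end

/-- The relation symbols: `Dom` and `∈`. -/
inductive Rel : ℕ → Type
  | dom : Rel 1
  | mem : Rel 2

/-- The first-order language of the theory of finite sets (equality is a logical symbol). -/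
abbrev LSet : FirstOrder.Language.{0, 0} := ⟨Fn, Rel⟩

/-- Renaming of variables in terms. -/
def Tm.rename {n m : ℕ} (g : Fin n → Fin m) : Tm n → Tm m
  | .var i => .var (g i)
  | .app f ts => .app f fun i => (ts i).rename g

/-- Renaming of free variables in bounded quantifier formulae. -/
def BForm.rename : {n m : ℕ} → (Fin n → Fin m) → BForm n → BForm m
  | _, _, _, .falsum => .falsum
  | _, _, g, .dom t => .dom (t.rename g)
  | _, _, g, .eq s t => .eq (s.rename g) (t.rename g)
  | _, _, g, .mem s t => .mem (s.rename g) (t.rename g)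
  | _, _, g, .imp φ ψ => .imp (φ.rename g) (ψ.rename g)
  | _, m, g, .ball t φ =>
      .ball (t.rename g) (φ.rename (Fin.snoc (fun i => (g i).castSucc) (Fin.last m)))
  | _, m, g, .bex t φ =>
      .bex (t.rename g) (φ.rename (Fin.snoc (fun i => (g i).castSucc) (Fin.last m)))

/-- The same term, in a context with one more variable. -/
def Tm.up {n : ℕ} (t : Tm n) : Tm (n + 1) := t.rename Fin.castSucc

/-- The most recently bound variable. -/
def new {n : ℕ} : Tm (n + 1) := .var (Fin.last n)

/-- Terms as first-order terms. -/
def Tm.toTerm {n : ℕ} : Tm n → LSet.Term (Fin n)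
  | .var i => Term.var i
  | .app (k := k) f ts => Term.func (L := LSet) (l := k) f fun i => (ts i).toTerm

/-- The atomic formula `s ∈ t`. -/
def memAtom {n : ℕ} (s t : Tm n) : LSet.BoundedFormula Empty n :=
  Relations.boundedFormula₂ (L := LSet) Rel.mem
    (s.toTerm.relabel Sum.inr) (t.toTerm.relabel Sum.inr)

/-- Bounded quantifier formulae as first-order formulae. -/
def BForm.toBounded : {n : ℕ} → BForm n → LSet.BoundedFormula Empty n
  | _, .falsum => ⊥
  | _, .dom t => Relations.boundedFormula₁ (L := LSet) Rel.dom (t.toTerm.relabel Sum.inr)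
  | _, .eq s t => (s.toTerm.relabel Sum.inr).bdEqual (t.toTerm.relabel Sum.inr)
  | _, .mem s t => memAtom s t
  | _, .imp φ ψ => φ.toBounded.imp ψ.toBounded
  | _, .ball t φ => ((memAtom new t.up).imp φ.toBounded).all
  | _, .bex t φ => (memAtom new t.up ⊓ φ.toBounded).ex

/-- A bounded quantifier formula as a first-order formula with `n` free variables. -/
def BForm.toFormula {n : ℕ} (φ : BForm n) : LSet.Formula (Fin n) :=
  Formula.relabel (Sum.elim Empty.elim id) (BoundedFormula.toFormula φ.toBounded)

/-! ## Abbreviations for terms and bounded quantifier formulae -/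

section Abbreviations

variable {n : ℕ}

def BForm.not (φ : BForm n) : BForm n := .imp φ .falsum
def BForm.and (φ ψ : BForm n) : BForm n := .not (.imp φ (.not ψ))
def BForm.or (φ ψ : BForm n) : BForm n := .imp (.not φ) ψ
def BForm.iff (φ ψ : BForm n) : BForm n := .and (.imp φ ψ) (.imp ψ φ)

/-- The empty set. -/
def emptyT : Tm n := .app .empty Fin.elim0
/-- The power set of `t`. -/
def powT (t : Tm n) : Tm n := .app .power ![t]
/-- The sum set of `t`. -/
def sUnionT (t : Tm n) : Tm n := .app .union ![t]
/-- The value of the rank function `R` at `t`. -/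
def rankT (t : Tm n) : Tm n := .app .rank ![t]
/-- The pair set `{s, t}`. -/
def pairT (s t : Tm n) : Tm n := .app .pair ![s, t]
/-- `{v ∈ t : φ(v)}`; all other variables of the context are parameters. -/
def sepT (t : Tm n) (φ : BForm (n + 1)) : Tm n := .app (.sep φ) (Fin.snoc Tm.var t)

/-- `⋃ {v ∈ t : φ(v)}`, which is the unique `v ∈ t` with `φ(v)` if there is exactly one. -/
def the (t : Tm n) (φ : BForm (n + 1)) : Tm n := sUnionT (sepT t φ)

def subset (s t : Tm n) : BForm n := .ball s (.mem new t.up)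
def singT (t : Tm n) : Tm n := pairT t t
def unionT (s t : Tm n) : Tm n := sUnionT (pairT s t)

/-- The Kuratowski ordered pair. -/
def opairT (s t : Tm n) : Tm n := pairT (singT s) (pairT s t)

/-- The Cartesian product. -/
def prodT (s t : Tm n) : Tm n :=
  sepT (powT (powT (unionT s t)))
    (.bex s.up (.bex t.up.up (.eq new.up.up (opairT new.up new))))

/-- The symmetric difference. -/
def symmDiffT (s t : Tm n) : Tm n :=
  sepT (unionT s t) (.not (.and (.mem new s.up) (.mem new t.up)))

/-! ### Functions and cardinality -/

/-- `f` is a function from `a` to `b`. -/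
def isFun (f a b : Tm n) : BForm n :=
  .and (subset f (prodT a b))
    (.ball a (.bex b.up (.and (.mem (opairT new.up new) f.up.up)
      (.ball b.up.up (.imp (.mem (opairT new.up.up new) f.up.up.up) (.eq new new.up))))))

/-- The function `f` from `a` to `b` is one-one. -/
def isInj (f a b : Tm n) : BForm n :=
  .ball a (.ball a.up (.ball b.up.up
    (.imp (.and (.mem (opairT new.up.up new) f.up.up.up) (.mem (opairT new.up new) f.up.up.up))
      (.eq new.up.up new.up))))

/-- The function `f` from `a` to `b` is onto. -/
def isSurj (f a b : Tm n) : BForm n :=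
  .ball b (.bex a.up (.mem (opairT new new.up) f.up.up))

/-- `a ≤_c b`: there is an injection from `a` into `b`. -/
def cardLe (a b : Tm n) : BForm n :=
  .bex (powT (prodT a b)) (.and (isFun new a.up b.up) (isInj new a.up b.up))

/-- `a ≃_c b`. -/
def cardEq (a b : Tm n) : BForm n := .and (cardLe a b) (cardLe b a)

/-- `a +_c b`, the disjoint sum `(a × {∅}) ∪ (b × {{∅}})`. -/
def cardSumT (a b : Tm n) : Tm n :=
  unionT (prodT a (singT emptyT)) (prodT b (singT (singT emptyT)))

/-- The set of all functions from `b` to `a`. -/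
def funsT (b a : Tm n) : Tm n := sepT (powT (prodT b a)) (isFun new b.up a.up)

/-! ### Linear orderings

A linear ordering is a reflexive one, represented by its set of ordered pairs; so the one-element
ordering `[x]` is `{(x, x)}`, and the empty ordering `[ ]` is `∅`. -/

/-- The field of the relation `l`. -/
def fieldT (l : Tm n) : Tm n :=
  sepT (sUnionT (sUnionT l)) (.bex (sUnionT (sUnionT l)).up
    (.or (.mem (opairT new.up new) l.up.up) (.mem (opairT new new.up) l.up.up)))

/-- `a ≤ b` in the ordering `l`. -/
def ordLe (l a b : Tm n) : BForm n := .mem (opairT a b) l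

/-- `a < b` in the ordering `l`. -/
def ordLt (l a b : Tm n) : BForm n := .and (ordLe l a b) (.not (.eq a b))

/-- `l` is a linear ordering: a set of ordered pairs that is reflexive on its field, antisymmetric,
transitive and total. -/
def isLinOrd (l : Tm n) : BForm n :=
  .and (.ball l (.bex (fieldT l).up (.bex (fieldT l).up.up (.eq new.up.up (opairT new.up new)))))
  (.and (.ball (fieldT l) (ordLe l.up new new))
  (.and (.ball (fieldT l) (.ball (fieldT l).up
    (.imp (.and (ordLe l.up.up new.up new) (ordLe l.up.up new new.up)) (.eq new.up new))))
  (.and (.ball (fieldT l) (.ball (fieldT l).up (.ball (fieldT l).up.up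
    (.imp (.and (ordLe l.up.up.up new.up.up new.up) (ordLe l.up.up.up new.up new))
      (ordLe l.up.up.up new.up.up new)))))
  (.ball (fieldT l) (.ball (fieldT l).up
    (.or (ordLe l.up.up new.up new) (ordLe l.up.up new new.up)))))))

/-- `b` follows immediately after `a` in the ordering `l`. -/
def isNext (l a b : Tm n) : BForm n :=
  .and (ordLt l a b) (.ball (fieldT l)
    (.imp (.and (ordLe l.up a.up new) (ordLe l.up new b.up))
      (.or (.eq new a.up) (.eq new b.up))))

/-- `g` is the `l`-greatest element of `s`. -/
def isGreatest (l s g : Tm n) : BForm n :=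
  .and (.mem g s) (.ball s (ordLe l.up new g.up))

/-- The field of the segment `[a, …, b]` of the ordering `l`. -/
def segT (l a b : Tm n) : Tm n :=
  sepT (fieldT l) (.and (ordLe l.up a.up new) (ordLe l.up new b.up))

/-- The set of linear orderings `l ⊆ s × s`. -/
def linOrdsT (s : Tm n) : Tm n := sepT (powT (prodT s s)) (isLinOrd new)

/-! ### Levels of the cumulative hierarchy -/

/-- `c` is a linear ordering `[V₀, …, Vₘ]` with `V₀, …, Vₘ ⊆ s`, `V₀ = ∅`, `Vₘ = s`, and
`Vₖ₊₁ = P(Vₖ)` for each `k < m`. -/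
def isHierarchy (c s : Tm n) : BForm n :=
  .and (isLinOrd c)
  (.and (.ball (fieldT c) (subset new s.up))
  (.and (.and (.mem emptyT (fieldT c)) (.ball (fieldT c) (ordLe c.up emptyT new)))
  (.and (.and (.mem s (fieldT c)) (.ball (fieldT c) (ordLe c.up new s.up)))
  (.ball (fieldT c) (.ball (fieldT c).up
    (.imp (isNext c.up.up new.up new) (.eq new (powT new.up))))))))

/-- A set of which every ordering of subsets of `s` is an element, since ordered pairs of subsets
of `s` are elements of `P(P(P(s)))`. -/
def chainBoundT (s : Tm n) : Tm n := powT (powT (powT (powT s)))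

/-- `s` is a level in the cumulative hierarchy. -/
def isLevel (s : Tm n) : BForm n := .bex (chainBoundT s) (isHierarchy new s.up)

/-! ### The Ackermann ordering and its arithmetic -/

/-- `x` precedes `y` in `Lex(l)`: the `l`-greatest element of the symmetric difference of `x` and
`y` is in `y`. -/
def lexLt (l x y : Tm n) : BForm n :=
  .bex (symmDiffT x y) (.and (isGreatest l.up (symmDiffT x y).up new) (.mem new y.up))

/-- The lexicographical ordering `Lex(l)` of the power set of the field of `l`. -/
def lexT (l : Tm n) : Tm n :=
  sepT (prodT (powT (fieldT l)) (powT (fieldT l)))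
    (.bex (powT (fieldT l)).up (.bex (powT (fieldT l)).up.up
      (.and (.eq new.up.up (opairT new.up new))
        (.or (.eq new.up new) (lexLt l.up.up.up new.up new)))))

/-- `f` is the local function `Ack` on the members `V₀, …, Vₘ` of the hierarchy `c` that ends with
`s`: its values are linear orderings `l ⊆ s × s`, its value at `V₀ = ∅` is the empty ordering, and
its value at `Vₖ₊₁` is `Lex` of its value at `Vₖ`. -/
def isAckFun (f c s : Tm n) : BForm n :=
  .and (isFun f (fieldT c) (linOrdsT s))
  (.and (.mem (opairT emptyT emptyT) f)
  (.ball (fieldT c) (.ball (fieldT c).up (.ball (linOrdsT s).up.up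
    (.imp (.and (isNext c.up.up.up new.up.up new.up) (.mem (opairT new.up.up new) f.up.up.up))
      (.mem (opairT new.up (lexT new)) f.up.up.up))))))

/-- `Ack(s)`, for a level `s` of the cumulative hierarchy: the value at `s` of the local function
`Ack`, given by recursion along a hierarchy that ends with `s`. -/
def ackT (s : Tm n) : Tm n :=
  the (linOrdsT s) (.bex (chainBoundT s).up (.and (isHierarchy new s.up.up)
    (.bex (powT (prodT (fieldT new) (linOrdsT s).up.up))
      (.and (isAckFun new new.up s.up.up.up) (.mem (opairT s.up.up.up new.up.up) new)))))

/-- `x <_a y`. -/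
def ltA (x y : Tm n) : BForm n :=
  .and (subset (rankT x) (rankT y)) (ordLt (ackT (rankT y)) x y)

/-- `0_a`. -/
def zeroA : Tm n := emptyT

/-- `S_a(x)`: the element that follows immediately after `x` in `Ack(P(R(x)))`. -/
def succA (x : Tm n) : Tm n :=
  the (fieldT (ackT (powT (rankT x)))) (isNext (ackT (powT (rankT x))).up x.up new)

/-- The larger of the levels `R(x)` and `R(y)`. -/
def maxRankT (x y : Tm n) : Tm n := unionT (rankT x) (rankT y)

/-- The field of the segment `[{∅}, …, x]` of the ordering `l`. -/
def initT (l x : Tm n) : Tm n := segT l (singT emptyT) x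

/-- `x +_a y`: the unique `z` in the ordering `l = Ack(P(R))`, for `R` the larger of `R(x)` and
`R(y)`, with `[{∅}, …, x]_l +_c [{∅}, …, y]_l ≃_c [{∅}, …, z]_l`. -/
def addA (x y : Tm n) : Tm n :=
  let l := ackT (powT (maxRankT x y))
  the (fieldT l) (cardEq (cardSumT (initT l x) (initT l y)).up (initT l.up new))

/-- `x ×_a y`: the unique `z` in the ordering `l = Ack(P(R))`, for `R` the larger of `R(x)` and
`R(y)`, with `[{∅}, …, x]_l × [{∅}, …, y]_l ≃_c [{∅}, …, z]_l`. -/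
def mulA (x y : Tm n) : Tm n :=
  let l := ackT (powT (maxRankT x y))
  the (fieldT l) (cardEq (prodT (initT l x) (initT l y)).up (initT l.up new))

/-- `Exp_a(x, y)`, that is, `x` to the power `y`: the unique `z` in the ordering `l = Ack(P(P(R)))`,
for `R` the larger of `R(x)` and `R(y)`, such that the set of functions from `[{∅}, …, y]_l` to
`[{∅}, …, x]_l` is `≃_c [{∅}, …, z]_l`. (A second power set is needed to have room for `z`: there
are 27 functions from a set of three elements to itself, and `Ack(P(R))` has 16 elements if `x` and
`y` are the element number 3.) -/
def expA (x y : Tm n) : Tm n :=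
  let l := ackT (powT (powT (maxRankT x y)))
  the (fieldT l) (cardEq (funsT (initT l y) (initT l x)).up (initT l.up new))

end Abbreviations

/-! ## The theory `EA*` -/

/-- The matrices of the axioms; the axioms are their universal closures. -/
inductive EAMatrix : {n : ℕ} → BForm n → Prop
  /-- Everything is in the domain. -/
  | dom : EAMatrix (n := 1) (.dom (.var 0))
  /-- Extensionality. -/
  | ext : EAMatrix (n := 2)
      (.imp (.and (subset (.var 0) (.var 1)) (subset (.var 1) (.var 0))) (.eq (.var 0) (.var 1)))
  /-- The constant `∅` denotes the empty set. -/
  | empty : EAMatrix (n := 1) (.not (.mem (.var 0) emptyT))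
  /-- Pair set. -/
  | pair : EAMatrix (n := 3) (.iff (.mem (.var 2) (pairT (.var 0) (.var 1)))
      (.or (.eq (.var 2) (.var 0)) (.eq (.var 2) (.var 1))))
  /-- Sum set. -/
  | union : EAMatrix (n := 2)
      (.iff (.mem (.var 1) (sUnionT (.var 0))) (.bex (.var 0) (.mem (.var 1) new)))
  /-- Power set. -/
  | power : EAMatrix (n := 2) (.iff (.mem (.var 1) (powT (.var 0))) (subset (.var 1) (.var 0)))
  /-- Foundation. -/
  | foundation : EAMatrix (n := 1) (.imp (.not (.eq (.var 0) emptyT))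
      (.bex (.var 0) (.ball new (.not (.mem new (.var 0))))))
  /-- Subset separation for the bounded quantifier formula `φ(x₁, …, xₖ, u)`, with the variables
  `x₁, …, xₖ, y, z`: `z ∈ {u ∈ y : φ(x₁, …, xₖ, u)} ↔ z ∈ y ∧ φ(x₁, …, xₖ, z)`. -/
  | sep {k : ℕ} (φ : BForm (k + 1)) : EAMatrix (n := k + 2)
      (.iff (.mem new (.app (.sep φ) fun i => .var i.castSucc))
        (.and (.mem new (.var (Fin.last k).castSucc))
          (φ.rename (Fin.snoc (fun i => i.castSucc.castSucc) (Fin.last (k + 1))))))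
  /-- Dedekind finiteness: every one-one function from a set to itself is onto. -/
  | dedekind : EAMatrix (n := 2)
      (.imp (.and (isFun (.var 1) (.var 0) (.var 0)) (isInj (.var 1) (.var 0) (.var 0)))
        (isSurj (.var 1) (.var 0) (.var 0)))
  /-- The weak hierarchy principle: `R(x)` is the first level of the cumulative hierarchy of which
  `x` is an element. -/
  | hierarchy : EAMatrix (n := 2)
      (.and (.mem (.var 0) (rankT (.var 0))) (.and (isLevel (rankT (.var 0)))
        (.imp (.and (.mem (.var 0) (.var 1)) (isLevel (.var 1)))
          (subset (rankT (.var 0)) (.var 1)))))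

/-- The theory `EA*`. -/
def EAStar : LSet.Theory :=
  {σ | ∃ (n : ℕ) (φ : BForm n), EAMatrix φ ∧ σ = φ.toBounded.alls}

/-! ## Interpretation mappings -/

/-- An atomic mapping from `L₁`, with the domain symbol `dom`, into `L₂`: a term of `L₂` for each
function symbol of `L₁`, and a formula of `L₂` for equality and each relation symbol of `L₁`. -/
structure AtomicMapping (L₁ L₂ : FirstOrder.Language.{0, 0}) (dom : L₁.Relations 1) where
  func : {k : ℕ} → L₁.Functions k → L₂.Term (Fin k)
  eq : L₂.Formula (Fin 2)
  rel : {k : ℕ} → L₁.Relations k → L₂.Formula (Fin k)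

/-- Substitution of terms for the free variables of a formula. -/
def substitute {L : FirstOrder.Language.{0, 0}} {α : Type} {k n : ℕ} (φ : L.Formula (Fin k))
    (ts : Fin k → L.Term (α ⊕ Fin n)) : L.BoundedFormula α n :=
  BoundedFormula.relabel (k := 0) id (BoundedFormula.subst φ ts)

namespace AtomicMapping

variable {L₁ L₂ : FirstOrder.Language.{0, 0}} {dom : L₁.Relations 1} {α : Type}

/-- The translation of terms. -/
def term (I : AtomicMapping L₁ L₂ dom) (t : L₁.Term α) : L₂.Term α := t.substFunc I.func

/-- The full interpretation mapping: it commutes with the connectives and relativizes quantifiers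
to the translation of `dom`. -/
def translate (I : AtomicMapping L₁ L₂ dom) :
    {n : ℕ} → L₁.BoundedFormula α n → L₂.BoundedFormula α n
  | _, .falsum => .falsum
  | _, .equal s t => substitute I.eq ![I.term s, I.term t]
  | _, .rel R ts => substitute (I.rel R) fun i => I.term (ts i)
  | _, .imp φ ψ => (I.translate φ).imp (I.translate ψ)
  | n, .all φ =>
      ((substitute (I.rel dom) ![Term.var (Sum.inr (Fin.last n))]).imp (I.translate φ)).all

end AtomicMapping

/-! ## Bounded arithmetic and the interpretation in `EA*` -/

/-- The function symbols of arithmetic with exponentiation. -/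
inductive ArithFn : ℕ → Type
  | zero : ArithFn 0
  | succ : ArithFn 1
  | add : ArithFn 2
  | mul : ArithFn 2
  | exp : ArithFn 2

/-- The relation symbols of arithmetic: `Dom` and `<`. -/
inductive ArithRel : ℕ → Type
  | dom : ArithRel 1
  | lt : ArithRel 2

/-- The language of `IΔ₀ + exp`. -/
abbrev LArith : FirstOrder.Language.{0, 0} := ⟨ArithFn, ArithRel⟩

/-- The interpretation mapping `𝔡` from arithmetic into set theory. -/
def interpD : AtomicMapping LArith LSet ArithRel.dom where
  func {_} f := match f with
    | ArithFn.zero => Tm.toTerm zeroA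
    | ArithFn.succ => Tm.toTerm (succA (.var 0))
    | ArithFn.add => Tm.toTerm (addA (.var 0) (.var 1))
    | ArithFn.mul => Tm.toTerm (mulA (.var 0) (.var 1))
    | ArithFn.exp => Tm.toTerm (expA (.var 0) (.var 1))
  eq := BForm.toFormula (.eq (.var 0) (.var 1))
  rel {_} R := match R with
    | ArithRel.dom => BForm.toFormula (.dom (.var 0))
    | ArithRel.lt => BForm.toFormula (ltA (.var 0) (.var 1))

section Arithmetic

variable {β : Type}

def zeroN : LArith.Term β := Constants.term (L := LArith) ArithFn.zero
def succN (t : LArith.Term β) : LArith.Term β := Functions.apply₁ (L := LArith) ArithFn.succ t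
def addN (s t : LArith.Term β) : LArith.Term β := Functions.apply₂ (L := LArith) ArithFn.add s t
def mulN (s t : LArith.Term β) : LArith.Term β := Functions.apply₂ (L := LArith) ArithFn.mul s t
def expN (s t : LArith.Term β) : LArith.Term β := Functions.apply₂ (L := LArith) ArithFn.exp s t

/-- `2 ^ t`. -/
def twoPowN (t : LArith.Term β) : LArith.Term β := expN (succN (succN zeroN)) t

def ltN {α : Type} {k : ℕ} (s t : LArith.Term (α ⊕ Fin k)) : LArith.BoundedFormula α k :=
  Relations.boundedFormula₂ (L := LArith) ArithRel.lt s t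

/-- "The `x`-th bit of `y` is 1", for the free variables `x = 0` and `y = 1`:
`(∃ n < y) (∃ m < 2 ^ x) y = 2 ^ (x + 1) * n + 2 ^ x + m`, with `x + 1` written as `S(x)`. -/
def bitFormula : LArith.Formula (Fin 2) :=
  (ltN (α := Fin 2) (k := 1) (Term.var (Sum.inr 0)) (Term.var (Sum.inl 1)) ⊓
    (ltN (α := Fin 2) (k := 2) (Term.var (Sum.inr 1)) (twoPowN (Term.var (Sum.inl 0))) ⊓
      Term.bdEqual (Term.var (Sum.inl 1))
        (addN (addN (mulN (twoPowN (succN (Term.var (Sum.inl 0)))) (Term.var (Sum.inr 0)))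
          (twoPowN (Term.var (Sum.inl 0)))) (Term.var (Sum.inr 1)))).ex).ex

end Arithmetic

/-- The formula `x ∈ y`, for the free variables `x = 0` and `y = 1`. -/
def memFormula : LSet.Formula (Fin 2) := BForm.toFormula (.mem (.var 0) (.var 1))

end FinSetTheory

/-!
The statement is proved semantically, in an arbitrary model `M` of `EA*`; write `ε` for its
membership relation. Such a model may be nonstandard, so that only sets and functions of the model
count, and induction is available only for predicates that are definable by bounded quantifier
formulae. The classes `Dfn` and `Dp` express definability of functions and predicates with
parameters, and their instances derive it from the shape of a Lean term, so that separation
(`mem_sep`) can be used with ordinary Lean predicates.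

*Induction.* Dedekind finiteness implies that every set `a` belongs to the least family that
contains `∅` and is closed under adding an element of `a` (`mem_finSubsets_self`). Otherwise every
member of the family could be enlarged within `a`, and adding one element would induce an injection,
without `0` in its range, on the set of the cardinalities of members of the family. The consequences
are induction on finite sets (`finite_induction`), and that every nonempty subset of a linear
ordering has a least and a greatest element.

*The Ackermann ordering.* Induction along a hierarchy shows that a level `s` has exactly one linear
ordering `l` for which `x` precedes `y` iff the `l`-greatest element of the symmetric difference of
`x` and `y` is in `y`, and that this is `Ack(s)` (`IsLevel.selfLex_ack`). Levels are comparable and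
are initial segments of the Ackermann orderings of larger levels, so that `<_a` is a linear ordering
of all of `M` whose restriction to a level `s` is `Ack(s)` (`ackOrder`, `ack_le_iff`), and it is
lexicographical itself (`lt_iff_lex`).

*Arithmetic.* A set `x` is read as the number of its predecessors, and by induction on finite sets
every set `a` is equinumerous with the set of predecessors of exactly one `card a`. Sum and product
of `x` and `y` are then the cardinality of the disjoint sum and of the product of the sets of
predecessors; here it has to be checked that the level in which the theory looks for the result has
room for it (`IsLevel.card_csum_mem`, `IsLevel.card_prod_mem`). The predecessors of `{x}` are the
sets of predecessors of `x`, so that `{x}` is `2 ^ x` (`lower_sing`, `expS_two`).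

*Binary expansion.* Let `h` and `r` be the sets of the elements of `y` that come after `x` and that
do not. The predecessors of `y` are those of `h` and the sets `h ∪ w` with `w` a predecessor of `r`,
so that `y = h + r` (`uni_eq_plus`). The predecessors of `h` are the unions `A ∪ B`, where `A` is a
predecessor of `h` all of whose elements come after `x` and `B` is a set of elements up to `x`, so
that `h` is a multiple of `2 ^ (x + 1)` (`exists_eq_times`). Hence `r` is the remainder of `y` modulo
`2 ^ (x + 1)`. If `x ε y`, then `r = {x} ∪ m = 2 ^ x + m` with `m < 2 ^ x`, and the bit formula holds;
conversely, if it holds, then `r = {x} ∪ m` by uniqueness of the remainder, and `x ε y`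
(`mem_iff_bit`).
-/

set_option linter.unusedSectionVars false

namespace FinSetTheory

/-! ### Semantics of bounded quantifier formulae -/

section Semantics

variable {M : Type} [LSet.Structure M]

/-- Membership in a structure for the language of set theory. -/
def Mem (x y : M) : Prop := Structure.RelMap (L := LSet) (n := 2) Rel.mem ![x, y]

/-- Membership in a structure for the language of set theory. -/
infix:50 " ε " => Mem

/-- The value of a term. -/
def ev {n : ℕ} (v : Fin n → M) (t : Tm n) : M := t.toTerm.realize v

@[simp] theorem ev_var {n : ℕ} (v : Fin n → M) (i : Fin n) : ev v (.var i) = v i := rfl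

theorem ev_app {n k : ℕ} (v : Fin n → M) (f : Fn k) (ts : Fin k → Tm n) :
    ev v (.app f ts) = Structure.funMap (L := LSet) (n := k) f fun i => ev v (ts i) := rfl

/-- Tarskian satisfaction of bounded quantifier formulae. -/
def BForm.Sat : {n : ℕ} → BForm n → (Fin n → M) → Prop
  | _, .falsum, _ => False
  | _, .dom t, v => Structure.RelMap (L := LSet) (n := 1) Rel.dom ![ev v t]
  | _, .eq s t, v => ev v s = ev v t
  | _, .mem s t, v => ev v s ε ev v t
  | _, .imp φ ψ, v => φ.Sat v → ψ.Sat v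
  | _, .ball t φ, v => ∀ x, x ε ev v t → φ.Sat (Fin.snoc v x)
  | _, .bex t φ, v => ∃ x, x ε ev v t ∧ φ.Sat (Fin.snoc v x)

theorem ev_rename {n m : ℕ} (g : Fin n → Fin m) (v : Fin m → M) :
    (t : Tm n) → ev v (t.rename g) = ev (v ∘ g) t
  | .var i => rfl
  | .app f ts => by
      rw [Tm.rename, ev_app, ev_app]
      congr 1
      funext i
      exact ev_rename g v (ts i)

@[simp] theorem ev_up {n : ℕ} (v : Fin n → M) (x : M) (t : Tm n) :
    ev (Fin.snoc v x : Fin (n + 1) → M) t.up = ev v t := by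
  rw [Tm.up, ev_rename]
  congr 1
  funext i
  simp

@[simp] theorem ev_new {n : ℕ} (v : Fin n → M) (x : M) :
    ev (Fin.snoc v x : Fin (n + 1) → M) new = x := by
  simp [new]

/-- The renaming under a quantifier, as in the definition of `BForm.rename`. -/
theorem snoc_comp_snoc {n m : ℕ} (g : Fin n → Fin m) (v : Fin m → M) (x : M) :
    (Fin.snoc v x : Fin (m + 1) → M) ∘ (Fin.snoc (fun i => (g i).castSucc) (Fin.last m)) =
      (Fin.snoc (v ∘ g) x : Fin (n + 1) → M) := by
  funext i
  refine Fin.lastCases ?_ (fun j => ?_) i <;> simp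

theorem sat_rename : {n m : ℕ} → (g : Fin n → Fin m) → (v : Fin m → M) → (φ : BForm n) →
    ((φ.rename g).Sat v ↔ φ.Sat (v ∘ g))
  | _, _, _, _, .falsum => Iff.rfl
  | _, _, g, v, .dom t => by simp only [BForm.rename, BForm.Sat, ev_rename]
  | _, _, g, v, .eq s t => by simp only [BForm.rename, BForm.Sat, ev_rename]
  | _, _, g, v, .mem s t => by simp only [BForm.rename, BForm.Sat, ev_rename]
  | _, _, g, v, .imp φ ψ => by
      simp only [BForm.rename, BForm.Sat, sat_rename g v φ, sat_rename g v ψ]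
  | _, _, g, v, .ball t φ => by
      simp only [BForm.rename, BForm.Sat, ev_rename, sat_rename _ _ φ, snoc_comp_snoc]
  | _, _, g, v, .bex t φ => by
      simp only [BForm.rename, BForm.Sat, ev_rename, sat_rename _ _ φ, snoc_comp_snoc]

theorem realize_relabel_toTerm {n : ℕ} (w : Empty → M) (v : Fin n → M) (t : Tm n) :
    (t.toTerm.relabel (Sum.inr : Fin n → Empty ⊕ Fin n)).realize (Sum.elim w v) = ev v t := by
  rw [Term.realize_relabel]; rfl

theorem realize_memAtom {n : ℕ} (w : Empty → M) (v : Fin n → M) (s t : Tm n) :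
    (memAtom s t).Realize w v ↔ ev v s ε ev v t := by
  rw [memAtom, BoundedFormula.realize_rel₂, realize_relabel_toTerm, realize_relabel_toTerm]; rfl

theorem realize_toBounded : {n : ℕ} → (φ : BForm n) → (w : Empty → M) → (v : Fin n → M) →
    (φ.toBounded.Realize w v ↔ φ.Sat v)
  | _, .falsum, _, _ => Iff.rfl
  | _, .dom t, w, v => by
      rw [BForm.toBounded, BoundedFormula.realize_rel₁, realize_relabel_toTerm]; rfl
  | _, .eq s t, w, v => by
      rw [BForm.toBounded, BoundedFormula.realize_bdEqual, realize_relabel_toTerm,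
        realize_relabel_toTerm]; rfl
  | _, .mem s t, w, v => realize_memAtom w v s t
  | _, .imp φ ψ, w, v => by
      simp only [BForm.toBounded, BForm.Sat, BoundedFormula.realize_imp, realize_toBounded φ,
        realize_toBounded ψ]
  | _, .ball t φ, w, v => by
      simp only [BForm.toBounded, BForm.Sat, BoundedFormula.realize_imp,
        BoundedFormula.realize_all, realize_memAtom, realize_toBounded φ, ev_up, ev_new]
  | _, .bex t φ, w, v => by
      simp only [BForm.toBounded, BForm.Sat, BoundedFormula.realize_inf,
        BoundedFormula.realize_ex, realize_memAtom, realize_toBounded φ, ev_up, ev_new]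

theorem realize_toFormula {n : ℕ} (φ : BForm n) (v : Fin n → M) :
    φ.toFormula.Realize v ↔ φ.Sat v := by
  rw [BForm.toFormula, Formula.realize_relabel, BoundedFormula.realize_toFormula,
    realize_toBounded]
  rfl

section Connectives

variable {n : ℕ} (v : Fin n → M) (φ ψ : BForm n) (s t : Tm n) (χ : BForm (n + 1))

@[simp] theorem sat_falsum : (BForm.falsum : BForm n).Sat v ↔ False := Iff.rfl
@[simp] theorem sat_eq : (BForm.eq s t).Sat v ↔ ev v s = ev v t := Iff.rfl
@[simp] theorem sat_mem : (BForm.mem s t).Sat v ↔ ev v s ε ev v t := Iff.rfl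
@[simp] theorem sat_imp : (BForm.imp φ ψ).Sat v ↔ (φ.Sat v → ψ.Sat v) := Iff.rfl
@[simp] theorem sat_ball :
    (BForm.ball t χ).Sat v ↔ ∀ x, x ε ev v t → χ.Sat (Fin.snoc v x) := Iff.rfl
@[simp] theorem sat_bex :
    (BForm.bex t χ).Sat v ↔ ∃ x, x ε ev v t ∧ χ.Sat (Fin.snoc v x) := Iff.rfl
@[simp] theorem sat_not : φ.not.Sat v ↔ ¬ φ.Sat v := Iff.rfl
@[simp] theorem sat_and : (φ.and ψ).Sat v ↔ φ.Sat v ∧ ψ.Sat v := by simp [BForm.and]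
@[simp] theorem sat_or : (φ.or ψ).Sat v ↔ φ.Sat v ∨ ψ.Sat v := by
  simp [BForm.or, or_iff_not_imp_left]
@[simp] theorem sat_iff : (φ.iff ψ).Sat v ↔ (φ.Sat v ↔ ψ.Sat v) := by
  simp only [BForm.iff, sat_and, sat_imp]; tauto

end Connectives

theorem sat_axiom [M ⊨ EAStar] {n : ℕ} {φ : BForm n} (h : EAMatrix φ) (v : Fin n → M) :
    φ.Sat v := by
  have h1 : M ⊨ φ.toBounded.alls := Theory.realize_sentence_of_mem EAStar ⟨n, φ, h, rfl⟩
  have h2 := BoundedFormula.realize_alls.1 h1 v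
  exact (realize_toBounded φ _ v).1 h2

/-! ### The operations of a model -/

/-- The empty set of a model. -/
def emp : M := Structure.funMap (L := LSet) (n := 0) Fn.empty ![]
/-- The power set. -/
def pow (x : M) : M := Structure.funMap (L := LSet) (n := 1) Fn.power ![x]
/-- The sum set. -/
def sun (x : M) : M := Structure.funMap (L := LSet) (n := 1) Fn.union ![x]
/-- The rank function. -/
def rk (x : M) : M := Structure.funMap (L := LSet) (n := 1) Fn.rank ![x]
/-- The pair set. -/
def pr (x y : M) : M := Structure.funMap (L := LSet) (n := 2) Fn.pair ![x, y]

variable {n : ℕ} (v : Fin n → M)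

@[simp] theorem ev_emptyT : ev v emptyT = emp := by
  rw [emptyT, ev_app]; exact congrArg _ (Subsingleton.elim _ _)
@[simp] theorem ev_powT (t : Tm n) : ev v (powT t) = pow (ev v t) := by
  rw [powT, ev_app, pow]; congr 1; funext i; fin_cases i; rfl
@[simp] theorem ev_sUnionT (t : Tm n) : ev v (sUnionT t) = sun (ev v t) := by
  rw [sUnionT, ev_app, sun]; congr 1; funext i; fin_cases i; rfl
@[simp] theorem ev_rankT (t : Tm n) : ev v (rankT t) = rk (ev v t) := by
  rw [rankT, ev_app, rk]; congr 1; funext i; fin_cases i; rfl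
@[simp] theorem ev_pairT (s t : Tm n) : ev v (pairT s t) = pr (ev v s) (ev v t) := by
  rw [pairT, ev_app, pr]; congr 1; funext i; fin_cases i <;> rfl

/-- The subset of `y` of all `u` with `P u`, if there is such a set; it is `y` if there is none. -/
noncomputable def sep (y : M) (P : M → Prop) : M :=
  open Classical in
  if h : ∃ z : M, ∀ u, u ε z ↔ u ε y ∧ P u then h.choose else y

variable [M ⊨ EAStar]

@[ext] theorem mem_ext {x y : M} (h : ∀ u, u ε x ↔ u ε y) : x = y := by
  have := sat_axiom EAMatrix.ext ![x, y]
  have e : ∀ u, ev (Fin.snoc ![x, y] u : Fin 3 → M) (Tm.up (.var 0)) = x := fun u => ev_up _ _ _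
  have e' : ∀ u, ev (Fin.snoc ![x, y] u : Fin 3 → M) (Tm.up (.var 1)) = y := fun u => ev_up _ _ _
  simp only [subset, sat_imp, sat_and, sat_ball, sat_mem, sat_eq, ev_new, e, e'] at this
  exact this ⟨fun u hu => (h u).1 hu, fun u hu => (h u).2 hu⟩

@[simp] theorem not_mem_emp (x : M) : ¬ x ε (emp : M) := by
  simpa using sat_axiom EAMatrix.empty ![x]

@[simp] theorem mem_pr {u x y : M} : u ε pr x y ↔ u = x ∨ u = y := by
  simpa using sat_axiom EAMatrix.pair ![x, y, u]

@[simp] theorem mem_sun {u x : M} : u ε sun x ↔ ∃ z, z ε x ∧ u ε z := by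
  have := sat_axiom EAMatrix.union ![x, u]
  simp only [sat_iff, sat_bex, sat_mem, ev_sUnionT] at this
  exact this

/-- Inclusion of sets of the model. -/
def Sub (x y : M) : Prop := ∀ u, u ε x → u ε y

/-- Inclusion of sets of the model. -/
infix:50 " ⊑ " => Sub

@[simp] theorem mem_pow {u x : M} : u ε pow x ↔ u ⊑ x := by
  have := sat_axiom EAMatrix.power ![x, u]
  simp only [sat_iff, subset, sat_ball, sat_mem, ev_powT] at this
  exact this

theorem foundation {x : M} (h : x ≠ emp) : ∃ y, y ε x ∧ ∀ z, z ε y → ¬ z ε x := by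
  have := sat_axiom EAMatrix.foundation ![x]
  simp only [sat_imp, sat_not, sat_eq, sat_ball, sat_bex, sat_mem, ev_emptyT] at this
  exact this h

theorem dom_holds (x : M) : Structure.RelMap (L := LSet) (n := 1) Rel.dom ![x] := by
  have := sat_axiom EAMatrix.dom ![x]
  simpa [BForm.Sat] using this

/-- The separation axiom for the function symbol of `φ`, with the parameters `c`. -/
theorem mem_funMap_sep {k : ℕ} (φ : BForm (k + 1)) (c : Fin k → M) (y z : M) :
    z ε Structure.funMap (L := LSet) (n := k + 1) (Fn.sep φ) (Fin.snoc c y : Fin (k + 1) → M) ↔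
      z ε y ∧ φ.Sat (Fin.snoc c z) := by
  have := sat_axiom (EAMatrix.sep φ) (Fin.snoc (Fin.snoc c y : Fin (k + 1) → M) z)
  simp only [sat_iff, sat_and, sat_mem, ev_new, ev_app, sat_rename, ev_var] at this
  convert this using 3
  · funext i; simp
  · simp
  · funext i
    refine Fin.lastCases ?_ (fun j => ?_) i <;> simp

theorem mem_sep_of_exists {y : M} {P : M → Prop} (h : ∃ z : M, ∀ u, u ε z ↔ u ε y ∧ P u) (u : M) :
    u ε sep y P ↔ u ε y ∧ P u := by
  rw [sep, dif_pos h]; exact h.choose_spec u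

theorem sep_eq {y : M} {P : M → Prop} {z : M} (h : ∀ u, u ε z ↔ u ε y ∧ P u) : sep y P = z :=
  mem_ext fun u => by rw [mem_sep_of_exists ⟨z, h⟩, h]

theorem mem_ev_sepT (t : Tm n) (φ : BForm (n + 1)) (u : M) :
    u ε ev v (sepT t φ) ↔ u ε ev v t ∧ φ.Sat (Fin.snoc v u) := by
  rw [sepT, ev_app, ← mem_funMap_sep]
  have : (fun i => ev v ((Fin.snoc Tm.var t : Fin (n + 1) → Tm n) i)) =
      (Fin.snoc v (ev v t) : Fin (n + 1) → M) := by
    funext i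
    refine Fin.lastCases ?_ (fun j => ?_) i <;> simp
  rw [this]

@[simp] theorem ev_sepT (t : Tm n) (φ : BForm (n + 1)) :
    ev v (sepT t φ) = sep (ev v t) fun u => φ.Sat (Fin.snoc v u) :=
  (sep_eq fun u => mem_ev_sepT v t φ u).symm

end Semantics

/-! ### Definability by bounded quantifier formulae -/

section Definability

variable {M : Type} [LSet.Structure M]

/-- A context `α` is an iterated product `Unit × M × ⋯ × M`; its elements are read as assignments
to finitely many variables. -/
class Ctx (M α : Type) where
  dim : ℕ
  val : α → Fin dim → M

instance ctxUnit : Ctx M Unit := ⟨0, fun _ => Fin.elim0⟩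

instance ctxProd {α : Type} [Ctx M α] : Ctx M (α × M) :=
  ⟨Ctx.dim M α + 1, fun p => Fin.snoc (Ctx.val p.1) p.2⟩

variable {α β : Type} [Ctx M α] [Ctx M β]

variable (M) in
/-- `f` is a projection of contexts, that is, it forgets and permutes variables. -/
class DCtx (f : β → α) : Prop where
  out : ∃ g : Fin (Ctx.dim M α) → Fin (Ctx.dim M β),
    ∀ b, (Ctx.val (f b) : Fin (Ctx.dim M α) → M) = Ctx.val b ∘ g

/-- `F` is the value of a term with parameters from `M`. -/
class Dfn (F : α → M) : Prop where
  out : ∃ (k : ℕ) (c : Fin k → M) (t : Tm (k + Ctx.dim M α)),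
    ∀ a, F a = ev (Fin.append c (Ctx.val a)) t

variable (M) in
/-- `P` is defined by a bounded quantifier formula with parameters from `M`. -/
class Dp (P : α → Prop) : Prop where
  out : ∃ (k : ℕ) (c : Fin k → M) (φ : BForm (k + Ctx.dim M α)),
    ∀ a, P a ↔ φ.Sat (Fin.append c (Ctx.val a))

/-- Definitions with parameters `c` and `e`, respectively, are brought to the common list of
parameters that consists of `c` and `e` by renaming their variables; this lemma and the next one
describe the effect on assignments. -/
theorem append_comp_left {k l d : ℕ} (c : Fin k → M) (e : Fin l → M) (w : Fin d → M) :
    Fin.append (Fin.append c e) w ∘ (Fin.addCases (fun i => Fin.castAdd d (Fin.castAdd l i))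
      (fun j => Fin.natAdd (k + l) j)) = Fin.append c w := by
  funext i
  refine Fin.addCases (fun i => ?_) (fun j => ?_) i <;> simp

theorem append_comp_right {k l d : ℕ} (c : Fin k → M) (e : Fin l → M) (w : Fin d → M) :
    Fin.append (Fin.append c e) w ∘ (Fin.addCases (fun i => Fin.castAdd d (Fin.natAdd k i))
      (fun j => Fin.natAdd (k + l) j)) = Fin.append e w := by
  funext i
  refine Fin.addCases (fun i => ?_) (fun j => ?_) i <;> simp

/-- Two definable functions have definitions with the same parameters. -/
theorem Dfn.common (F G : α → M) [hF : Dfn F] [hG : Dfn G] :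
    ∃ (k : ℕ) (c : Fin k → M) (s t : Tm (k + Ctx.dim M α)),
      (∀ a, F a = ev (Fin.append c (Ctx.val a)) s) ∧
        ∀ a, G a = ev (Fin.append c (Ctx.val a)) t := by
  obtain ⟨k, c, s, hs⟩ := hF.out
  obtain ⟨l, e, t, ht⟩ := hG.out
  exact ⟨k + l, Fin.append c e, s.rename _, t.rename _,
    fun a => by rw [hs, ev_rename, append_comp_left],
    fun a => by rw [ht, ev_rename, append_comp_right]⟩

theorem Dp.common (P Q : α → Prop) [hP : Dp M P] [hQ : Dp M Q] :
    ∃ (k : ℕ) (c : Fin k → M) (s t : BForm (k + Ctx.dim M α)),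
      (∀ a, P a ↔ s.Sat (Fin.append c (Ctx.val a))) ∧
        ∀ a, Q a ↔ t.Sat (Fin.append c (Ctx.val a)) := by
  obtain ⟨k, c, s, hs⟩ := hP.out
  obtain ⟨l, e, t, ht⟩ := hQ.out
  exact ⟨k + l, Fin.append c e, s.rename _, t.rename _,
    fun a => by rw [hs, sat_rename, append_comp_left],
    fun a => by rw [ht, sat_rename, append_comp_right]⟩

theorem val_prod (p : α × M) (k : ℕ) (c : Fin k → M) :
    (Fin.append c (Ctx.val p : Fin (Ctx.dim M (α × M)) → M) :
      Fin (k + Ctx.dim M (α × M)) → M) =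
      (Fin.snoc (Fin.append c (Ctx.val p.1)) p.2 : Fin (k + Ctx.dim M α + 1) → M) :=
  Fin.append_snoc _ _ _

/-- A function and a predicate with one more variable have definitions with the same
parameters. -/
theorem Dfn.common_bind (T : α → M) (P : α → M → Prop) [hT : Dfn T]
    [hP : Dp M fun p : α × M => P p.1 p.2] :
    ∃ (k : ℕ) (c : Fin k → M) (t : Tm (k + Ctx.dim M α)) (φ : BForm (k + Ctx.dim M α + 1)),
      (∀ a, T a = ev (Fin.append c (Ctx.val a)) t) ∧
        ∀ a x, P a x ↔ φ.Sat (Fin.snoc (Fin.append c (Ctx.val a)) x) := by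
  obtain ⟨k, c, s, hs⟩ := hT.out
  obtain ⟨l, e, t, ht⟩ := hP.out
  refine ⟨k + l, Fin.append c e, s.rename _, BForm.rename (n := l + Ctx.dim M (α × M))
    (m := k + l + Ctx.dim M (α × M)) (Fin.addCases
      (fun i => Fin.castAdd (Ctx.dim M (α × M)) (Fin.natAdd k i)) fun j => Fin.natAdd (k + l) j) t,
    fun a => by rw [hs, ev_rename, append_comp_left], fun a x => ?_⟩
  have := ht (a, x)
  rw [← append_comp_right c, ← sat_rename, val_prod] at this
  exact this

instance DCtx.id : DCtx M (fun b : β => b) := ⟨_root_.id, fun _ => rfl⟩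

instance DCtx.fst (f : β → α × M) [h : DCtx M f] : DCtx M (fun b => (f b).1) := by
  obtain ⟨g, hg⟩ := h.out
  refine ⟨fun i => g i.castSucc, fun b => ?_⟩
  funext i
  have := congrFun (hg b) i.castSucc
  simpa [Ctx.val] using this

/-- Variables are definable: they are the second components of contexts that are obtained from
the given one by forgetting variables. -/
instance Dfn.snd (f : β → α × M) [h : DCtx M f] : Dfn (fun b => (f b).2) := by
  obtain ⟨g, hg⟩ := h.out
  refine ⟨0, Fin.elim0, .var (Fin.natAdd 0 (g (Fin.last _))), fun b => ?_⟩
  have := congrFun (hg b) (Fin.last _)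
  simpa [Ctx.val] using this

instance (priority := high) Dfn.const (c : M) : Dfn (fun _ : α => c) :=
  ⟨1, fun _ => c, .var (Fin.castAdd _ 0), fun a => by simp⟩

instance (priority := high) Dp.const (p : Prop) : Dp M (fun _ : α => p) := by
  refine ⟨0, Fin.elim0, open Classical in if p then .imp .falsum .falsum else .falsum, fun a => ?_⟩
  split_ifs with h <;> simp [h]

theorem append_comp_ctx {k : ℕ} (c : Fin k → M) {f : β → α}
    {g : Fin (Ctx.dim M α) → Fin (Ctx.dim M β)}
    (hg : ∀ b, (Ctx.val (f b) : Fin (Ctx.dim M α) → M) = Ctx.val b ∘ g) (b : β) :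
    (Fin.append c (Ctx.val b) : Fin (k + Ctx.dim M β) → M) ∘
      (Fin.addCases (fun i => Fin.castAdd _ i) fun j => Fin.natAdd k (g j)) =
        Fin.append c (Ctx.val (f b)) := by
  funext i
  refine Fin.addCases (fun i => ?_) (fun j => ?_) i <;> simp [hg]

/-- A definable function stays definable when variables are added to the context. The low priority
reserves this rule for functions that are not built up from the operations of the model. -/
instance (priority := low) Dfn.comp (G : α → M) (f : β → α) [h : DCtx M f] [hG : Dfn G] :
    Dfn (fun b => G (f b)) := by
  obtain ⟨g, hg⟩ := h.out
  obtain ⟨k, c, t, ht⟩ := hG.out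
  exact ⟨k, c, t.rename _, fun b => by rw [ht, ev_rename, append_comp_ctx c hg]⟩

instance (priority := low) Dp.comp (P : α → Prop) (f : β → α) [h : DCtx M f] [hP : Dp M P] :
    Dp M (fun b => P (f b)) := by
  obtain ⟨g, hg⟩ := h.out
  obtain ⟨k, c, t, ht⟩ := hP.out
  exact ⟨k, c, t.rename _, fun b => by rw [ht, sat_rename, append_comp_ctx c hg]⟩

section Instances

variable (F G : α → M) [Dfn F] [Dfn G] (P Q : α → Prop) [Dp M P] [Dp M Q]

instance Dp.mem : Dp M (fun a => F a ε G a) := by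
  obtain ⟨k, c, s, t, hs, ht⟩ := Dfn.common F G
  exact ⟨k, c, .mem s t, fun a => by rw [hs, ht, sat_mem]⟩

instance Dp.eq : Dp M (fun a => F a = G a) := by
  obtain ⟨k, c, s, t, hs, ht⟩ := Dfn.common F G
  exact ⟨k, c, .eq s t, fun a => by rw [hs, ht, sat_eq]⟩

instance Dp.imp : Dp M (fun a => P a → Q a) := by
  obtain ⟨k, c, s, t, hs, ht⟩ := Dp.common (M := M) P Q
  exact ⟨k, c, s.imp t, fun a => by rw [hs, ht, sat_imp]⟩

instance Dp.and : Dp M (fun a => P a ∧ Q a) := by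
  obtain ⟨k, c, s, t, hs, ht⟩ := Dp.common (M := M) P Q
  exact ⟨k, c, s.and t, fun a => by rw [hs, ht, sat_and]⟩

instance Dp.or : Dp M (fun a => P a ∨ Q a) := by
  obtain ⟨k, c, s, t, hs, ht⟩ := Dp.common (M := M) P Q
  exact ⟨k, c, s.or t, fun a => by rw [hs, ht, sat_or]⟩

instance Dp.iff : Dp M (fun a => P a ↔ Q a) := by
  obtain ⟨k, c, s, t, hs, ht⟩ := Dp.common (M := M) P Q
  exact ⟨k, c, s.iff t, fun a => by rw [hs, ht, sat_iff]⟩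

variable (R : α → M → Prop) [Dp M fun p : α × M => R p.1 p.2]

instance Dp.ball : Dp M (fun a => ∀ x, x ε F a → R a x) := by
  obtain ⟨k, c, t, φ, ht, hφ⟩ := Dfn.common_bind F R
  exact ⟨k, c, .ball t φ, fun a => by simp only [sat_ball, ht, hφ]⟩

instance Dp.bex : Dp M (fun a => ∃ x, x ε F a ∧ R a x) := by
  obtain ⟨k, c, t, φ, ht, hφ⟩ := Dfn.common_bind F R
  exact ⟨k, c, .bex t φ, fun a => by simp only [sat_bex, ht, hφ]⟩

instance Dfn.pow : Dfn (fun a => pow (F a)) := by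
  obtain ⟨k, c, s, t, hs, ht⟩ := Dfn.common F F
  exact ⟨k, c, powT s, fun a => by rw [hs, ev_powT]⟩

instance Dfn.sun : Dfn (fun a => sun (F a)) := by
  obtain ⟨k, c, s, t, hs, ht⟩ := Dfn.common F F
  exact ⟨k, c, sUnionT s, fun a => by rw [hs, ev_sUnionT]⟩

instance Dfn.rk : Dfn (fun a => rk (F a)) := by
  obtain ⟨k, c, s, t, hs, ht⟩ := Dfn.common F F
  exact ⟨k, c, rankT s, fun a => by rw [hs, ev_rankT]⟩

instance Dfn.pr : Dfn (fun a => pr (F a) (G a)) := by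
  obtain ⟨k, c, s, t, hs, ht⟩ := Dfn.common F G
  exact ⟨k, c, pairT s t, fun a => by rw [hs, ht, ev_pairT]⟩

instance Dp.sub : Dp M (fun a => F a ⊑ G a) := by
  unfold Sub; infer_instance

variable [M ⊨ EAStar]

instance Dfn.sep : Dfn (fun a => sep (F a) (R a)) := by
  obtain ⟨k, c, t, φ, ht, hφ⟩ := Dfn.common_bind F R
  exact ⟨k, c, sepT t φ, fun a => by simp only [ev_sepT, ht, ← hφ]⟩

end Instances

variable [M ⊨ EAStar]

/-- Separation for predicates that are definable with parameters. -/
@[simp] theorem mem_sep {y u : M} {P : M → Prop} [h : Dp M fun p : Unit × M => P p.2] :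
    u ε sep y P ↔ u ε y ∧ P u := by
  refine mem_sep_of_exists ?_ u
  obtain ⟨k, c, t, φ, ht, hφ⟩ := Dfn.common_bind (α := Unit) (fun _ => y) fun _ => P
  refine ⟨ev (Fin.append c (Ctx.val ())) (sepT t φ), fun u => ?_⟩
  rw [ht (), hφ () u]
  exact mem_ev_sepT _ t φ u

end Definability

section Definability

variable {M : Type} [LSet.Structure M] {α β : Type} [Ctx M α] [Ctx M β]

/-- A projection of contexts can be extended by one more variable. -/
theorem DCtx.pair (f : β → α) (g : β → M) [h : DCtx M f] (j : Fin (Ctx.dim M β))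
    (hg : ∀ b, g b = Ctx.val b j) : DCtx M (fun b => (f b, g b)) := by
  obtain ⟨k, hk⟩ := h.out
  refine ⟨(Fin.snoc k j : Fin (Ctx.dim M α + 1) → _), fun b => ?_⟩
  funext i
  have : ∀ i : Fin (Ctx.dim M α + 1), (Fin.snoc (Ctx.val (f b)) (g b) : _ → M) i =
      Ctx.val b ((Fin.snoc k j : Fin (Ctx.dim M α + 1) → _) i) := by
    intro i
    refine Fin.lastCases ?_ (fun j => ?_) i <;> simp [hk, hg]
  exact this i

theorem DCtx.exists_index (f : β → α × M) [h : DCtx M f] :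
    ∃ j : Fin (Ctx.dim M β), ∀ b, (f b).2 = Ctx.val b j := by
  obtain ⟨g, hg⟩ := h.out
  refine ⟨g (Fin.last _), fun b => ?_⟩
  have := congrFun (hg b) (Fin.last _)
  simpa [Ctx.val] using this

instance DCtx.unit : DCtx M (fun _ : β => ()) := ⟨Fin.elim0, fun _ => funext fun i => i.elim0⟩

instance (priority := low) Dfn.comp₁ (F : M → M) (f : β → α × M) [DCtx M f]
    [h : Dfn fun p : Unit × M => F p.2] : Dfn (fun b => F (f b).2) := by
  obtain ⟨j, hj⟩ := DCtx.exists_index f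
  have := DCtx.pair (fun _ : β => ()) (fun b => (f b).2) j hj
  exact Dfn.comp (fun p : Unit × M => F p.2) fun b => ((), (f b).2)

instance (priority := low) Dp.comp₂ {γ : Type} [Ctx M γ] (P : M → M → Prop) (f : β → α × M)
    (g : β → γ × M) [DCtx M f] [DCtx M g]
    [h : Dp M fun p : (Unit × M) × M => P p.1.2 p.2] : Dp M (fun b => P (f b).2 (g b).2) := by
  obtain ⟨j, hj⟩ := DCtx.exists_index f
  obtain ⟨k, hk⟩ := DCtx.exists_index g
  have := DCtx.pair (fun _ : β => ()) (fun b => (f b).2) j hj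
  have := DCtx.pair (fun b : β => ((), (f b).2)) (fun b => (g b).2) k hk
  exact Dp.comp (fun p : (Unit × M) × M => P p.1.2 p.2) fun b => (((), (f b).2), (g b).2)

end Definability

/-! ### Pairs, products and functions -/

section Sets

variable {M : Type} [LSet.Structure M]

/-- The singleton of `x`. -/
def sing (x : M) : M := pr x x
/-- The union of `x` and `y`. -/
def uni (x y : M) : M := sun (pr x y)
/-- The set `x` with the additional element `p`. -/
def ins (x p : M) : M := uni x (sing p)
/-- The Kuratowski ordered pair. -/
def op (x y : M) : M := pr (sing x) (pr x y)
/-- The Cartesian product. -/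
noncomputable def prod (a b : M) : M :=
  sep (pow (pow (uni a b))) fun w => ∃ u, u ε a ∧ ∃ v, v ε b ∧ w = op u v
/-- The unique element of `t` with the property `P`, if there is exactly one (`thee_eq`). -/
noncomputable def thee (t : M) (P : M → Prop) : M := sun (sep t P)
/-- The difference of sets. -/
noncomputable def diff (a b : M) : M := sep a fun u => ¬ u ε b
/-- The value at `u` of the function `f`. -/
noncomputable def app (f u : M) : M := thee (sun (sun f)) fun v => op u v ε f

/-- `f` is a function from `a` to `b`. -/
def IsFun (f a b : M) : Prop :=
  f ⊑ prod a b ∧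
    ∀ u, u ε a → ∃ v, v ε b ∧ op u v ε f ∧ ∀ w, w ε b → op u w ε f → w = v
/-- `f` is one-one, as a function from `a` to `b`. -/
def IsInj (f a b : M) : Prop :=
  ∀ u, u ε a → ∀ w, w ε a → ∀ v, v ε b → op u v ε f ∧ op w v ε f → u = w
/-- There is an injection from `a` into `b`. -/
def CardLe (a b : M) : Prop := ∃ f, f ε pow (prod a b) ∧ IsFun f a b ∧ IsInj f a b
/-- `a` and `b` are equinumerous: there are injections both ways. -/
def CardEq (a b : M) : Prop := CardLe a b ∧ CardLe b a

section Instances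

variable [M ⊨ EAStar] {α : Type} [Ctx M α] (F G H : α → M) [Dfn F] [Dfn G] [Dfn H]
  (R : α → M → Prop) [Dp M fun p : α × M => R p.1 p.2]

instance Dfn.sing : Dfn (fun a => sing (F a)) := by unfold FinSetTheory.sing; infer_instance
instance Dfn.uni : Dfn (fun a => uni (F a) (G a)) := by unfold FinSetTheory.uni; infer_instance
instance Dfn.ins : Dfn (fun a => ins (F a) (G a)) := by unfold FinSetTheory.ins; infer_instance
instance Dfn.op : Dfn (fun a => op (F a) (G a)) := by unfold FinSetTheory.op; infer_instance
instance Dfn.prod : Dfn (fun a => prod (F a) (G a)) := by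
  unfold FinSetTheory.prod; infer_instance
instance Dfn.thee : Dfn (fun a => thee (F a) (R a)) := by
  unfold FinSetTheory.thee; infer_instance
instance Dfn.app : Dfn (fun a => app (F a) (G a)) := by unfold FinSetTheory.app; infer_instance
instance Dp.isFun : Dp M (fun a => IsFun (F a) (G a) (H a)) := by unfold IsFun; infer_instance
instance Dp.isInj : Dp M (fun a => IsInj (F a) (G a) (H a)) := by unfold IsInj; infer_instance
instance Dp.cardLe : Dp M (fun a => CardLe (F a) (G a)) := by unfold CardLe; infer_instance
instance Dp.cardEq : Dp M (fun a => CardEq (F a) (G a)) := by unfold CardEq; infer_instance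

end Instances

variable [M ⊨ EAStar]

section Evaluation

variable {n : ℕ} (v : Fin n → M) (s t f a b : Tm n)

@[simp] theorem sat_subset : (subset s t).Sat v ↔ ev v s ⊑ ev v t := by
  simp [subset, Sub]
@[simp] theorem ev_singT : ev v (singT t) = sing (ev v t) := by simp [singT, sing]
@[simp] theorem ev_unionT : ev v (unionT s t) = uni (ev v s) (ev v t) := by simp [unionT, uni]
@[simp] theorem ev_opairT : ev v (opairT s t) = op (ev v s) (ev v t) := by simp [opairT, op]
@[simp] theorem ev_prodT : ev v (prodT s t) = prod (ev v s) (ev v t) := by simp [prodT, prod]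
@[simp] theorem ev_the (φ : BForm (n + 1)) :
    ev v (the t φ) = thee (ev v t) fun u => φ.Sat (Fin.snoc v u) := by simp [the, thee]
@[simp] theorem sat_isFun : (isFun f a b).Sat v ↔ IsFun (ev v f) (ev v a) (ev v b) := by
  simp [isFun, IsFun]
@[simp] theorem sat_isInj : (isInj f a b).Sat v ↔ IsInj (ev v f) (ev v a) (ev v b) := by
  simp [isInj, IsInj]
@[simp] theorem sat_cardLe : (cardLe a b).Sat v ↔ CardLe (ev v a) (ev v b) := by
  simp [cardLe, CardLe]
@[simp] theorem sat_cardEq : (cardEq a b).Sat v ↔ CardEq (ev v a) (ev v b) := by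
  simp [cardEq, CardEq]

end Evaluation

@[simp] theorem mem_sing {u x : M} : u ε sing x ↔ u = x := by simp [sing]
@[simp] theorem mem_uni {u x y : M} : u ε uni x y ↔ u ε x ∨ u ε y := by simp [uni]
@[simp] theorem mem_ins {u x p : M} : u ε ins x p ↔ u ε x ∨ u = p := by simp [ins]
@[simp] theorem mem_diff {u x y : M} : u ε diff x y ↔ u ε x ∧ ¬ u ε y := by simp [diff]

theorem Sub.refl (x : M) : x ⊑ x := fun _ h => h
theorem Sub.trans {x y z : M} (h : x ⊑ y) (h' : y ⊑ z) : x ⊑ z := fun u hu => h' u (h u hu)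
theorem Sub.antisymm {x y : M} (h : x ⊑ y) (h' : y ⊑ x) : x = y :=
  mem_ext fun u => ⟨h u, h' u⟩
theorem emp_sub (x : M) : emp ⊑ x := fun u hu => (not_mem_emp u hu).elim

theorem eq_emp {x : M} (h : ∀ u, ¬ u ε x) : x = emp := mem_ext fun u => by simp [h u]
theorem exists_mem_of_ne {x : M} (h : x ≠ emp) : ∃ u, u ε x := by
  by_contra! h'; exact h (eq_emp h')

theorem not_mem_self (x : M) : ¬ x ε x := by
  intro h
  obtain ⟨y, hy, h'⟩ := foundation (x := sing x) fun e => not_mem_emp x (e ▸ mem_sing.2 rfl)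
  rw [mem_sing] at hy
  exact h' x (hy ▸ h) (mem_sing.2 rfl)

theorem sing_inj {x y : M} (h : sing x = sing y) : x = y :=
  mem_sing.1 (h ▸ mem_sing.2 rfl : x ε sing y)

theorem op_inj {x y x' y' : M} : op x y = op x' y' ↔ x = x' ∧ y = y' := by
  refine ⟨fun h => ?_, fun h => by rw [h.1, h.2]⟩
  have h1 : ∀ w : M, (w = sing x ∨ w = pr x y) ↔ (w = sing x' ∨ w = pr x' y') := fun w => by
    rw [← mem_pr, ← mem_pr]; exact iff_of_eq (congrArg (w ε ·) h)
  have hx : x = x' := by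
    rcases (h1 (sing x)).1 (.inl rfl) with e | e
    · exact sing_inj e
    · exact (mem_sing.1 (e ▸ mem_pr.2 (.inl rfl) : x' ε sing x)).symm
  subst hx
  have e1 : ∀ u v w : M, pr u v = pr u w → v = w := by
    intro u v w e
    have h1 : v ε pr u w := e ▸ mem_pr.2 (.inr rfl)
    have h2 : w ε pr u v := e ▸ mem_pr.2 (.inr rfl)
    rw [mem_pr] at h1 h2
    grind
  refine ⟨rfl, ?_⟩
  rcases (h1 (pr x y)).1 (.inr rfl) with e | e
  · rcases (h1 (pr x y')).2 (.inr rfl) with e' | e'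
    · exact e1 x y y' (e.trans e'.symm)
    · exact (e1 _ _ _ e').symm
  · exact e1 _ _ _ e

theorem mem_prod {w a b : M} : w ε prod a b ↔ ∃ u, u ε a ∧ ∃ v, v ε b ∧ w = op u v := by
  rw [prod, mem_sep, and_iff_right_iff_imp]
  rintro ⟨u, hu, v, hv, rfl⟩
  rw [mem_pow]
  intro z hz
  rw [op, mem_pr] at hz
  rw [mem_pow]
  intro x hx
  rw [mem_uni]
  rcases hz with rfl | rfl
  · rw [mem_sing] at hx; exact .inl (hx ▸ hu)
  · rw [mem_pr] at hx
    rcases hx with rfl | rfl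
    · exact .inl hu
    · exact .inr hv

@[simp] theorem op_mem_prod {u v a b : M} : op u v ε prod a b ↔ u ε a ∧ v ε b := by
  simp only [mem_prod, op_inj]; grind

theorem thee_eq {t z : M} {P : M → Prop} [Dp M fun p : Unit × M => P p.2] (hz : z ε t) (hP : P z)
    (h : ∀ u, u ε t → P u → u = z) : thee t P = z := by
  refine mem_ext fun u => ?_
  rw [thee, mem_sun]
  refine ⟨fun ⟨w, hw, hu⟩ => ?_, fun hu => ⟨z, mem_sep.2 ⟨hz, hP⟩, hu⟩⟩
  rw [mem_sep] at hw
  rwa [← h w hw.1 hw.2]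

theorem mem_sun_sun {f u v : M} (h : op u v ε f) : u ε sun (sun f) ∧ v ε sun (sun f) := by
  have : pr u v ε sun f := mem_sun.2 ⟨_, h, mem_pr.2 (.inr rfl)⟩
  exact ⟨mem_sun.2 ⟨_, this, mem_pr.2 (.inl rfl)⟩, mem_sun.2 ⟨_, this, mem_pr.2 (.inr rfl)⟩⟩

theorem IsFun.app_eq {f a b u v : M} (h : IsFun f a b) (huv : op u v ε f) : app f u = v := by
  have hp := fun w (hw : op u w ε f) => op_mem_prod.1 (h.1 _ hw)
  obtain ⟨w, hw, hw', e⟩ := h.2 u (hp v huv).1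
  refine thee_eq (mem_sun_sun huv).2 huv fun x _ hx => ?_
  rw [e v (hp v huv).2 huv, e x (hp x hx).2 hx]

theorem IsFun.op_app {f a b u : M} (h : IsFun f a b) (hu : u ε a) : op u (app f u) ε f := by
  obtain ⟨w, hw, hw', e⟩ := h.2 u hu
  rwa [h.app_eq hw']

theorem IsFun.app_mem {f a b u : M} (h : IsFun f a b) (hu : u ε a) : app f u ε b :=
  (op_mem_prod.1 (h.1 _ (h.op_app hu))).2

/-- The graph on `a` of a definable function. -/
noncomputable def graph (a b : M) (F : M → M) : M :=
  sep (prod a b) fun w => ∃ u, u ε a ∧ w = op u (F u)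

section Graph

variable {a b : M} {F : M → M} [Dfn fun p : Unit × M => F p.2]

theorem op_mem_graph {u v : M} : op u v ε graph a b F ↔ u ε a ∧ v ε b ∧ v = F u := by
  rw [graph, mem_sep, op_mem_prod]
  simp only [op_inj]; grind

theorem isFun_graph (h : ∀ u, u ε a → F u ε b) : IsFun (graph a b F) a b := by
  refine ⟨fun w hw => (mem_sep.1 hw).1, fun u hu => ⟨F u, h u hu, ?_, fun w _ hw => ?_⟩⟩
  · exact op_mem_graph.2 ⟨hu, h u hu, rfl⟩
  · exact (op_mem_graph.1 hw).2.2

theorem CardLe.intro (F : M → M) [Dfn fun p : Unit × M => F p.2] (h : ∀ u, u ε a → F u ε b)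
    (h' : ∀ u, u ε a → ∀ w, w ε a → F u = F w → u = w) : CardLe a b := by
  refine ⟨graph a b F, mem_pow.2 (isFun_graph h).1, isFun_graph h, fun u hu w hw v _ hv => ?_⟩
  rw [op_mem_graph, op_mem_graph] at hv
  exact h' u hu w hw (hv.1.2.2.symm.trans hv.2.2.2)

end Graph

/-- An injection of the model, as the definable function `app f`. -/
theorem CardLe.elim {a b : M} (h : CardLe a b) : ∃ f : M, (∀ u, u ε a → app f u ε b) ∧
    ∀ u, u ε a → ∀ w, w ε a → app f u = app f w → u = w := by
  obtain ⟨f, _, hf, hi⟩ := h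
  refine ⟨f, fun u hu => hf.app_mem hu, fun u hu w hw e => ?_⟩
  exact hi u hu w hw _ (hf.app_mem hu) ⟨hf.op_app hu, e ▸ hf.op_app hw⟩

theorem CardLe.of_sub {a b : M} (h : a ⊑ b) : CardLe a b :=
  CardLe.intro (fun u => u) h fun _ _ _ _ e => e

theorem CardLe.refl (a : M) : CardLe a a := CardLe.of_sub (Sub.refl a)

theorem CardLe.trans {a b c : M} (h : CardLe a b) (h' : CardLe b c) : CardLe a c := by
  obtain ⟨f, hf, hf'⟩ := h.elim
  obtain ⟨g, hg, hg'⟩ := h'.elim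
  exact CardLe.intro (fun u => app g (app f u)) (fun u hu => hg _ (hf u hu)) fun u hu w hw e =>
    hf' u hu w hw (hg' _ (hf u hu) _ (hf w hw) e)

theorem CardEq.refl (a : M) : CardEq a a := ⟨CardLe.refl a, CardLe.refl a⟩
theorem CardEq.symm {a b : M} (h : CardEq a b) : CardEq b a := ⟨h.2, h.1⟩
theorem CardEq.trans {a b c : M} (h : CardEq a b) (h' : CardEq b c) : CardEq a c :=
  ⟨h.1.trans h'.1, h'.2.trans h.2⟩

/-- A definable bijection yields equinumerosity. -/
theorem CardEq.intro {a b : M} (F : M → M) [Dfn fun p : Unit × M => F p.2]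
    (h : ∀ u, u ε a → F u ε b) (h' : ∀ u, u ε a → ∀ w, w ε a → F u = F w → u = w)
    (h'' : ∀ v, v ε b → ∃ u, u ε a ∧ F u = v) : CardEq a b := by
  refine ⟨CardLe.intro F h h', CardLe.intro (fun v => thee a fun u => F u = v) ?_ ?_⟩
  · intro v hv
    obtain ⟨u, hu, e⟩ := h'' v hv
    rw [thee_eq (P := fun u => F u = v) hu e fun w hw e' => h' w hw u hu (e'.trans e.symm)]
    exact hu
  · intro v hv w hw e
    obtain ⟨u, hu, rfl⟩ := h'' v hv
    obtain ⟨x, hx, rfl⟩ := h'' w hw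
    rw [thee_eq (P := fun z => F z = F u) hu rfl fun w hw e' => h' w hw u hu e',
      thee_eq (P := fun z => F z = F x) hx rfl fun w hw e' => h' w hw x hx e'] at e
    rw [e]

/-- Dedekind finiteness for definable functions. -/
theorem exists_of_injective {a : M} (F : M → M) [Dfn fun p : Unit × M => F p.2]
    (h : ∀ u, u ε a → F u ε a) (h' : ∀ u, u ε a → ∀ w, w ε a → F u = F w → u = w) {v : M}
    (hv : v ε a) : ∃ u, u ε a ∧ F u = v := by
  have hf := isFun_graph h
  have := sat_axiom EAMatrix.dedekind ![a, graph a a F]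
  simp only [sat_imp, sat_and, sat_isFun, sat_isInj, isSurj, sat_ball, sat_bex, sat_mem,
    ev_opairT, ev_up, ev_new] at this
  obtain ⟨u, hu, hu'⟩ := this ⟨hf, fun u hu w hw v _ hv => by
    have h1 := op_mem_graph.1 hv.1
    have h2 := op_mem_graph.1 hv.2
    exact h' u hu w hw (h1.2.2.symm.trans h2.2.2)⟩ v hv
  exact ⟨u, hu, (op_mem_graph.1 hu').2.2.symm⟩

/-- A set has no injection into a proper subset. -/
theorem not_cardLe_of_ssub {a b p : M} (h : a ⊑ b) (hp : p ε b) (hp' : ¬ p ε a) :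
    ¬ CardLe b a := by
  intro hc
  obtain ⟨f, hf, hf'⟩ := hc.elim
  obtain ⟨u, hu, e⟩ := exists_of_injective (app f) (fun u hu => h _ (hf u hu)) hf' hp
  exact hp' (e ▸ hf u hu)

end Sets

/-! ### Induction on finite sets -/

section Induction

variable {M : Type} [LSet.Structure M] [M ⊨ EAStar]

/-- Definition by cases: the value is the set of those `u` in the union of both values that are in
the right one. -/
instance Dfn.ite {α : Type} [Ctx M α] (P : α → Prop) [∀ a, Decidable (P a)] (F G : α → M)
    [Dp M P] [Dfn F] [Dfn G] : Dfn (fun a => if P a then F a else G a) := by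
  have h : (fun a => if P a then F a else G a) = fun a => FinSetTheory.sep (FinSetTheory.uni (F a) (G a)) fun u =>
      (P a ∧ u ε F a) ∨ (¬ P a ∧ u ε G a) := by
    funext a
    ext u
    by_cases h : P a <;> simp [h] <;> tauto
  rw [h]
  infer_instance

theorem cardLe_ins {b c p q : M} (hq : ¬ q ε c) (h : CardLe b c) :
    CardLe (ins b p) (ins c q) := by
  classical
  by_cases hp : p ε b
  · have : ins b p = b := mem_ext fun u => by
      rw [mem_ins, or_iff_left_iff_imp]; rintro rfl; exact hp
    rw [this]
    exact h.trans (CardLe.of_sub fun u hu => mem_ins.2 (.inl hu))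
  obtain ⟨f, hf, hf'⟩ := h.elim
  refine CardLe.intro (fun u => if u = p then q else app f u) ?_ ?_
  · intro u hu
    rw [mem_ins] at hu
    by_cases e : u = p
    · simp [e]
    · simp [e, hf u (hu.resolve_right e)]
  · intro u hu w hw e
    rw [mem_ins] at hu hw
    by_cases e1 : u = p <;> by_cases e2 : w = p <;> simp only [e1, e2, if_true, if_false] at e ⊢
    · exact (hq (e ▸ hf w (hw.resolve_right e2))).elim
    · exact (hq (e ▸ hf u (hu.resolve_right e1))).elim
    · exact hf' u (hu.resolve_right e1) w (hw.resolve_right e2) e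

theorem cardLe_of_ins {b c p q : M} (hp : ¬ p ε b) (h : CardLe (ins b p) (ins c q)) :
    CardLe b c := by
  classical
  obtain ⟨f, hf, hf'⟩ := h.elim
  have hb : ∀ u, u ε b → u ε ins b p := fun u hu => mem_ins.2 (.inl hu)
  have hpp : p ε ins b p := mem_ins.2 (.inr rfl)
  have hne : ∀ u, u ε b → u ≠ p := fun u hu e => hp (e ▸ hu)
  -- An element that is sent to `q` is redirected to the value at `p`.
  refine CardLe.intro (fun u => if app f u = q then app f p else app f u) ?_ ?_
  · intro u hu
    by_cases e : app f u = q
    · have h1 := mem_ins.1 (hf p hpp)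
      simp only [e, if_true]
      refine h1.resolve_right fun e' => hne u hu (hf' u (hb u hu) p hpp (e.trans e'.symm))
    · simpa [e] using (mem_ins.1 (hf u (hb u hu))).resolve_right e
  · intro u hu w hw e
    by_cases e1 : app f u = q <;> by_cases e2 : app f w = q <;>
      simp only [e1, e2, if_true, if_false] at e
    · exact hf' u (hb u hu) w (hb w hw) (e1.trans e2.symm)
    · exact (hne w hw (hf' w (hb w hw) p hpp e.symm)).elim
    · exact (hne u hu (hf' u (hb u hu) p hpp e)).elim
    · exact hf' u (hb u hu) w (hb w hw) e

theorem cardEq_ins {b c p q : M} (hp : ¬ p ε b) (hq : ¬ q ε c) :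
    CardEq (ins b p) (ins c q) ↔ CardEq b c :=
  ⟨fun h => ⟨cardLe_of_ins hp h.1, cardLe_of_ins hq h.2⟩,
    fun h => ⟨cardLe_ins hq h.1, cardLe_ins hp h.2⟩⟩

/-- The family `X` contains the empty set and is closed under adding an element of `a`. -/
def Inductive (a X : M) : Prop := emp ε X ∧ ∀ c, c ε X → ∀ p, p ε a → ins c p ε X

instance Dp.inductive {α : Type} [Ctx M α] (F G : α → M) [Dfn F] [Dfn G] :
    Dp M (fun a => Inductive (F a) (G a)) := by unfold Inductive; infer_instance

/-- The least inductive family of subsets of `a`. -/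
noncomputable def finSubsets (a : M) : M :=
  sep (pow a) fun b => ∀ X, X ε pow (pow a) → Inductive a X → b ε X

theorem mem_finSubsets {a b : M} :
    b ε finSubsets a ↔ b ⊑ a ∧ ∀ X, X ⊑ pow a → Inductive a X → b ε X := by
  rw [finSubsets, mem_sep]
  simp only [mem_pow]

theorem ins_sub {a b p : M} (h : b ⊑ a) (hp : p ε a) : ins b p ⊑ a := by
  intro u hu
  rcases mem_ins.1 hu with hu | rfl
  exacts [h u hu, hp]

theorem inductive_finSubsets (a : M) : Inductive a (finSubsets a) := by
  refine ⟨mem_finSubsets.2 ⟨emp_sub a, fun X _ h => h.1⟩, fun c hc p hp => ?_⟩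
  rw [mem_finSubsets] at hc ⊢
  exact ⟨ins_sub hc.1 hp, fun X hX h => h.2 c (hc.2 X hX h) p hp⟩

/-- The equinumerosity class of `b` in the family `F`. -/
noncomputable def cardClass (F b : M) : M := sep F fun c => CardEq c b

instance Dfn.cardClass {α : Type} [Ctx M α] (F G : α → M) [Dfn F] [Dfn G] :
    Dfn (fun a => cardClass (F a) (G a)) := by unfold FinSetTheory.cardClass; infer_instance

theorem cardClass_eq_iff {F b c : M} (hb : b ε F) :
    cardClass F b = cardClass F c ↔ CardEq b c := by
  constructor
  · intro h
    have : b ε cardClass F b := mem_sep.2 ⟨hb, CardEq.refl b⟩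
    rw [h] at this
    exact (mem_sep.1 this).2
  · intro h
    ext u
    simp only [cardClass, mem_sep]
    exact and_congr_right fun _ => ⟨fun h' => h'.trans h, fun h' => h'.trans h.symm⟩

/-- Every set belongs to the least inductive family of its subsets. Otherwise every member of that
family could be enlarged, and sending the cardinality of a member to that of an enlargement would
be an injection of the set of cardinalities into itself that omits the cardinality of `∅`. -/
theorem mem_finSubsets_self (a : M) : a ε finSubsets a := by
  by_contra ha
  have hi := inductive_finSubsets a
  have hext : ∀ b, b ε finSubsets a → ∃ p, p ε a ∧ ¬ p ε b := by
    intro b hb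
    by_contra! h
    exact ha (Sub.antisymm (mem_finSubsets.1 hb).1 h ▸ hb)
  set F := finSubsets a with hF
  set Q := sep (pow F) fun q => ∃ b, b ε F ∧ q = cardClass F b with hQ
  have hmem : ∀ b, b ε F → cardClass F b ε Q := fun b hb =>
    mem_sep.2 ⟨mem_pow.2 fun u hu => (mem_sep.1 hu).1, b, hb, rfl⟩
  -- `G` sends the cardinality of `b` to that of `b ∪ {p}`, for any `p` in `a` outside `b`.
  let G : M → M := fun q => thee Q fun r => ∃ b, b ε F ∧ ∃ p, p ε a ∧
    ¬ p ε b ∧ q = cardClass F b ∧ r = cardClass F (ins b p)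
  have hG : ∀ b p, b ε F → p ε a → ¬ p ε b → G (cardClass F b) = cardClass F (ins b p) := by
    intro b p hb hp hpb
    refine thee_eq (P := fun r => ∃ c, c ε F ∧ ∃ p, p ε a ∧
      ¬ p ε c ∧ cardClass F b = cardClass F c ∧ r = cardClass F (ins c p))
      (hmem _ (hi.2 b hb p hp)) ⟨b, hb, p, hp, hpb, rfl, rfl⟩ ?_
    rintro u - ⟨c, hc, q, hq, hqc, e, rfl⟩
    rw [cardClass_eq_iff hb] at e
    rw [cardClass_eq_iff (hi.2 c hc q hq), cardEq_ins hqc hpb]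
    exact e.symm
  have hmaps : ∀ q, q ε Q → G q ε Q := by
    intro q hq
    obtain ⟨-, b, hb, rfl⟩ := mem_sep.1 hq
    obtain ⟨p, hp, hpb⟩ := hext b hb
    rw [hG b p hb hp hpb]
    exact hmem _ (hi.2 b hb p hp)
  have hinj : ∀ q, q ε Q → ∀ r, r ε Q → G q = G r → q = r := by
    intro q hq r hr e
    obtain ⟨-, b, hb, rfl⟩ := mem_sep.1 hq
    obtain ⟨-, c, hc, rfl⟩ := mem_sep.1 hr
    obtain ⟨p, hp, hpb⟩ := hext b hb
    obtain ⟨p', hp', hpc⟩ := hext c hc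
    rw [hG b p hb hp hpb, hG c p' hc hp' hpc, cardClass_eq_iff (hi.2 b hb p hp),
      cardEq_ins hpb hpc] at e
    exact (cardClass_eq_iff hb).2 e
  -- By Dedekind finiteness the cardinality of `∅` is a value of `G`, which is impossible.
  obtain ⟨q, hq, e⟩ := exists_of_injective G hmaps hinj (hmem _ hi.1)
  obtain ⟨-, b, hb, rfl⟩ := mem_sep.1 hq
  obtain ⟨p, hp, hpb⟩ := hext b hb
  rw [hG b p hb hp hpb, cardClass_eq_iff (hi.2 b hb p hp)] at e
  obtain ⟨f, hf, -⟩ := e.1.elim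
  exact not_mem_emp _ (hf p (mem_ins.2 (.inr rfl)))

/-- Induction on finite sets. -/
theorem finite_induction (a : M) (P : M → Prop) [Dp M fun p : Unit × M => P p.2] (h0 : P emp)
    (hs : ∀ c p, c ⊑ a → p ε a → ¬ p ε c → P c → P (ins c p)) : P a := by
  have h := (mem_finSubsets.1 (mem_finSubsets_self a)).2 (sep (pow a) P)
    (fun u hu => (mem_sep.1 hu).1) ?_
  · exact (mem_sep.1 h).2
  refine ⟨mem_sep.2 ⟨mem_pow.2 (emp_sub a), h0⟩, fun c hc p hp => ?_⟩
  rw [mem_sep, mem_pow] at hc ⊢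
  refine ⟨ins_sub hc.1 hp, ?_⟩
  by_cases hpc : p ε c
  · have : ins c p = c := mem_ext fun u => by
      rw [mem_ins, or_iff_left_iff_imp]; rintro rfl; exact hpc
    rw [this]; exact hc.2
  · exact hs c p hc.1 hp hpc hc.2

/-- A definable reflexive, transitive relation that is total on a nonempty set `a` has a least
element in `a`. -/
theorem exists_least (a : M) (R : M → M → Prop) [Dp M fun p : (Unit × M) × M => R p.1.2 p.2]
    (hrefl : ∀ u, u ε a → R u u)
    (htrans : ∀ u, u ε a → ∀ v, v ε a → ∀ w, w ε a → R u v → R v w → R u w)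
    (htot : ∀ u, u ε a → ∀ v, v ε a → R u v ∨ R v u) (hne : ∃ u, u ε a) :
    ∃ u, u ε a ∧ ∀ v, v ε a → R u v := by
  have := finite_induction a (fun c => (∃ u, u ε c ∧ True) →
    ∃ u, u ε c ∧ ∀ v, v ε c → R u v) (by simp) ?_
  · exact this (by simpa using hne)
  intro c p hc hp hpc ih _
  by_cases hce : c = emp
  · subst hce
    exact ⟨p, by simp, fun v hv => by simp at hv; exact hv ▸ hrefl p hp⟩
  · obtain ⟨u, hu, hu'⟩ := ih (by simpa using exists_mem_of_ne hce)
    rcases htot u (hc u hu) p hp with h | h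
    · refine ⟨u, mem_ins.2 (.inl hu), fun v hv => ?_⟩
      rcases mem_ins.1 hv with hv | rfl
      exacts [hu' v hv, h]
    · refine ⟨p, mem_ins.2 (.inr rfl), fun v hv => ?_⟩
      rcases mem_ins.1 hv with hv | rfl
      exacts [htrans p hp u (hc u hu) v (hc v hv) h (hu' v hv), hrefl v hp]

end Induction

/-! ### Linear orderings -/

section Orders

variable {M : Type} [LSet.Structure M]

/-- The field of the relation `l`. -/
noncomputable def fld (l : M) : M :=
  sep (sun (sun l)) fun u => ∃ v, v ε sun (sun l) ∧ (op u v ε l ∨ op v u ε l)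

/-- `l` is a linear ordering. -/
def IsLin (l : M) : Prop :=
  (∀ w, w ε l → ∃ u, u ε fld l ∧ ∃ v, v ε fld l ∧ w = op u v) ∧
  (∀ u, u ε fld l → op u u ε l) ∧
  (∀ u, u ε fld l → ∀ v, v ε fld l → op u v ε l ∧ op v u ε l → u = v) ∧
  (∀ u, u ε fld l → ∀ v, v ε fld l → ∀ w, w ε fld l → op u v ε l ∧ op v w ε l → op u w ε l) ∧
  ∀ u, u ε fld l → ∀ v, v ε fld l → op u v ε l ∨ op v u ε l

/-- `b` follows immediately after `a` in the ordering `l`. -/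
def IsNext (l a b : M) : Prop :=
  (op a b ε l ∧ ¬ a = b) ∧ ∀ z, z ε fld l → op a z ε l ∧ op z b ε l → z = a ∨ z = b

/-- The set of linear orderings `l ⊆ s × s`. -/
noncomputable def linOrds (s : M) : M := sep (pow (prod s s)) IsLin

/-- `c` is a cumulative hierarchy that ends with `s`. -/
def IsHier (c s : M) : Prop :=
  IsLin c ∧ (∀ V, V ε fld c → V ⊑ s) ∧ (emp ε fld c ∧ ∀ V, V ε fld c → op emp V ε c) ∧
  (s ε fld c ∧ ∀ V, V ε fld c → op V s ε c) ∧
  ∀ V, V ε fld c → ∀ W, W ε fld c → IsNext c V W → W = pow V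

/-- `s` is a level of the cumulative hierarchy. -/
def IsLevel (s : M) : Prop := ∃ c, c ε pow (pow (pow (pow s))) ∧ IsHier c s

/-- The symmetric difference. -/
noncomputable def symm (x y : M) : M := sep (uni x y) fun u => ¬ (u ε x ∧ u ε y)

/-- `x` precedes `y` in `Lex(l)`. -/
def LexLt (l x y : M) : Prop :=
  ∃ u, u ε symm x y ∧ (u ε symm x y ∧ ∀ v, v ε symm x y → op v u ε l) ∧ u ε y

/-- The relation `R` on the set `a`. -/
noncomputable def mkRel (a : M) (R : M → M → Prop) : M :=
  sep (prod a a) fun w => ∃ u, u ε a ∧ ∃ v, v ε a ∧ w = op u v ∧ R u v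

/-- The lexicographical ordering of the power set of the field of `l`. -/
noncomputable def lex (l : M) : M :=
  sep (prod (pow (fld l)) (pow (fld l))) fun w => ∃ u, u ε pow (fld l) ∧
    ∃ v, v ε pow (fld l) ∧ w = op u v ∧ (u = v ∨ LexLt l u v)

/-- `f` is a local function `Ack` along the hierarchy `c` that ends with `s`. -/
def IsAckFun (f c s : M) : Prop :=
  IsFun f (fld c) (linOrds s) ∧ op emp emp ε f ∧
  ∀ V, V ε fld c → ∀ W, W ε fld c → ∀ l, l ε linOrds s → IsNext c V W ∧ op V l ε f →
    op W (lex l) ε f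

/-- The Ackermann ordering of the level `s`. -/
noncomputable def ack (s : M) : M :=
  thee (linOrds s) fun l => ∃ c, c ε pow (pow (pow (pow s))) ∧ IsHier c s ∧
    ∃ f, f ε pow (prod (fld c) (linOrds s)) ∧ IsAckFun f c s ∧ op s l ε f

variable [M ⊨ EAStar]

section Instances

variable {α : Type} [Ctx M α] (F G H : α → M) [Dfn F] [Dfn G] [Dfn H]

instance Dfn.fld : Dfn (fun a => fld (F a)) := by unfold FinSetTheory.fld; infer_instance
set_option synthInstance.maxSize 1000 in
instance Dp.isLin : Dp M (fun a => IsLin (F a)) := by unfold IsLin; infer_instance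
instance Dp.isNext : Dp M (fun a => IsNext (F a) (G a) (H a)) := by
  unfold IsNext; infer_instance
instance Dfn.linOrds : Dfn (fun a => linOrds (F a)) := by
  unfold FinSetTheory.linOrds; infer_instance
instance Dp.isHier : Dp M (fun a => IsHier (F a) (G a)) := by unfold IsHier; infer_instance
instance Dfn.symm : Dfn (fun a => symm (F a) (G a)) := by
  unfold FinSetTheory.symm; infer_instance
instance Dp.lexLt : Dp M (fun a => LexLt (F a) (G a) (H a)) := by
  unfold LexLt; infer_instance
instance Dfn.lex : Dfn (fun a => lex (F a)) := by unfold FinSetTheory.lex; infer_instance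
instance Dp.isAckFun : Dp M (fun a => IsAckFun (F a) (G a) (H a)) := by
  unfold IsAckFun; infer_instance
instance Dfn.ack : Dfn (fun a => ack (F a)) := by unfold FinSetTheory.ack; infer_instance

end Instances

section Evaluation

variable {n : ℕ} (v : Fin n → M) (s t l a b c f x y : Tm n)

@[simp] theorem ev_fieldT : ev v (fieldT l) = fld (ev v l) := by simp [fieldT, fld]
@[simp] theorem sat_ordLe : (ordLe l a b).Sat v ↔ op (ev v a) (ev v b) ε ev v l := by
  simp [ordLe]
@[simp] theorem sat_ordLt :
    (ordLt l a b).Sat v ↔ op (ev v a) (ev v b) ε ev v l ∧ ¬ ev v a = ev v b := by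
  simp [ordLt]
@[simp] theorem sat_isLinOrd : (isLinOrd l).Sat v ↔ IsLin (ev v l) := by
  simp only [isLinOrd, IsLin, sat_and, sat_ball, sat_bex, sat_eq, sat_imp, sat_or, sat_ordLe,
    ev_fieldT, ev_opairT, ev_up, ev_new]
@[simp] theorem sat_isNext : (isNext l a b).Sat v ↔ IsNext (ev v l) (ev v a) (ev v b) := by
  simp only [isNext, IsNext, sat_and, sat_ball, sat_eq, sat_imp, sat_or, sat_ordLe, sat_ordLt,
    ev_fieldT, ev_up, ev_new]
@[simp] theorem ev_linOrdsT : ev v (linOrdsT s) = linOrds (ev v s) := by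
  simp only [linOrdsT, linOrds, ev_sepT, ev_powT, ev_prodT, sat_isLinOrd, ev_new]
@[simp] theorem sat_isHierarchy : (isHierarchy c s).Sat v ↔ IsHier (ev v c) (ev v s) := by
  simp only [isHierarchy, IsHier, sat_and, sat_ball, sat_eq, sat_imp, sat_isNext, sat_ordLe,
    sat_subset, sat_mem, sat_isLinOrd, ev_fieldT, ev_emptyT, ev_powT, ev_up, ev_new]
@[simp] theorem ev_chainBoundT :
    ev v (chainBoundT s) = pow (pow (pow (pow (ev v s)))) := by
  simp [chainBoundT]
@[simp] theorem sat_isLevel : (isLevel s).Sat v ↔ IsLevel (ev v s) := by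
  simp only [isLevel, IsLevel, sat_bex, sat_isHierarchy, ev_chainBoundT, ev_up, ev_new]
@[simp] theorem ev_symmDiffT : ev v (symmDiffT x y) = symm (ev v x) (ev v y) := by
  simp only [symmDiffT, symm, ev_sepT, sat_not, sat_and, sat_mem, ev_unionT, ev_up, ev_new]
@[simp] theorem sat_lexLt : (lexLt l x y).Sat v ↔ LexLt (ev v l) (ev v x) (ev v y) := by
  simp only [lexLt, LexLt, isGreatest, sat_bex, sat_and, sat_mem, sat_ball, sat_ordLe, ev_symmDiffT,
    ev_up, ev_new]
@[simp] theorem ev_lexT : ev v (lexT l) = lex (ev v l) := by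
  simp only [lexT, lex, ev_sepT, sat_bex, sat_and, sat_or, sat_eq, sat_lexLt, ev_prodT, ev_powT,
    ev_fieldT, ev_opairT, ev_up, ev_new]
@[simp] theorem sat_isAckFun : (isAckFun f c s).Sat v ↔ IsAckFun (ev v f) (ev v c) (ev v s) := by
  simp only [isAckFun, IsAckFun, sat_and, sat_ball, sat_imp, sat_isNext, sat_mem, sat_isFun,
    ev_fieldT, ev_linOrdsT, ev_emptyT, ev_opairT, ev_lexT, ev_up, ev_new]
@[simp] theorem ev_ackT : ev v (ackT s) = ack (ev v s) := by
  simp only [ackT, ack, ev_the, sat_bex, sat_and, sat_mem, sat_isHierarchy, sat_isAckFun,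
    ev_chainBoundT, ev_linOrdsT, ev_powT, ev_prodT, ev_fieldT, ev_opairT, ev_up, ev_new]

end Evaluation

theorem mem_fld {l u : M} : u ε fld l ↔ ∃ v, op u v ε l ∨ op v u ε l := by
  rw [fld, mem_sep]
  constructor
  · rintro ⟨-, v, -, h⟩; exact ⟨v, h⟩
  · rintro ⟨v, h | h⟩
    · exact ⟨(mem_sun_sun h).1, v, (mem_sun_sun h).2, .inl h⟩
    · exact ⟨(mem_sun_sun h).2, v, (mem_sun_sun h).1, .inr h⟩

theorem mem_symm {x y u : M} : u ε symm x y ↔ (u ε x ∧ ¬ u ε y) ∨ (u ε y ∧ ¬ u ε x) := by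
  rw [symm, mem_sep, mem_uni]; tauto

theorem symm_comm (x y : M) : symm x y = symm y x := by
  ext u; rw [mem_symm, mem_symm]; tauto

theorem exists_mem_symm {x y : M} (h : x ≠ y) : ∃ u, u ε symm x y := by
  by_contra! h'
  refine h (mem_ext fun u => ?_)
  have := h' u
  rw [mem_symm] at this
  tauto

theorem mem_linOrds {l s : M} : l ε linOrds s ↔ l ⊑ prod s s ∧ IsLin l := by
  rw [linOrds, mem_sep, mem_pow]

theorem op_mem_mkRel {a u v : M} {R : M → M → Prop}
    [Dp M fun p : (Unit × M) × M => R p.1.2 p.2] :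
    op u v ε mkRel a R ↔ u ε a ∧ v ε a ∧ R u v := by
  rw [mkRel, mem_sep, op_mem_prod]
  simp only [op_inj]; grind

theorem isLin_mkRel {a : M} {R : M → M → Prop} [Dp M fun p : (Unit × M) × M => R p.1.2 p.2]
    (hrefl : ∀ u, u ε a → R u u)
    (hanti : ∀ u, u ε a → ∀ v, v ε a → R u v → R v u → u = v)
    (htrans : ∀ u, u ε a → ∀ v, v ε a → ∀ w, w ε a → R u v → R v w → R u w)
    (htot : ∀ u, u ε a → ∀ v, v ε a → R u v ∨ R v u) :
    IsLin (mkRel a R) ∧ fld (mkRel a R) = a := by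
  have hf : fld (mkRel a R) = a := by
    ext u
    rw [mem_fld]
    simp only [op_mem_mkRel]
    exact ⟨by rintro ⟨v, h | h⟩ <;> tauto, fun h => ⟨u, .inl ⟨h, h, hrefl u h⟩⟩⟩
  refine ⟨?_, hf⟩
  rw [IsLin, hf]
  simp only [op_mem_mkRel]
  refine ⟨fun w hw => ?_, by grind, by grind, by grind, by grind⟩
  obtain ⟨-, u, hu, v, hv, e, -⟩ := mem_sep.1 hw
  exact ⟨u, hu, v, hv, e⟩

namespace IsLin

variable {l u v w : M} (h : IsLin l)
include h

theorem mem_left (huv : op u v ε l) : u ε fld l := mem_fld.2 ⟨v, .inl huv⟩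
theorem mem_right (huv : op u v ε l) : v ε fld l := mem_fld.2 ⟨u, .inr huv⟩
theorem refl (hu : u ε fld l) : op u u ε l := h.2.1 u hu
theorem antisymm (h1 : op u v ε l) (h2 : op v u ε l) : u = v :=
  h.2.2.1 u (h.mem_left h1) v (h.mem_right h1) ⟨h1, h2⟩
theorem trans (h1 : op u v ε l) (h2 : op v w ε l) : op u w ε l :=
  h.2.2.2.1 u (h.mem_left h1) v (h.mem_right h1) w (h.mem_right h2) ⟨h1, h2⟩
theorem total (hu : u ε fld l) (hv : v ε fld l) : op u v ε l ∨ op v u ε l :=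
  h.2.2.2.2 u hu v hv

theorem sub_prod : l ⊑ prod (fld l) (fld l) := by
  intro w hw
  obtain ⟨u, hu, v, hv, rfl⟩ := h.1 w hw
  exact op_mem_prod.2 ⟨hu, hv⟩

theorem ext_of_iff {l' : M} (h' : IsLin l') (H : ∀ u v, op u v ε l ↔ op u v ε l') : l = l' := by
  ext w
  constructor
  · intro hw
    obtain ⟨u, hu, v, hv, rfl⟩ := h.1 w hw
    exact (H u v).1 hw
  · intro hw
    obtain ⟨u, hu, v, hv, rfl⟩ := h'.1 w hw
    exact (H u v).2 hw

theorem least {a : M} (ha : a ⊑ fld l) (hne : ∃ u, u ε a) :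
    ∃ u, u ε a ∧ ∀ v, v ε a → op u v ε l :=
  exists_least a (fun u v => op u v ε l) (fun u hu => h.refl (ha u hu))
    (fun _ _ _ _ _ _ h1 h2 => h.trans h1 h2) (fun u hu v hv => h.total (ha u hu) (ha v hv)) hne

theorem greatest {a : M} (ha : a ⊑ fld l) (hne : ∃ u, u ε a) :
    ∃ u, u ε a ∧ ∀ v, v ε a → op v u ε l :=
  exists_least a (fun u v => op v u ε l) (fun u hu => h.refl (ha u hu))
    (fun _ _ _ _ _ _ h1 h2 => h.trans h2 h1) (fun u hu v hv => h.total (ha v hv) (ha u hu)) hne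

end IsLin

/-! ### Levels of the cumulative hierarchy -/

namespace IsHier

variable {c s : M} (h : IsHier c s)
include h

theorem mem_top : s ε fld c := h.2.2.2.1.1
theorem sub_top {V : M} (hV : V ε fld c) : V ⊑ s := h.2.1 V hV

/-- Induction along a hierarchy. -/
theorem induction (P : M → Prop) [Dp M fun p : Unit × M => P p.2] (h0 : P emp)
    (hs : ∀ V, V ε fld c → pow V ε fld c → IsNext c V (pow V) → P V → P (pow V)) {V : M}
    (hV : V ε fld c) : P V := by
  obtain ⟨hl, -, h00, -, hn⟩ := h
  by_contra hP
  -- The least counterexample `W` is not `∅`, and so it is `P(U)` for its predecessor `U`.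
  obtain ⟨W, hW, hmin⟩ := hl.least (a := sep (fld c) fun V => ¬ P V)
    (fun u hu => (mem_sep.1 hu).1) ⟨V, mem_sep.2 ⟨hV, hP⟩⟩
  rw [mem_sep] at hW
  have hWne : emp ≠ W := fun e => hW.2 (e ▸ h0)
  obtain ⟨U, hU, hmax⟩ := hl.greatest (a := sep (fld c) fun V => op V W ε c ∧ V ≠ W)
    (fun u hu => (mem_sep.1 hu).1) ⟨emp, mem_sep.2 ⟨h00.1, h00.2 W hW.1, hWne⟩⟩
  rw [mem_sep] at hU
  have hnext : IsNext c U W := by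
    refine ⟨hU.2, fun z hz hz' => ?_⟩
    by_cases e : z = W
    · exact .inr e
    · exact .inl (hl.antisymm (hmax z (mem_sep.2 ⟨hz, hz'.2, e⟩)) hz'.1)
  have e := hn U hU.1 W hW.1 hnext
  subst e
  refine hW.2 (hs U hU.1 hW.1 hnext ?_)
  by_contra hPU
  exact hU.2.2 (hl.antisymm hU.2.1 (hmin U (mem_sep.2 ⟨hU.1, hPU⟩)))

theorem isNext_pow {V : M} (hV : V ε fld c) (hVs : V ≠ s) : IsNext c V (pow V) := by
  obtain ⟨hl, -, -, hs, hn⟩ := h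
  obtain ⟨W, hW, hmin⟩ := hl.least (a := sep (fld c) fun W => op V W ε c ∧ V ≠ W)
    (fun u hu => (mem_sep.1 hu).1) ⟨s, mem_sep.2 ⟨hs.1, hs.2 V hV, hVs⟩⟩
  rw [mem_sep] at hW
  have hnext : IsNext c V W := by
    refine ⟨hW.2, fun z hz hz' => ?_⟩
    by_cases e : V = z
    · exact .inl e.symm
    · exact .inr (hl.antisymm hz'.2 (hmin z (mem_sep.2 ⟨hz, hz'.1, e⟩)))
  exact hn V hV W hW.1 hnext ▸ hnext

theorem pow_mem {V : M} (hV : V ε fld c) (hVs : V ≠ s) : pow V ε fld c :=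
  h.1.mem_right (h.isNext_pow hV hVs).1.1

theorem transitive {V : M} (hV : V ε fld c) : V ⊑ pow V := by
  refine h.induction (fun V => V ⊑ pow V) (emp_sub _) (fun V _ _ _ ih u hu => ?_) hV
  rw [mem_pow] at hu ⊢
  exact hu.trans ih

/-- A hierarchy is ordered by inclusion. -/
theorem op_mem_iff {V W : M} (hV : V ε fld c) (hW : W ε fld c) : op V W ε c ↔ V ⊑ W := by
  have key : ∀ V, V ε fld c → ∀ W, W ε fld c → op V W ε c → V ⊑ W := by
    intro V hV W hW
    refine h.induction (fun W => op V W ε c → V ⊑ W) ?_ ?_ hW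
    · intro h'
      rw [h.1.antisymm h' (h.2.2.1.2 V hV)]
      exact Sub.refl _
    · intro W hW hW' hn ih h'
      rcases h.1.total hV hW with h1 | h1
      · exact (ih h1).trans (h.transitive hW)
      · rcases hn.2 V hV ⟨h1, h'⟩ with rfl | rfl
        exacts [h.transitive hW, Sub.refl _]
  refine ⟨key V hV W hW, fun h' => ?_⟩
  rcases h.1.total hV hW with h1 | h1
  · exact h1
  · rw [Sub.antisymm h' (key W hW V hV h1)]
    exact h.1.refl hW

end IsHier

theorem pow_mono {x y : M} (h : x ⊑ y) : pow x ⊑ pow y := fun _ hu =>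
  mem_pow.2 ((mem_pow.1 hu).trans h)

/-- The bound on the hierarchy in the definition of a level is no restriction. -/
theorem isLevel_iff {s : M} : IsLevel s ↔ ∃ c, IsHier c s := by
  refine ⟨fun ⟨c, _, h⟩ => ⟨c, h⟩, fun ⟨c, h⟩ => ⟨c, ?_, h⟩⟩
  rw [mem_pow]
  refine h.1.sub_prod.trans fun w hw => ?_
  have hs : uni (fld c) (fld c) ⊑ pow s := fun u hu =>
    mem_pow.2 (h.sub_top (by simpa using hu))
  exact pow_mono (pow_mono hs) _ (mem_sep.1 hw).1

namespace IsLevel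

variable {s t : M}

theorem transitive (h : IsLevel s) : s ⊑ pow s := by
  obtain ⟨c, h⟩ := isLevel_iff.1 h
  exact h.transitive h.mem_top

theorem sub_of_mem (h : IsLevel s) {x : M} (hx : x ε s) : x ⊑ s := mem_pow.1 (h.transitive x hx)

/-- Along the hierarchy of `s`, every member is a member of the hierarchy of `t` as long as it does
not include `t`. -/
theorem comparable (hs : IsLevel s) (ht : IsLevel t) : s ⊑ t ∨ t ⊑ s := by
  obtain ⟨c, hc⟩ := isLevel_iff.1 hs
  obtain ⟨d, hd⟩ := isLevel_iff.1 ht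
  have : s ε fld d ∨ t ⊑ s := by
    refine hc.induction (fun V => V ε fld d ∨ t ⊑ V) (.inl hd.2.2.1.1) (fun V hV _ _ ih => ?_)
      hc.mem_top
    rcases ih with h | h
    · by_cases e : V = t
      · exact .inr (e ▸ hc.transitive hV)
      · exact .inl (hd.pow_mem h e)
    · exact .inr (h.trans (hc.transitive hV))
  exact this.imp_left hd.sub_top

/-- A hierarchy that ends with `s` is extended by `P(s)`; the new hierarchy is ordered by inclusion,
which agrees with the given ordering on the old members. -/
theorem pow (hs : IsLevel s) : IsLevel (pow s) := by
  obtain ⟨c, h⟩ := isLevel_iff.1 hs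
  have hst := h.transitive h.mem_top
  have hnot : ¬ FinSetTheory.pow s ε fld c := fun h' =>
    not_mem_self s (h.sub_top h' s (mem_pow.2 (Sub.refl s)))
  set a := ins (fld c) (FinSetTheory.pow s) with ha
  have hmem : ∀ {V}, V ε a ↔ V ε fld c ∨ V = FinSetTheory.pow s := mem_ins
  have hsub : ∀ V, V ε a → V ⊑ FinSetTheory.pow s := by
    intro V hV
    rcases hmem.1 hV with hV | rfl
    exacts [(h.sub_top hV).trans hst, Sub.refl _]
  obtain ⟨hl, hf⟩ := isLin_mkRel (a := a) (R := Sub) (fun _ _ => Sub.refl _)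
    (fun _ _ _ _ => Sub.antisymm) (fun _ _ _ _ _ _ => Sub.trans) (fun u hu v hv => by
      rcases hmem.1 hv with hv | rfl
      · rcases hmem.1 hu with hu | rfl
        · rw [← h.op_mem_iff hu hv, ← h.op_mem_iff hv hu]
          exact h.1.total hu hv
        · exact .inr ((h.sub_top hv).trans hst)
      · exact .inl (hsub u hu))
  refine isLevel_iff.2 ⟨mkRel a Sub, hl, ?_⟩
  have hemp : emp ε a := hmem.2 (.inl h.2.2.1.1)
  have hpow : FinSetTheory.pow s ε a := hmem.2 (.inr rfl)
  have hs' : s ε a := hmem.2 (.inl h.mem_top)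
  simp only [hf, IsNext, op_mem_mkRel]
  refine ⟨hsub, ⟨hemp, fun V hV => ⟨hemp, hV, emp_sub V⟩⟩,
    ⟨hpow, fun V hV => ⟨hV, hpow, hsub V hV⟩⟩, fun V hV W hW hn => ?_⟩
  obtain ⟨⟨⟨-, -, hVW⟩, hne⟩, hn⟩ := hn
  rcases hmem.1 hV with hV' | rfl
  · rcases hmem.1 hW with hW' | rfl
    · refine h.2.2.2.2 V hV' W hW' ⟨⟨(h.op_mem_iff hV' hW').2 hVW, hne⟩, fun z hz hz' => ?_⟩
      have hz'' := hmem.2 (.inl hz)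
      rw [h.op_mem_iff hV' hz, h.op_mem_iff hz hW'] at hz'
      exact hn z hz'' ⟨⟨hV, hz'', hz'.1⟩, hz'', hW, hz'.2⟩
    · rcases hn s hs' ⟨⟨hV, hs', h.sub_top hV'⟩, hs', hW, hst⟩ with e | e
      · rw [e]
      · exact (hnot (e ▸ h.mem_top)).elim
  · exact (hne (Sub.antisymm hVW (hsub W hW))).elim

end IsLevel

/-! ### The Ackermann ordering of a level -/

theorem lexLt_iff {l x y : M} :
    LexLt l x y ↔ ∃ u, u ε y ∧ ¬ u ε x ∧ ∀ v, v ε symm x y → op v u ε l := by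
  constructor
  · rintro ⟨u, hu, ⟨-, h⟩, huy⟩
    rw [mem_symm] at hu
    exact ⟨u, huy, by tauto, h⟩
  · rintro ⟨u, hu, hux, h⟩
    have : u ε symm x y := mem_symm.2 (.inr ⟨hu, hux⟩)
    exact ⟨u, this, ⟨this, h⟩, hu⟩

/-- The lexicographical comparison of `x` and `y` depends only on the ordering of their symmetric
difference. -/
theorem lexLt_congr {l l' x y : M}
    (h : ∀ u, u ε symm x y → ∀ v, v ε symm x y → (op u v ε l ↔ op u v ε l')) :
    LexLt l x y ↔ LexLt l' x y :=
  exists_congr fun u => and_congr_right fun hu => and_congr_left fun _ =>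
    and_congr_right fun _ => forall_congr' fun v => forall_congr' fun hv => h v hv u hu

theorem symm_sub {x y a : M} (hx : x ⊑ a) (hy : y ⊑ a) : symm x y ⊑ a := by
  intro u hu
  rw [mem_symm] at hu
  rcases hu with hu | hu
  exacts [hx u hu.1, hy u hu.1]

theorem lex_eq_mkRel (l : M) : lex l = mkRel (pow (fld l)) fun x y => x = y ∨ LexLt l x y := rfl

theorem op_mem_lex {l x y : M} :
    op x y ε lex l ↔ x ⊑ fld l ∧ y ⊑ fld l ∧ (x = y ∨ LexLt l x y) := by
  rw [lex_eq_mkRel, op_mem_mkRel, mem_pow, mem_pow]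

theorem isLin_lex {l : M} (h : IsLin l) : IsLin (lex l) ∧ fld (lex l) = pow (fld l) := by
  rw [lex_eq_mkRel]
  refine isLin_mkRel (fun _ _ => .inl rfl) ?_ ?_ ?_
  · intro x _ y _ h1 h2
    rcases h1 with h1 | h1
    · exact h1
    rcases h2 with h2 | h2
    · exact h2.symm
    rw [lexLt_iff] at h1 h2
    obtain ⟨u, hu, hux, hm⟩ := h1
    obtain ⟨v, hv, hvy, hm'⟩ := h2
    have h1 := hm v (mem_symm.2 (.inl ⟨hv, hvy⟩))
    have h2 := hm' u (mem_symm.2 (.inl ⟨hu, hux⟩))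
    exact (hux (h.antisymm h1 h2 ▸ hv)).elim
  · intro x hx y hy z hz h1 h2
    rcases h1 with rfl | h1
    · exact h2
    rcases h2 with rfl | h2
    · exact .inr h1
    right
    rw [lexLt_iff] at h1 h2 ⊢
    obtain ⟨u, hu, hux, hm⟩ := h1
    obtain ⟨w, hw, hwy, hm'⟩ := h2
    rw [mem_pow] at hy hz
    have hsymm : ∀ v, v ε symm x z → v ε symm x y ∨ v ε symm y z := by
      intro v; simp only [mem_symm]; tauto
    -- The greater one of the two witnesses `u` and `w` is a witness for `x` and `z`.
    rcases h.total (hy u hu) (hz w hw) with huw | huw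
    · refine ⟨w, hw, fun hwx => ?_, fun v hv => ?_⟩
      · have := hm w (mem_symm.2 (.inl ⟨hwx, hwy⟩))
        exact hwy (h.antisymm this huw ▸ hu)
      · rcases hsymm v hv with hv | hv
        exacts [h.trans (hm v hv) huw, hm' v hv]
    · refine ⟨u, ?_, hux, fun v hv => ?_⟩
      · by_contra huz
        have := hm' u (mem_symm.2 (.inl ⟨hu, huz⟩))
        exact hwy (h.antisymm this huw ▸ hu)
      · rcases hsymm v hv with hv | hv
        exacts [hm v hv, h.trans (hm' v hv) huw]
  · intro x hx y hy
    rw [mem_pow] at hx hy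
    by_cases e : x = y
    · exact .inl (.inl e)
    obtain ⟨u, hu, hm⟩ := h.greatest (symm_sub hx hy) (exists_mem_symm e)
    rcases mem_symm.1 hu with h' | h'
    · exact .inr (.inr (lexLt_iff.2 ⟨u, h'.1, h'.2, symm_comm x y ▸ hm⟩))
    · exact .inl (.inr (lexLt_iff.2 ⟨u, h'.1, h'.2, hm⟩))

/-- `l` is a linear ordering of `V` that is its own lexicographical ordering: `x` precedes `y` iff
the `l`-greatest element of the symmetric difference of `x` and `y` is in `y`. -/
def SelfLex (l V : M) : Prop :=
  IsLin l ∧ fld l = V ∧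
    ∀ x, x ε V → ∀ y, y ε V → (op x y ε l ↔ x = y ∨ LexLt l x y)

instance Dp.selfLex {α : Type} [Ctx M α] (F G : α → M) [Dfn F] [Dfn G] :
    Dp M (fun a => SelfLex (F a) (G a)) := by unfold SelfLex; infer_instance

/-- `Lex` of a self-lexicographical ordering of a transitive set `V` agrees with it on `V`, and hence
is self-lexicographical, too. -/
theorem SelfLex.lex {l V : M} (h : SelfLex l V) (hV : V ⊑ pow V) :
    SelfLex (lex l) (pow V) := by
  obtain ⟨hl, rfl, hlex⟩ := h
  obtain ⟨hl', hf⟩ := isLin_lex hl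
  refine ⟨hl', hf, fun x hx y hy => ?_⟩
  rw [mem_pow] at hx hy
  rw [op_mem_lex, and_iff_right hx, and_iff_right hy]
  refine or_congr_right (lexLt_congr fun u hu v hv => ?_)
  have hu := symm_sub hx hy u hu
  have hv := symm_sub hx hy v hv
  rw [hlex u hu v hv, op_mem_lex, and_iff_right (mem_pow.1 (hV u hu)),
    and_iff_right (mem_pow.1 (hV v hv))]

theorem SelfLex.restrict {l V W : M} (h : SelfLex l W) (hVW : V ⊑ W) (hV : V ⊑ pow V) :
    SelfLex (mkRel V fun u v => op u v ε l) V := by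
  obtain ⟨hl, rfl, hlex⟩ := h
  obtain ⟨hl', hf⟩ := isLin_mkRel (a := V) (R := fun u v => op u v ε l)
    (fun u hu => hl.refl (hVW u hu)) (fun u _ v _ => hl.antisymm)
    (fun u _ v _ w _ => hl.trans) (fun u hu v hv => hl.total (hVW u hu) (hVW v hv))
  refine ⟨hl', hf, fun x hx y hy => ?_⟩
  rw [op_mem_mkRel, and_iff_right hx, and_iff_right hy, hlex x (hVW x hx) y (hVW y hy)]
  have hs := symm_sub (mem_pow.1 (hV x hx)) (mem_pow.1 (hV y hy))
  refine or_congr_right (lexLt_congr fun u hu v hv => ?_)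
  rw [op_mem_mkRel, and_iff_right (hs u hu), and_iff_right (hs v hv)]

theorem SelfLex.mem_linOrds {l V s : M} (h : SelfLex l V) (hV : V ⊑ s) : l ε linOrds s := by
  refine FinSetTheory.mem_linOrds.2 ⟨h.1.sub_prod.trans fun w hw => ?_, h.1⟩
  obtain ⟨u, hu, v, hv, rfl⟩ := mem_prod.1 hw
  rw [h.2.1] at hu hv
  exact op_mem_prod.2 ⟨hV u hu, hV v hv⟩

theorem selfLex_emp : SelfLex (emp : M) emp := by
  have hf : fld (emp : M) = emp := eq_emp fun u hu => by simp [mem_fld] at hu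
  refine ⟨?_, hf, by simp⟩
  simp [IsLin, hf]

theorem IsHier.exists_selfLex {c s V : M} (h : IsHier c s) (hV : V ε fld c) :
    ∃ l, l ε linOrds s ∧ SelfLex l V := by
  refine h.induction (fun V => ∃ l, l ε linOrds s ∧ SelfLex l V)
    ⟨emp, selfLex_emp.mem_linOrds (emp_sub s), selfLex_emp⟩ (fun V hV hV' _ ih => ?_) hV
  obtain ⟨l, -, hl⟩ := ih
  have := hl.lex (h.transitive hV)
  exact ⟨_, this.mem_linOrds (h.sub_top hV'), this⟩

theorem IsHier.selfLex_unique {c s V l l' : M} (h : IsHier c s) (hV : V ε fld c)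
    (hl : SelfLex l V) (hl' : SelfLex l' V) : l = l' := by
  have := h.induction (fun V => ∀ l, l ε linOrds s → ∀ l', l' ε linOrds s → SelfLex l V →
    SelfLex l' V → l = l') ?_ ?_ hV
  · exact this l (hl.mem_linOrds (h.sub_top hV)) l' (hl'.mem_linOrds (h.sub_top hV)) hl hl'
  · intro l _ l' _ hl hl'
    refine hl.1.ext_of_iff hl'.1 fun u v => ?_
    have e : ∀ {l : M}, SelfLex l emp → ¬ op u v ε l := fun hl huv =>
      not_mem_emp u (hl.2.1 ▸ hl.1.mem_left huv)
    exact iff_of_false (e hl) (e hl')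
  · intro V hV hV' _ ih l _ l' _ hl hl'
    have ht := h.transitive hV
    have r := hl.restrict ht ht
    have r' := hl'.restrict ht ht
    have e := ih _ (r.mem_linOrds (h.sub_top hV)) _ (r'.mem_linOrds (h.sub_top hV)) r r'
    refine hl.1.ext_of_iff hl'.1 fun x y => ?_
    by_cases hxy : x ε pow V ∧ y ε pow V
    · rw [hl.2.2 x hxy.1 y hxy.2, hl'.2.2 x hxy.1 y hxy.2]
      have hs := symm_sub (mem_pow.1 hxy.1) (mem_pow.1 hxy.2)
      refine or_congr_right (lexLt_congr fun u hu v hv => ?_)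
      have := iff_of_eq (congrArg (op u v ε ·) e)
      simpa only [op_mem_mkRel, hs u hu, hs v hv, true_and] using this
    · refine iff_of_false (fun h1 => hxy ?_) fun h1 => hxy ?_
      · exact hl.2.1 ▸ ⟨hl.1.mem_left h1, hl.1.mem_right h1⟩
      · exact hl'.2.1 ▸ ⟨hl'.1.mem_left h1, hl'.1.mem_right h1⟩

/-- The Ackermann ordering of a level is its unique self-lexicographical ordering. -/
theorem IsLevel.selfLex_ack {s : M} (hs : IsLevel s) : SelfLex (ack s) s := by
  obtain ⟨c, hcb, hc⟩ := id hs
  obtain ⟨l, hls, hl⟩ := hc.exists_selfLex hc.mem_top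
  suffices h : ack s = l by rw [h]; exact hl
  -- The local function `Ack` sends each member `V` of `c` to its self-lexicographical ordering.
  refine thee_eq hls ⟨c, hcb, hc, sep (prod (fld c) (linOrds s)) fun w => ∃ V, V ε fld c ∧
    ∃ l, l ε linOrds s ∧ w = op V l ∧ SelfLex l V, ?_, ?_, ?_⟩ ?_
  · exact mem_pow.2 fun w hw => (mem_sep.1 hw).1
  · have hmem : ∀ V l, op V l ε (sep (prod (fld c) (linOrds s)) fun w => ∃ V, V ε fld c ∧
        ∃ l, l ε linOrds s ∧ w = op V l ∧ SelfLex l V) ↔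
        V ε fld c ∧ l ε linOrds s ∧ SelfLex l V := by
      intro V l
      rw [mem_sep, op_mem_prod]
      simp only [op_inj]; grind
    refine ⟨⟨fun w hw => (mem_sep.1 hw).1, fun V hV => ?_⟩, ?_, ?_⟩
    · obtain ⟨l, hl, hl'⟩ := hc.exists_selfLex hV
      refine ⟨l, hl, (hmem V l).2 ⟨hV, hl, hl'⟩, fun w _ hw => ?_⟩
      exact hc.selfLex_unique hV ((hmem V w).1 hw).2.2 hl'
    · exact (hmem _ _).2 ⟨hc.2.2.1.1, selfLex_emp.mem_linOrds (emp_sub s), selfLex_emp⟩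
    · rintro V hV W hW l hl ⟨hn, hVl⟩
      obtain rfl := hc.2.2.2.2 V hV W hW hn
      have := ((hmem V l).1 hVl).2.2.lex (hc.transitive hV)
      exact (hmem _ _).2 ⟨hW, this.mem_linOrds (hc.sub_top hW), this⟩
  · rw [mem_sep, op_mem_prod]
    exact ⟨⟨hc.mem_top, hls⟩, s, hc.mem_top, l, hls, rfl, hl⟩
  -- Conversely, the values of every local function `Ack` are self-lexicographical.
  · rintro l' - ⟨d, -, hd, f, -, hf, hsf⟩
    have key : SelfLex (app f s) s := by
      refine hd.induction (fun V => SelfLex (app f V) V) ?_ (fun V hV hV' hn ih => ?_) hd.mem_top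
      · rw [hf.1.app_eq hf.2.1]; exact selfLex_emp
      · have h1 := hf.2.2 V hV _ hV' _ (hf.1.app_mem hV) ⟨hn, hf.1.op_app hV⟩
        rw [hf.1.app_eq h1]
        exact ih.lex (hd.transitive hV)
    rw [hf.1.app_eq hsf] at key
    exact hc.selfLex_unique hc.mem_top key hl

theorem IsLevel.selfLex_unique {s l l' : M} (h : IsLevel s) (hl : SelfLex l s)
    (hl' : SelfLex l' s) : l = l' := by
  obtain ⟨c, hc⟩ := isLevel_iff.1 h
  exact hc.selfLex_unique hc.mem_top hl hl'

end Orders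

/-! ### The global Ackermann ordering -/

section Global

variable {M : Type} [LSet.Structure M] [M ⊨ EAStar]

theorem mem_rk (x : M) : x ε rk x := by
  have := sat_axiom EAMatrix.hierarchy ![x, x]
  simp only [sat_and, sat_mem, ev_rankT] at this
  exact this.1

theorem isLevel_rk (x : M) : IsLevel (rk x) := by
  have := sat_axiom EAMatrix.hierarchy ![x, x]
  simp only [sat_and, sat_isLevel, ev_rankT] at this
  exact this.2.1

theorem rk_sub {x s : M} (hs : IsLevel s) (hx : x ε s) : rk x ⊑ s := by
  have := sat_axiom EAMatrix.hierarchy ![x, s]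
  simp only [sat_and, sat_imp, sat_mem, sat_isLevel, sat_subset, ev_rankT] at this
  exact this.2.2 ⟨hx, hs⟩

theorem IsLevel.uni {s t : M} (hs : IsLevel s) (ht : IsLevel t) : IsLevel (uni s t) := by
  rcases hs.comparable ht with h | h
  · rwa [show FinSetTheory.uni s t = t from mem_ext fun u => by
      rw [mem_uni, or_iff_right_iff_imp]; exact h u]
  · rwa [show FinSetTheory.uni s t = s from mem_ext fun u => by
      rw [mem_uni, or_iff_left_iff_imp]; exact h u]

theorem exists_level₂ (x y : M) : ∃ s, IsLevel s ∧ x ε s ∧ y ε s :=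
  ⟨uni (rk x) (rk y), (isLevel_rk x).uni (isLevel_rk y), mem_uni.2 (.inl (mem_rk x)),
    mem_uni.2 (.inr (mem_rk y))⟩

theorem exists_level₃ (x y z : M) : ∃ s, IsLevel s ∧ x ε s ∧ y ε s ∧ z ε s := by
  obtain ⟨s, hs, hx, hy⟩ := exists_level₂ x y
  exact ⟨uni s (rk z), hs.uni (isLevel_rk z), mem_uni.2 (.inl hx), mem_uni.2 (.inl hy),
    mem_uni.2 (.inr (mem_rk z))⟩

theorem ack_restrict {s t x y : M} (hs : IsLevel s) (ht : IsLevel t) (hst : s ⊑ t) (hx : x ε s)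
    (hy : y ε s) : op x y ε ack s ↔ op x y ε ack t := by
  rw [hs.selfLex_unique hs.selfLex_ack (ht.selfLex_ack.restrict hst hs.transitive), op_mem_mkRel,
    and_iff_right hx, and_iff_right hy]

/-- A level is an initial segment of the Ackermann ordering of every larger level. -/
theorem ack_initial {s t x y : M} (hs : IsLevel s) (ht : IsLevel t) (hst : s ⊑ t) (hx : x ε s)
    (hyx : op y x ε ack t) : y ε s := by
  obtain ⟨hl, hf, hlex⟩ := ht.selfLex_ack
  obtain ⟨c, hc⟩ := isLevel_iff.1 hs
  have hy := hf ▸ hl.mem_left hyx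
  refine hc.induction (fun V => V ⊑ t → ∀ x, x ε V → ∀ y, y ε t → op y x ε ack t → y ε V)
    (fun _ x hx => (not_mem_emp x hx).elim) ?_ hc.mem_top hst x hx y hy hyx
  intro V hV _ _ ih hVt x hx y hy hyx
  have ih := ih ((hc.transitive hV).trans hVt)
  rcases (hlex y hy x (hVt x hx)).1 hyx with rfl | h
  · exact hx
  obtain ⟨w, hw, hwy, hm⟩ := lexLt_iff.1 h
  rw [mem_pow] at hx ⊢
  intro u hu
  by_cases hux : u ε x
  · exact hx u hux
  · exact ih w (hx w hw) u (ht.sub_of_mem hy u hu) (hm u (mem_symm.2 (.inl ⟨hu, hux⟩)))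

/-- The relation `<_a`. -/
def AckLt (x y : M) : Prop := rk x ⊑ rk y ∧ op x y ε ack (rk y) ∧ ¬ x = y

instance Dp.ackLt {α : Type} [Ctx M α] (F G : α → M) [Dfn F] [Dfn G] :
    Dp M (fun a => AckLt (F a) (G a)) := by unfold AckLt; infer_instance

/-- The relation `<_a` agrees with the Ackermann ordering of every level. -/
theorem ackLt_iff {s x y : M} (hs : IsLevel s) (hy : y ε s) :
    AckLt x y ↔ op x y ε ack s ∧ x ≠ y := by
  have hys := rk_sub hs hy
  have hly := isLevel_rk y
  have hyy := mem_rk y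
  constructor
  · rintro ⟨h1, h2, h3⟩
    exact ⟨(ack_restrict hly hs hys (h1 x (mem_rk x)) hyy).1 h2, h3⟩
  · rintro ⟨h2, h3⟩
    have hxy := ack_initial hly hs hys hyy h2
    exact ⟨rk_sub hly hxy, (ack_restrict hly hs hys hxy hyy).2 h2, h3⟩

theorem eq_or_ackLt_iff {s x y : M} (hs : IsLevel s) (hx : x ε s) (hy : y ε s) :
    x = y ∨ AckLt x y ↔ op x y ε ack s := by
  rw [ackLt_iff hs hy]
  have h : op x x ε ack s := hs.selfLex_ack.1.refl (by
    rw [hs.selfLex_ack.2.1]; exact hx)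
  by_cases e : x = y
  · subst e; simp [h]
  · simp [e]

/-- The relation `<_a` is a linear ordering of the universe. -/
noncomputable instance ackOrder : LinearOrder M where
  le x y := x = y ∨ AckLt x y
  lt := AckLt
  le_refl x := .inl rfl
  le_trans x y z := by
    obtain ⟨s, hs, hx, hy, hz⟩ := exists_level₃ x y z
    simp only [eq_or_ackLt_iff hs hx hy, eq_or_ackLt_iff hs hy hz, eq_or_ackLt_iff hs hx hz]
    exact hs.selfLex_ack.1.trans
  le_antisymm x y := by
    obtain ⟨s, hs, hx, hy⟩ := exists_level₂ x y
    simp only [eq_or_ackLt_iff hs hx hy, eq_or_ackLt_iff hs hy hx]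
    exact hs.selfLex_ack.1.antisymm
  le_total x y := by
    obtain ⟨s, hs, hx, hy⟩ := exists_level₂ x y
    simp only [eq_or_ackLt_iff hs hx hy, eq_or_ackLt_iff hs hy hx]
    obtain ⟨hl, hf, -⟩ := hs.selfLex_ack
    exact hl.total (hf.symm ▸ hx) (hf.symm ▸ hy)
  lt_iff_le_not_ge x y := by
    obtain ⟨s, hs, hx, hy⟩ := exists_level₂ x y
    rw [eq_or_ackLt_iff hs hx hy, eq_or_ackLt_iff hs hy hx, ackLt_iff hs hy]
    refine and_congr_right fun h => ⟨fun hne h' => hne (hs.selfLex_ack.1.antisymm h h'), ?_⟩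
    rintro h' rfl
    exact h' h
  toDecidableLE := Classical.decRel _

theorem ack_le_iff {s x y : M} (hs : IsLevel s) (hx : x ε s) (hy : y ε s) :
    op x y ε ack s ↔ x ≤ y := (eq_or_ackLt_iff hs hx hy).symm

section Instances

variable {α : Type} [Ctx M α] (F G : α → M) [Dfn F] [Dfn G]

instance Dp.lt : Dp M (fun a => F a < G a) := Dp.ackLt F G
instance Dp.le : Dp M (fun a => F a ≤ G a) :=
  inferInstanceAs (Dp M fun a => F a = G a ∨ AckLt (F a) (G a))

end Instances

/-- The Ackermann ordering is lexicographical. -/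
theorem lt_iff_lex {x y : M} :
    x < y ↔ ∃ u, u ε y ∧ ¬ u ε x ∧ ∀ v, v ε symm x y → v ≤ u := by
  obtain ⟨s, hs, hx, hy⟩ := exists_level₂ x y
  obtain ⟨hl, hf, hlex⟩ := hs.selfLex_ack
  have hsym := symm_sub (hs.sub_of_mem hx) (hs.sub_of_mem hy)
  have key : x ≤ y ↔ x = y ∨ ∃ u, u ε y ∧ ¬ u ε x ∧ ∀ v, v ε symm x y → v ≤ u := by
    rw [← ack_le_iff hs hx hy, hlex x hx y hy, lexLt_iff]
    refine or_congr_right (exists_congr fun u => and_congr_right fun hu => and_congr_right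
      fun _ => forall_congr' fun v => forall_congr' fun hv => ?_)
    exact ack_le_iff hs (hsym v hv) (hs.sub_of_mem hy u hu)
  rw [lt_iff_le_and_ne, key]
  constructor
  · rintro ⟨h | h, h'⟩
    exacts [(h' h).elim, h]
  · rintro h
    refine ⟨.inr h, ?_⟩
    rintro rfl
    obtain ⟨u, hu, hu', -⟩ := h
    exact hu' hu

theorem le_of_sub {x y : M} (h : x ⊑ y) : x ≤ y := by
  by_contra! h'
  obtain ⟨u, hu, hu', -⟩ := lt_iff_lex.1 h'
  exact hu' (h u hu)

theorem emp_le (x : M) : emp ≤ x := le_of_sub (emp_sub x)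

theorem emp_lt_iff {x : M} : emp < x ↔ x ≠ emp := by
  rw [lt_iff_le_and_ne, and_iff_right (emp_le x), ne_comm]

theorem exists_min {a : M} (h : ∃ u, u ε a) : ∃ u, u ε a ∧ ∀ v, v ε a → u ≤ v :=
  exists_least a (· ≤ ·) (fun _ _ => le_rfl) (fun _ _ _ _ _ _ => le_trans)
    (fun u _ v _ => le_total u v) h

theorem exists_max {a : M} (h : ∃ u, u ε a) : ∃ u, u ε a ∧ ∀ v, v ε a → v ≤ u :=
  exists_least a (· ≥ ·) (fun _ _ => le_rfl) (fun _ _ _ _ _ _ => ge_trans)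
    (fun u _ v _ => le_total v u) h

theorem IsLevel.mem_of_le {s x y : M} (hs : IsLevel s) (hx : x ε s) (h : y ≤ x) : y ε s := by
  have ht := hs.uni (isLevel_rk y)
  have hst : s ⊑ FinSetTheory.uni s (rk y) := fun u hu => mem_uni.2 (.inl hu)
  exact ack_initial hs ht hst hx
    ((ack_le_iff ht (mem_uni.2 (.inr (mem_rk y))) (hst x hx)).2 h)

theorem lt_rk (x : M) : x < rk x := by
  refine lt_of_le_of_ne (le_of_sub ((isLevel_rk x).sub_of_mem (mem_rk x))) fun e => ?_
  have := mem_rk x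
  rw [← e] at this
  exact not_mem_self x this

/-- The set of all predecessors of `x` in the Ackermann ordering. -/
noncomputable def lower (x : M) : M := sep (rk x) fun u => u < x

instance Dfn.lower {α : Type} [Ctx M α] (F : α → M) [Dfn F] : Dfn (fun a => lower (F a)) := by
  unfold FinSetTheory.lower; infer_instance

@[simp] theorem mem_lower {u x : M} : u ε lower x ↔ u < x := by
  rw [lower, mem_sep, and_iff_right_iff_imp]
  exact fun h => (isLevel_rk x).mem_of_le (mem_rk x) h.le

/-! ### Successor and initial segments -/

/-- The immediate successor of `x`. -/
noncomputable def succ (x : M) : M :=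
  thee (fld (ack (pow (rk x)))) fun z => IsNext (ack (pow (rk x))) x z

instance Dfn.succ {α : Type} [Ctx M α] (F : α → M) [Dfn F] : Dfn (fun a => succ (F a)) := by
  unfold FinSetTheory.succ; infer_instance

theorem succ_spec (x : M) : succ x ε pow (rk x) ∧ x < succ x ∧ ∀ w, x < w → succ x ≤ w := by
  have hL := (isLevel_rk x).pow
  obtain ⟨hl, hf, -⟩ := hL.selfLex_ack
  have hx : x ε pow (rk x) := (isLevel_rk x).transitive x (mem_rk x)
  obtain ⟨z, hz, hm⟩ := exists_min (a := sep (pow (rk x)) fun w => x < w)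
    ⟨rk x, mem_sep.2 ⟨mem_pow.2 (Sub.refl _), lt_rk x⟩⟩
  rw [mem_sep] at hz
  have hleast : ∀ w, x < w → z ≤ w := by
    intro w hw
    by_contra! h
    exact absurd (hm w (mem_sep.2 ⟨hL.mem_of_le hz.1 h.le, hw⟩)) (not_le.2 h)
  have e : succ x = z := by
    refine thee_eq (hf.symm ▸ hz.1)
      ⟨⟨(ack_le_iff hL hx hz.1).2 hz.2.le, hz.2.ne⟩, fun w hw hw' => ?_⟩ fun u hu hu' => ?_
    · rw [hf] at hw
      rw [ack_le_iff hL hx hw, ack_le_iff hL hw hz.1] at hw'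
      rcases hw'.1.eq_or_lt with e | h
      exacts [.inl e.symm, .inr (hw'.2.antisymm (hleast w h))]
    · rw [hf] at hu
      have h1 : x < u := lt_of_le_of_ne ((ack_le_iff hL hx hu).1 hu'.1.1) hu'.1.2
      rcases hu'.2 z (hf.symm ▸ hz.1) ⟨(ack_le_iff hL hx hz.1).2 hz.2.le,
        (ack_le_iff hL hz.1 hu).2 (hleast u h1)⟩ with e | e
      exacts [(hz.2.ne e.symm).elim, e.symm]
  rw [e]
  exact ⟨hz.1, hz.2, hleast⟩

theorem lt_succ (x : M) : x < succ x := (succ_spec x).2.1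
theorem succ_le {x w : M} (h : x < w) : succ x ≤ w := (succ_spec x).2.2 w h

theorem lt_succ_iff {w x : M} : w < succ x ↔ w ≤ x :=
  ⟨fun h => not_lt.1 fun h' => (succ_le h').not_gt h, fun h => h.trans_lt (lt_succ x)⟩

theorem succ_injective {x y : M} (h : succ x = succ y) : x = y :=
  le_antisymm (lt_succ_iff.1 (h ▸ lt_succ x)) (lt_succ_iff.1 (h.symm ▸ lt_succ y))

theorem IsLevel.succ_mem {s x : M} (hs : IsLevel s) (hx : x ε s) :
    succ x ε FinSetTheory.pow s :=
  pow_mono (rk_sub hs hx) _ (succ_spec x).1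

theorem exists_eq_succ {x : M} (h : x ≠ emp) : ∃ u, u < x ∧ succ u = x := by
  obtain ⟨u, hu, hm⟩ := exists_max (a := lower x) ⟨emp, mem_lower.2 (emp_lt_iff.2 h)⟩
  rw [mem_lower] at hu
  refine ⟨u, hu, (succ_le hu).antisymm (not_lt.1 fun h' => ?_)⟩
  exact (hm _ (mem_lower.2 h')).not_gt (lt_succ u)

theorem lower_succ (x : M) : lower (succ x) = ins (lower x) x := by
  ext u
  rw [mem_lower, mem_ins, mem_lower, lt_succ_iff, le_iff_lt_or_eq]

theorem sing_emp_le_iff {x : M} : sing emp ≤ x ↔ x ≠ emp := by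
  constructor
  · rintro h rfl
    have : (emp : M) ε sing emp := mem_sing.2 rfl
    rw [h.antisymm (emp_le _)] at this
    exact not_mem_emp _ this
  · intro h
    by_contra! h'
    obtain ⟨u, hu, hux, hm⟩ := lt_iff_lex.1 h'
    rw [mem_sing] at hu
    subst hu
    obtain ⟨v, hv⟩ := exists_mem_of_ne h
    have hv' : v ≠ emp := fun e => hux (e ▸ hv)
    exact hv' ((hm v (mem_symm.2 (.inl ⟨hv, by rwa [mem_sing]⟩))).antisymm (emp_le v))

theorem succ_emp : succ (emp : M) = sing emp := by
  refine (succ_le ?_).antisymm ?_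
  · exact emp_lt_iff.2 (sing_emp_le_iff.1 le_rfl)
  · exact sing_emp_le_iff.2 (emp_lt_iff.1 (lt_succ _))

/-- The set of all `u` with `{∅} ≤ u ≤ x`. -/
noncomputable def seg (x : M) : M := sep (lower (succ x)) fun u => u ≠ emp

theorem mem_seg {u x : M} : u ε seg x ↔ u ≤ x ∧ u ≠ emp := by
  rw [seg, mem_sep, mem_lower, lt_succ_iff]

theorem lower_cardEq_seg (x : M) : CardEq (lower x) (seg x) := by
  refine CardEq.intro succ (fun u hu => ?_) (fun _ _ _ _ e => succ_injective e) fun v hv => ?_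
  · rw [mem_lower] at hu
    exact mem_seg.2 ⟨succ_le hu, emp_lt_iff.1 ((emp_le u).trans_lt (lt_succ u))⟩
  · rw [mem_seg] at hv
    obtain ⟨u, hu, e⟩ := exists_eq_succ hv.2
    exact ⟨u, mem_lower.2 (hu.trans_le hv.1), e⟩

/-- The segment `[{∅}, …, x]` of an ordering `l`. -/
noncomputable def ini (l x : M) : M :=
  sep (fld l) fun u => op (sing emp) u ε l ∧ op u x ε l

instance Dfn.ini {α : Type} [Ctx M α] (F G : α → M) [Dfn F] [Dfn G] :
    Dfn (fun a => ini (F a) (G a)) := by unfold FinSetTheory.ini; infer_instance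

theorem ini_ack {s x : M} (hs : IsLevel s) (h1 : sing emp ε s) (hx : x ε s) :
    ini (ack s) x = seg x := by
  ext u
  rw [ini, mem_sep, mem_seg, hs.selfLex_ack.2.1]
  constructor
  · rintro ⟨hu, h⟩
    rw [ack_le_iff hs h1 hu, ack_le_iff hs hu hx] at h
    exact ⟨h.2, sing_emp_le_iff.1 h.1⟩
  · rintro ⟨h, h'⟩
    have hu := hs.mem_of_le hx h
    rw [ack_le_iff hs h1 hu, ack_le_iff hs hu hx]
    exact ⟨hu, sing_emp_le_iff.2 h', h⟩

/-! ### The number of elements of a set -/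

theorem lower_ssub {x y : M} (h : x < y) : ¬ CardLe (lower y) (lower x) :=
  not_cardLe_of_ssub (fun _ hu => mem_lower.2 ((mem_lower.1 hu).trans h)) (mem_lower.2 h)
    fun h' => lt_irrefl x (mem_lower.1 h')

theorem IsLevel.sub_lower {s z : M} (hs : IsLevel s) (hz : ¬ z ε s) : s ⊑ lower z := fun _ hu =>
  mem_lower.2 (not_le.1 fun h => hz (hs.mem_of_le hu h))

/-- Every set is equinumerous with the set of predecessors of some `z`. -/
theorem exists_number (a : M) : ∃ z, CardEq (lower z) a := by
  have hs := isLevel_rk a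
  have ha := hs.sub_of_mem (mem_rk a)
  have := finite_induction a (fun c => ∃ z, z ε pow (rk a) ∧ CardEq (lower z) c) ?_ ?_
  · obtain ⟨z, -, hz⟩ := this; exact ⟨z, hz⟩
  · refine ⟨emp, mem_pow.2 (emp_sub _), ?_⟩
    rw [show lower (emp : M) = emp from eq_emp fun u hu => (emp_le u).not_gt (mem_lower.1 hu)]
    exact CardEq.refl _
  · rintro c p hc hp hpc ⟨z, hz, h⟩
    -- Otherwise the level `R(a)` would be included in `lower z`, which has fewer elements.
    have hzs : z ε rk a := by
      by_contra hz'
      exact not_cardLe_of_ssub (hc.trans ha) (ha p hp) hpc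
        ((CardLe.of_sub (hs.sub_lower hz')).trans h.1)
    refine ⟨succ z, hs.succ_mem hzs, ?_⟩
    rw [lower_succ, cardEq_ins (by simp) hpc]
    exact h

/-- The number of elements of `a`: the element of the universe whose position in the Ackermann
ordering is the number of elements of `a`. -/
noncomputable def card (a : M) : M := (exists_number a).choose

theorem card_spec (a : M) : CardEq (lower (card a)) a := (exists_number a).choose_spec

theorem card_mono {a b : M} (h : CardLe a b) : card a ≤ card b := by
  by_contra! h'
  exact lower_ssub h' ((card_spec a).1.trans (h.trans (card_spec b).2))

theorem card_congr {a b : M} (h : CardEq a b) : card a = card b :=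
  le_antisymm (card_mono h.1) (card_mono h.2)

theorem cardEq_of_card_eq {a b : M} (h : card a = card b) : CardEq a b :=
  (card_spec a).symm.trans (h ▸ card_spec b)

theorem card_lower (x : M) : card (lower x) = x := by
  have h := card_spec (lower x)
  rcases lt_trichotomy (card (lower x)) x with h' | h' | h'
  exacts [(lower_ssub h' h.2).elim, h', (lower_ssub h' h.1).elim]

theorem card_lt {a b p : M} (h : a ⊑ b) (hp : p ε b) (hp' : ¬ p ε a) : card a < card b := by
  refine lt_of_le_of_ne (card_mono (CardLe.of_sub h)) fun e => ?_
  exact not_cardLe_of_ssub h hp hp' (cardEq_of_card_eq e).2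

theorem card_seg (x : M) : card (seg x) = x := by
  rw [← card_congr (lower_cardEq_seg x), card_lower]

/-- A level contains the number of elements of every set that can be injected into a proper subset
of the level. -/
theorem IsLevel.card_mem {s a b p : M} (hs : IsLevel s) (h : CardLe a b) (hb : b ⊑ s) (hp : p ε s)
    (hpb : ¬ p ε b) : card a ε s := by
  by_contra h'
  exact not_cardLe_of_ssub hb hp hpb
    ((CardLe.of_sub (hs.sub_lower h')).trans ((card_spec a).1.trans h))

/-- The description by which the arithmetical operations are defined denotes the number of elements
of `a`, if the level `s` has room for it. -/
theorem thee_ini_eq_card {s a : M} (hs : IsLevel s) (h1 : sing emp ε s) (ha : card a ε s) :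
    thee (fld (ack s)) (fun z => CardEq a (ini (ack s) z)) = card a := by
  have hf := hs.selfLex_ack.2.1
  refine thee_eq (hf.symm ▸ ha) ?_ fun z hz hz' => ?_
  · rw [ini_ack hs h1 ha]
    exact cardEq_of_card_eq (card_seg _).symm
  · rw [hf] at hz
    rw [ini_ack hs h1 hz] at hz'
    rw [card_congr hz', card_seg]

end Global

/-! ### Sums and products of cardinalities -/

section Arithmetic

variable {M : Type} [LSet.Structure M]

/-- The first component of an ordered pair. -/
noncomputable def fst (w : M) : M := thee (sun w) fun u => ∃ v, v ε sun w ∧ w = op u v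
/-- The second component of an ordered pair. -/
noncomputable def snd (w : M) : M := thee (sun w) fun v => ∃ u, u ε sun w ∧ w = op u v
/-- The disjoint sum of `a` and `b`. -/
noncomputable def csum (a b : M) : M := uni (prod a (sing emp)) (prod b (sing (sing emp)))
/-- The set of all functions from `b` to `a`. -/
noncomputable def funs (b a : M) : M := sep (pow (prod b a)) fun f => IsFun f b a

variable [M ⊨ EAStar]

section Instances

variable {α : Type} [Ctx M α] (F G : α → M) [Dfn F] [Dfn G]

instance Dfn.fstPair : Dfn (fun a => FinSetTheory.fst (F a)) := by unfold FinSetTheory.fst; infer_instance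
instance Dfn.sndPair : Dfn (fun a => FinSetTheory.snd (F a)) := by unfold FinSetTheory.snd; infer_instance

end Instances

theorem mem_sun_op (u v : M) : u ε sun (op u v) ∧ v ε sun (op u v) := by
  have : pr u v ε op u v := mem_pr.2 (.inr rfl)
  exact ⟨mem_sun.2 ⟨_, this, mem_pr.2 (.inl rfl)⟩, mem_sun.2 ⟨_, this, mem_pr.2 (.inr rfl)⟩⟩

@[simp] theorem fst_op (u v : M) : fst (op u v) = u :=
  thee_eq (mem_sun_op u v).1 ⟨v, (mem_sun_op u v).2, rfl⟩ fun _ _ ⟨_, _, h⟩ => (op_inj.1 h).1.symm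

@[simp] theorem snd_op (u v : M) : snd (op u v) = v :=
  thee_eq (mem_sun_op u v).2 ⟨u, (mem_sun_op u v).1, rfl⟩ fun _ _ ⟨_, _, h⟩ => (op_inj.1 h).2.symm

@[simp] theorem sing_ne_emp (x : M) : sing x ≠ emp := fun e =>
  not_mem_emp x (e ▸ mem_sing.2 rfl)

theorem mem_csum {w a b : M} :
    w ε csum a b ↔ (∃ u, u ε a ∧ w = op u emp) ∨ ∃ u, u ε b ∧ w = op u (sing emp) := by
  simp [csum, mem_prod]

theorem mem_funs {f a b : M} : f ε funs b a ↔ IsFun f b a := by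
  rw [funs, mem_sep, mem_pow, and_iff_right_iff_imp]
  exact fun h => h.1

theorem csum_le {a b a' b' : M} (h : CardLe a a') (h' : CardLe b b') :
    CardLe (csum a b) (csum a' b') := by
  classical
  obtain ⟨f, hf, hf'⟩ := h.elim
  obtain ⟨g, hg, hg'⟩ := h'.elim
  refine CardLe.intro (fun w => if snd w = emp then op (app f (fst w)) emp
    else op (app g (fst w)) (sing emp)) ?_ ?_
  · intro w hw
    rcases mem_csum.1 hw with ⟨u, hu, rfl⟩ | ⟨u, hu, rfl⟩
    · simpa using mem_csum.2 (.inl ⟨_, hf u hu, rfl⟩)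
    · simpa using mem_csum.2 (.inr ⟨_, hg u hu, rfl⟩)
  · intro w hw w' hw' e
    rcases mem_csum.1 hw with ⟨u, hu, rfl⟩ | ⟨u, hu, rfl⟩ <;>
      rcases mem_csum.1 hw' with ⟨v, hv, rfl⟩ | ⟨v, hv, rfl⟩ <;>
      simp [op_inj] at e ⊢
    · exact hf' u hu v hv e
    · exact (sing_ne_emp _ e.2.symm).elim
    · exact hg' u hu v hv e

theorem csum_congr {a b a' b' : M} (h : CardEq a a') (h' : CardEq b b') :
    CardEq (csum a b) (csum a' b') := ⟨csum_le h.1 h'.1, csum_le h.2 h'.2⟩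

theorem prod_le {a b a' b' : M} (h : CardLe a a') (h' : CardLe b b') :
    CardLe (prod a b) (prod a' b') := by
  obtain ⟨f, hf, hf'⟩ := h.elim
  obtain ⟨g, hg, hg'⟩ := h'.elim
  refine CardLe.intro (fun w => op (app f (fst w)) (app g (snd w))) ?_ ?_
  · intro w hw
    obtain ⟨u, hu, v, hv, rfl⟩ := mem_prod.1 hw
    simpa using ⟨hf u hu, hg v hv⟩
  · intro w hw w' hw' e
    obtain ⟨u, hu, v, hv, rfl⟩ := mem_prod.1 hw
    obtain ⟨u', hu', v', hv', rfl⟩ := mem_prod.1 hw'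
    simp only [fst_op, snd_op, op_inj] at e ⊢
    exact ⟨hf' u hu u' hu' e.1, hg' v hv v' hv' e.2⟩

theorem prod_congr {a b a' b' : M} (h : CardEq a a') (h' : CardEq b b') :
    CardEq (prod a b) (prod a' b') := ⟨prod_le h.1 h'.1, prod_le h.2 h'.2⟩

theorem csum_assoc (a b c : M) : CardEq (csum (csum a b) c) (csum a (csum b c)) := by
  classical
  refine CardEq.intro (fun w => if snd w = emp then
    (if snd (fst w) = emp then op (fst (fst w)) emp else op (op (fst (fst w)) emp) (sing emp))
    else op (op (fst w) (sing emp)) (sing emp)) ?_ ?_ ?_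
  · intro w hw
    simp only [mem_csum] at hw
    rcases hw with ⟨_, ⟨u, hu, rfl⟩ | ⟨u, hu, rfl⟩, rfl⟩ | ⟨u, hu, rfl⟩ <;>
      simp [mem_csum, op_inj, hu, (sing_ne_emp _).symm]
  · intro w hw w' hw' e
    simp only [mem_csum] at hw hw'
    rcases hw with ⟨_, ⟨u, hu, rfl⟩ | ⟨u, hu, rfl⟩, rfl⟩ | ⟨u, hu, rfl⟩ <;>
      rcases hw' with ⟨_, ⟨v, hv, rfl⟩ | ⟨v, hv, rfl⟩, rfl⟩ | ⟨v, hv, rfl⟩ <;>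
      simp [op_inj, (sing_ne_emp _).symm] at e ⊢ <;> exact e
  · intro w hw
    simp only [mem_csum] at hw ⊢
    rcases hw with ⟨u, hu, rfl⟩ | ⟨_, ⟨u, hu, rfl⟩ | ⟨u, hu, rfl⟩, rfl⟩
    · exact ⟨_, .inl ⟨_, .inl ⟨u, hu, rfl⟩, rfl⟩, by simp⟩
    · exact ⟨_, .inl ⟨_, .inr ⟨u, hu, rfl⟩, rfl⟩, by simp⟩
    · exact ⟨_, .inr ⟨u, hu, rfl⟩, by simp⟩

/-- The sum of `x` and `y`, read as numbers. -/
noncomputable def plus (x y : M) : M := card (csum (lower x) (lower y))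
/-- The product of `x` and `y`, read as numbers. -/
noncomputable def times (x y : M) : M := card (prod (lower x) (lower y))

theorem card_csum (a b : M) : card (csum a b) = plus (card a) (card b) :=
  card_congr (csum_congr (card_spec a).symm (card_spec b).symm)

theorem card_prod (a b : M) : card (prod a b) = times (card a) (card b) :=
  card_congr (prod_congr (card_spec a).symm (card_spec b).symm)

theorem plus_assoc (x y z : M) : plus (plus x y) z = plus x (plus y z) := by
  have h := card_congr (csum_assoc (lower x) (lower y) (lower z))
  simpa only [card_csum, card_lower] using h

theorem plus_lt {y y' : M} (x : M) (h : y < y') : plus x y < plus x y' := by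
  refine card_lt (p := op y (sing emp)) (fun w hw => ?_) ?_ ?_
  · rw [mem_csum] at hw ⊢
    refine hw.imp_right fun ⟨u, hu, e⟩ => ⟨u, mem_lower.2 ((mem_lower.1 hu).trans h), e⟩
  · exact mem_csum.2 (.inr ⟨y, mem_lower.2 h, rfl⟩)
  · simp [mem_csum, op_inj]

theorem le_plus (x y : M) : x ≤ plus x y := by
  have : CardLe (lower x) (csum (lower x) (lower y)) :=
    CardLe.intro (fun u => op u emp) (fun u hu => mem_csum.2 (.inl ⟨u, hu, rfl⟩))
      fun u _ w _ e => (op_inj.1 e).1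
  simpa only [card_lower, plus] using card_mono this

theorem times_succ (d n : M) : times d (succ n) = plus (times d n) d := by
  classical
  have : CardEq (csum (prod (lower d) (lower n)) (lower d))
      (prod (lower d) (lower (succ n))) := by
    refine CardEq.intro (fun w => if snd w = emp then fst w else op (fst w) n) ?_ ?_ ?_
    · intro w hw
      simp only [mem_csum, mem_prod, lower_succ, mem_ins] at hw ⊢
      rcases hw with ⟨_, ⟨u, hu, v, hv, rfl⟩, rfl⟩ | ⟨u, hu, rfl⟩
      · exact ⟨u, hu, v, .inl hv, by simp⟩
      · exact ⟨u, hu, n, .inr rfl, by simp⟩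
    · intro w hw w' hw' e
      simp only [mem_csum, mem_prod] at hw hw'
      rcases hw with ⟨_, ⟨u, hu, v, hv, rfl⟩, rfl⟩ | ⟨u, hu, rfl⟩ <;>
        rcases hw' with ⟨_, ⟨u', hu', v', hv', rfl⟩, rfl⟩ | ⟨u', hu', rfl⟩ <;>
        simp [op_inj] at e ⊢
      · exact e
      · exact absurd (mem_lower.1 hv) (e.2 ▸ lt_irrefl n)
      · exact absurd (mem_lower.1 hv') (e.2 ▸ lt_irrefl _)
      · exact e
    · intro w hw
      simp only [mem_csum, mem_prod, lower_succ, mem_ins] at hw ⊢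
      obtain ⟨u, hu, v, hv | rfl, rfl⟩ := hw
      · exact ⟨_, .inl ⟨_, ⟨u, hu, v, hv, rfl⟩, rfl⟩, by simp⟩
      · exact ⟨_, .inr ⟨u, hu, rfl⟩, by simp⟩
  rw [times, ← card_congr this, card_csum, card_lower, ← times]

theorem times_mono {n n' : M} (d : M) (h : n ≤ n') : times d n ≤ times d n' := by
  refine card_mono (CardLe.of_sub fun w hw => ?_)
  obtain ⟨u, hu, v, hv, rfl⟩ := mem_prod.1 hw
  exact op_mem_prod.2 ⟨hu, mem_lower.2 ((mem_lower.1 hv).trans_le h)⟩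

/-- Uniqueness of the remainder in division by `d`. -/
theorem remainder_unique {d n n' r r' : M} (hr : r < d) (hr' : r' < d)
    (h : plus (times d n) r = plus (times d n') r') : r = r' := by
  -- A greater quotient yields a greater number, whatever the remainders are.
  have key : ∀ {n n' r r' : M}, r < d → n < n' →
      plus (times d n) r < plus (times d n') r' := by
    intro n n' r r' hr hn
    calc plus (times d n) r < plus (times d n) d := plus_lt _ hr
      _ = times d (succ n) := (times_succ d n).symm
      _ ≤ times d n' := times_mono d (succ_le hn)
      _ ≤ plus (times d n') r' := le_plus _ _
  rcases lt_trichotomy n n' with hn | rfl | hn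
  · exact ((key hr hn).ne h).elim
  · rcases lt_trichotomy r r' with hr | hr | hr
    exacts [((plus_lt _ hr).ne h).elim, hr, ((plus_lt _ hr).ne' h).elim]
  · exact ((key hr' hn).ne' h).elim

/-! ### Sets as binary numerals -/

theorem lt_sing_iff {w x : M} : w < sing x ↔ ∀ u, u ε w → u < x := by
  rw [lt_iff_lex]
  constructor
  · rintro ⟨u, hu, hx, hm⟩ v hv
    obtain rfl := mem_sing.1 hu
    have hne : v ≠ u := fun e => hx (e ▸ hv)
    exact lt_of_le_of_ne (hm v (mem_symm.2 (.inl ⟨hv, by rwa [mem_sing]⟩))) hne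
  · intro h
    refine ⟨x, mem_sing.2 rfl, fun hx => lt_irrefl x (h x hx), fun v hv => ?_⟩
    rcases mem_symm.1 hv with hv | hv
    exacts [(h v hv.1).le, (mem_sing.1 hv.1).le]

/-- The predecessors of `{x}` are the sets of predecessors of `x`, so that `{x}` is the `x`-th power
of two. -/
theorem lower_sing (x : M) : lower (sing x) = pow (lower x) := by
  ext w
  rw [mem_lower, lt_sing_iff, mem_pow]
  exact forall_congr' fun u => forall_congr' fun _ => mem_lower.symm

theorem exists_le_of_lt {w y v : M} (h : w < y) (hv : v ε w) : ∃ u, u ε y ∧ v ≤ u := by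
  by_cases hvy : v ε y
  · exact ⟨v, hvy, le_rfl⟩
  · obtain ⟨u, hu, -, hm⟩ := lt_iff_lex.1 h
    exact ⟨u, hu, hm v (mem_symm.2 (.inl ⟨hv, hvy⟩))⟩

/-- If all elements of `h` come after all elements of `r`, then `h ∪ r` is the sum of `h` and `r`:
the predecessors of `h ∪ r` are those of `h` and the sets `h ∪ w`, for `w` a predecessor of `r`. -/
theorem uni_eq_plus {h r : M} (H : ∀ a, a ε h → ∀ b, b ε r → b < a) : uni h r = plus h r := by
  classical
  have hdisj : ∀ w, w < r → ∀ v, v ε w → ¬ v ε h := by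
    intro w hw v hv hvh
    obtain ⟨u, hu, hvu⟩ := exists_le_of_lt hw hv
    exact (H v hvh u hu).not_ge hvu
  have : CardEq (csum (lower h) (lower r)) (lower (uni h r)) := by
    refine CardEq.intro (fun w => if snd w = emp then fst w else uni h (fst w)) ?_ ?_ ?_
    · intro w hw
      rw [mem_lower]
      rcases mem_csum.1 hw with ⟨u, hu, rfl⟩ | ⟨u, hu, rfl⟩ <;> rw [mem_lower] at hu
      · simpa using hu.trans_le (le_of_sub fun v hv => mem_uni.2 (.inl hv))
      · simp only [snd_op, sing_ne_emp, if_false, fst_op]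
        obtain ⟨z, hz, hzu, hm⟩ := lt_iff_lex.1 hu
        refine lt_iff_lex.2 ⟨z, mem_uni.2 (.inr hz), fun h' => ?_, fun v hv => hm v ?_⟩
        · rcases mem_uni.1 h' with h' | h'
          exacts [lt_irrefl z (H z h' z hz), hzu h']
        · simp only [mem_symm, mem_uni] at hv ⊢
          tauto
    · have hsep : ∀ u w, u < h → u ≠ uni h w := by
        rintro u w hu rfl
        exact (le_of_sub fun v hv => mem_uni.2 (.inl hv)).not_gt hu
      intro w hw w' hw' e
      rcases mem_csum.1 hw with ⟨u, hu, rfl⟩ | ⟨u, hu, rfl⟩ <;>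
        rcases mem_csum.1 hw' with ⟨v, hv, rfl⟩ | ⟨v, hv, rfl⟩ <;>
        rw [mem_lower] at hu hv <;>
        simp only [snd_op, fst_op, if_true, if_false, sing_ne_emp] at e
      · rw [e]
      · exact (hsep u v hu e).elim
      · exact (hsep v u hv e.symm).elim
      · congr 1
        ext z
        have h1 := hdisj u hu z
        have h2 := hdisj v hv z
        have h3 : z ε uni h u ↔ z ε uni h v := by rw [e]
        simp only [mem_uni] at h3
        tauto
    · intro w hw
      rw [mem_lower] at hw
      by_cases hwh : w < h
      · exact ⟨_, mem_csum.2 (.inl ⟨w, mem_lower.2 hwh, rfl⟩), by simp⟩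
      obtain ⟨u, hu, huw, hm⟩ := lt_iff_lex.1 hw
      have huh : ¬ u ε h := by
        intro huh
        refine hwh (lt_iff_lex.2 ⟨u, huh, huw, fun v hv => ?_⟩)
        by_cases hvr : v ε r
        · exact (H u huh v hvr).le
        · refine hm v ?_
          simp only [mem_symm, mem_uni] at hv ⊢
          tauto
      have hur : u ε r := (mem_uni.1 hu).resolve_left huh
      have hsub : h ⊑ w := by
        intro a ha
        by_contra haw
        refine (H a ha u hur).not_ge (hm a (mem_symm.2 (.inr ⟨mem_uni.2 (.inl ha), haw⟩)))
      refine ⟨_, mem_csum.2 (.inr ⟨diff w h, mem_lower.2 ?_, rfl⟩), ?_⟩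
      · refine lt_iff_lex.2 ⟨u, hur, fun h' => huw (mem_diff.1 h').1, fun v hv => hm v ?_⟩
        have : v ε r → ¬ v ε h := fun h1 h2 => lt_irrefl v (H v h2 v h1)
        simp only [mem_symm, mem_uni, mem_diff] at hv ⊢
        tauto
      · simp only [snd_op, fst_op, if_false, sing_ne_emp]
        ext z
        have := hsub z
        rw [mem_uni, mem_diff]
        tauto
  rw [plus, card_congr this, card_lower]

/-- If all elements of `h` come after `x`, then `h` is a multiple of `{x + 1}`: the predecessors of
`h` are the unions of a set of such elements that precedes `h` and an arbitrary set of elements up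
to `x`. -/
theorem exists_eq_times {h x : M} (H : ∀ a, a ε h → x < a) :
    ∃ n, n ≤ h ∧ h = times (sing (succ x)) n := by
  set N := sep (lower h) fun A => ∀ a, a ε A → x < a with hN
  have hmem : ∀ {A}, A ε N ↔ A < h ∧ ∀ a, a ε A → x < a := by
    intro A; rw [hN, mem_sep, mem_lower]
  have hle : N ⊑ lower h := fun A hA => (mem_sep.1 hA).1
  refine ⟨card N, ?_, ?_⟩
  · simpa only [card_lower] using card_mono (CardLe.of_sub hle)
  have hD : ∀ {B}, B ε lower (sing (succ x)) ↔ ∀ b, b ε B → b ≤ x := by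
    intro B
    rw [mem_lower, lt_sing_iff]
    simp only [lt_succ_iff]
  have : CardEq (prod (lower (sing (succ x))) N) (lower h) := by
    refine CardEq.intro (fun w => uni (snd w) (fst w)) ?_ ?_ ?_
    · intro w hw
      obtain ⟨B, hB, A, hA, rfl⟩ := mem_prod.1 hw
      rw [hD] at hB
      rw [hmem] at hA
      simp only [fst_op, snd_op, mem_lower]
      obtain ⟨u, hu, huA, hm⟩ := lt_iff_lex.1 hA.1
      refine lt_iff_lex.2 ⟨u, hu, fun h' => ?_, fun v hv => ?_⟩
      · rcases mem_uni.1 h' with h' | h'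
        exacts [huA h', (hB u h').not_gt (H u hu)]
      · by_cases hvB : v ε B
        · exact (hB v hvB).trans (H u hu).le
        · refine hm v ?_
          simp only [mem_symm, mem_uni] at hv ⊢
          tauto
    · intro w hw w' hw' e
      obtain ⟨B, hB, A, hA, rfl⟩ := mem_prod.1 hw
      obtain ⟨B', hB', A', hA', rfl⟩ := mem_prod.1 hw'
      rw [hD] at hB hB'
      rw [hmem] at hA hA'
      simp only [fst_op, snd_op] at e
      have he : ∀ z, z ε A ∨ z ε B ↔ z ε A' ∨ z ε B' := fun z => by
        rw [← mem_uni, ← mem_uni, e]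
      rw [op_inj]
      constructor <;> ext z
      · have h1 := he z
        have h2 : z ε B → ¬ z ε A' := fun h h' => (hB z h).not_gt (hA'.2 z h')
        have h3 : z ε B' → ¬ z ε A := fun h h' => (hB' z h).not_gt (hA.2 z h')
        tauto
      · have h1 := he z
        have h2 : z ε B → ¬ z ε A' := fun h h' => (hB z h).not_gt (hA'.2 z h')
        have h3 : z ε B' → ¬ z ε A := fun h h' => (hB' z h).not_gt (hA.2 z h')
        tauto
    · intro w hw
      rw [mem_lower] at hw
      refine ⟨op (sep w fun u => u ≤ x) (sep w fun u => x < u), ?_, ?_⟩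
      · rw [op_mem_prod, hD, hmem]
        refine ⟨fun b hb => (mem_sep.1 hb).2, ?_, fun a ha => (mem_sep.1 ha).2⟩
        exact (le_of_sub fun u hu => (mem_sep.1 hu).1).trans_lt hw
      · simp only [fst_op, snd_op]
        ext u
        rw [mem_uni, mem_sep, mem_sep]
        have := lt_or_ge x u
        tauto
  have e := card_congr this
  rw [card_lower, card_prod, card_lower] at e
  exact e.symm

/-- The elements of `y` up to `x` form the remainder of `y` modulo `{x + 1}`. -/
theorem exists_eq_plus_rem (x y : M) : ∃ n, n ≤ (sep y fun u => x < u) ∧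
    y = plus (times (sing (succ x)) n) (sep y fun u => u ≤ x) := by
  obtain ⟨n, hn, e⟩ := exists_eq_times (h := sep y fun u => x < u) (x := x)
    fun a ha => (mem_sep.1 ha).2
  refine ⟨n, hn, ?_⟩
  rw [← e, ← uni_eq_plus fun a ha b hb => (mem_sep.1 hb).2.trans_lt (mem_sep.1 ha).2]
  ext u
  rw [mem_uni, mem_sep, mem_sep]
  have := lt_or_ge x u
  tauto

/-- An element `x` of `y` is a position at which the binary expansion of `y` has the digit one. -/
theorem mem_iff_bit {x y : M} : x ε y ↔ ∃ n, n < y ∧ ∃ m, m < sing x ∧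
    y = plus (plus (times (sing (succ x)) n) (sing x)) m := by
  have hplus : ∀ m, m < sing x → uni (sing x) m = plus (sing x) m := by
    intro m hm
    refine uni_eq_plus fun a ha b hb => ?_
    rw [mem_sing] at ha
    exact ha ▸ lt_sing_iff.1 hm b hb
  obtain ⟨n, hn, e⟩ := exists_eq_plus_rem x y
  constructor
  · intro hxy
    have hlt : n < y := by
      refine hn.trans_lt (lt_of_le_of_ne (le_of_sub fun u hu => (mem_sep.1 hu).1) fun e => ?_)
      rw [← e, mem_sep] at hxy
      exact lt_irrefl x hxy.2
    have hm : (sep y fun u => u < x) < sing x := lt_sing_iff.2 fun u hu => (mem_sep.1 hu).2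
    refine ⟨n, hlt, sep y fun u => u < x, hm, ?_⟩
    rw [plus_assoc, ← hplus _ hm]
    have : (sep y fun u => u ≤ x) = uni (sing x) (sep y fun u => u < x) := by
      ext u
      rw [mem_uni, mem_sep, mem_sep, mem_sing, le_iff_lt_or_eq]
      constructor
      · tauto
      · rintro (rfl | h)
        exacts [⟨hxy, .inr rfl⟩, ⟨h.1, .inl h.2⟩]
    rw [← this]
    exact e
  · rintro ⟨n', -, m, hm, e'⟩
    rw [plus_assoc, ← hplus m hm] at e'
    have h1 : (sep y fun u => u ≤ x) < sing (succ x) :=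
      lt_sing_iff.2 fun u hu => lt_succ_iff.2 (mem_sep.1 hu).2
    have h2 : uni (sing x) m < sing (succ x) := by
      refine lt_sing_iff.2 fun u hu => ?_
      rcases mem_uni.1 hu with hu | hu
      · rw [mem_sing.1 hu]; exact lt_succ x
      · exact (lt_sing_iff.1 hm u hu).trans (lt_succ x)
    have h3 := remainder_unique h1 h2 (e.symm.trans e')
    have h4 : x ε uni (sing x) m := mem_uni.2 (.inl (mem_sing.2 rfl))
    rw [← h3, mem_sep] at h4
    exact h4.1

end Arithmetic

/-! ### The arithmetical operations of the theory -/

section Operations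

variable {M : Type} [LSet.Structure M] [M ⊨ EAStar]

/-- The operation `+_a`. -/
noncomputable def addS (x y : M) : M :=
  thee (fld (ack (pow (uni (rk x) (rk y))))) fun z =>
    CardEq (csum (ini (ack (pow (uni (rk x) (rk y)))) x) (ini (ack (pow (uni (rk x) (rk y)))) y))
      (ini (ack (pow (uni (rk x) (rk y)))) z)

/-- The operation `×_a`. -/
noncomputable def mulS (x y : M) : M :=
  thee (fld (ack (pow (uni (rk x) (rk y))))) fun z =>
    CardEq (prod (ini (ack (pow (uni (rk x) (rk y)))) x) (ini (ack (pow (uni (rk x) (rk y)))) y))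
      (ini (ack (pow (uni (rk x) (rk y)))) z)

/-- The operation `Exp_a`. -/
noncomputable def expS (x y : M) : M :=
  thee (fld (ack (pow (pow (uni (rk x) (rk y)))))) fun z =>
    CardEq (funs (ini (ack (pow (pow (uni (rk x) (rk y))))) y)
      (ini (ack (pow (pow (uni (rk x) (rk y))))) x)) (ini (ack (pow (pow (uni (rk x) (rk y))))) z)

section Evaluation

variable {n : ℕ} (v : Fin n → M) (x y l a b : Tm n)

@[simp] theorem sat_ltA : (ltA x y).Sat v ↔ ev v x < ev v y := by
  simp only [ltA, sat_and, sat_subset, sat_ordLt, ev_ackT, ev_rankT]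
  exact Iff.rfl
@[simp] theorem ev_succA : ev v (succA x) = succ (ev v x) := by
  simp only [succA, ev_the, sat_isNext, ev_fieldT, ev_ackT, ev_powT, ev_rankT, ev_up, ev_new, succ]
@[simp] theorem ev_initT : ev v (initT l x) = ini (ev v l) (ev v x) := by
  simp only [initT, segT, ev_sepT, sat_and, sat_ordLe, ev_fieldT, ev_singT, ev_emptyT, ev_up,
    ev_new, ini]
@[simp] theorem ev_cardSumT : ev v (cardSumT a b) = csum (ev v a) (ev v b) := by
  simp [cardSumT, csum]
@[simp] theorem ev_funsT : ev v (funsT b a) = funs (ev v b) (ev v a) := by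
  simp only [funsT, funs, ev_sepT, sat_isFun, ev_powT, ev_prodT, ev_up, ev_new]
@[simp] theorem ev_addA : ev v (addA x y) = addS (ev v x) (ev v y) := by
  simp only [addA, maxRankT, ev_the, sat_cardEq, ev_cardSumT, ev_initT, ev_fieldT, ev_ackT,
    ev_powT, ev_unionT, ev_rankT, ev_up, ev_new, addS]
@[simp] theorem ev_mulA : ev v (mulA x y) = mulS (ev v x) (ev v y) := by
  simp only [mulA, maxRankT, ev_the, sat_cardEq, ev_prodT, ev_initT, ev_fieldT, ev_ackT,
    ev_powT, ev_unionT, ev_rankT, ev_up, ev_new, mulS]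
@[simp] theorem ev_expA : ev v (expA x y) = expS (ev v x) (ev v y) := by
  simp only [expA, maxRankT, ev_the, sat_cardEq, ev_funsT, ev_initT, ev_fieldT, ev_ackT,
    ev_powT, ev_unionT, ev_rankT, ev_up, ev_new, expS]

end Evaluation

theorem IsLevel.sing_emp_mem_pow {s x : M} (hs : IsLevel s) (hx : x ε s) :
    sing emp ε FinSetTheory.pow s := by
  rw [mem_pow]
  intro u hu
  exact mem_sing.1 hu ▸ hs.mem_of_le hx (emp_le x)

theorem IsLevel.seg_sub {s x u : M} (hs : IsLevel s) (hx : x ε s) (hu : u ε seg x) :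
    u ε s ∧ u ≠ emp :=
  ⟨hs.mem_of_le hx (mem_seg.1 hu).1, (mem_seg.1 hu).2⟩

theorem pr_eq_pr {a b c d : M} (h : pr a b = pr c d) : (a = c ∧ b = d) ∨ (a = d ∧ b = c) := by
  have h1 : ∀ z, z = a ∨ z = b ↔ z = c ∨ z = d := fun z => by rw [← mem_pr, ← mem_pr, h]
  have ha := h1 a
  have hb := h1 b
  have hc := h1 c
  have hd := h1 d
  grind

/-- The number of elements of `[x] ⊎ [y]` is in `P(s)`, for every level `s` that contains `x` and
`y`: elements `u` of the summands are sent to `{u}` and `{∅, u}`. -/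
theorem IsLevel.card_csum_mem {s x y : M} (hs : IsLevel s) (hx : x ε s) (hy : y ε s) :
    card (csum (seg x) (seg y)) ε FinSetTheory.pow s := by
  classical
  have h0 : emp ε s := hs.mem_of_le hx (emp_le x)
  refine hs.pow.card_mem (b := diff (FinSetTheory.pow s) (sing emp)) (p := emp) ?_
    (fun u hu => (mem_diff.1 hu).1) (mem_pow.2 (emp_sub _)) (by simp)
  refine CardLe.intro (fun w => if snd w = emp then sing (fst w) else pr emp (fst w)) ?_ ?_
  · intro w hw
    rw [mem_diff, mem_pow, mem_sing]
    rcases mem_csum.1 hw with ⟨u, hu, rfl⟩ | ⟨u, hu, rfl⟩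
    · simp only [snd_op, if_true, fst_op]
      exact ⟨fun z hz => mem_sing.1 hz ▸ (hs.seg_sub hx hu).1, sing_ne_emp u⟩
    · simp only [snd_op, sing_ne_emp, if_false, fst_op]
      refine ⟨fun z hz => ?_, fun e => not_mem_emp u (e ▸ mem_pr.2 (.inr rfl))⟩
      rcases mem_pr.1 hz with rfl | rfl
      exacts [h0, (hs.seg_sub hy hu).1]
  · intro w hw w' hw' e
    rcases mem_csum.1 hw with ⟨u, hu, rfl⟩ | ⟨u, hu, rfl⟩ <;>
      rcases mem_csum.1 hw' with ⟨v, hv, rfl⟩ | ⟨v, hv, rfl⟩ <;>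
      have hu := (mem_seg.1 hu).2 <;>
      have hv := (mem_seg.1 hv).2 <;>
      simp only [snd_op, fst_op, if_true, if_false, sing_ne_emp] at e <;>
      have := pr_eq_pr e <;>
      grind

/-- The number of elements of `[x] × [y]` is in `P(s)`, for every level `s` that contains `x` and
`y`: a pair `(u, v)` is sent to `{u, v}` or `{u, v, ∅}`, according to the order of `u` and `v`. -/
theorem IsLevel.card_prod_mem {s x y : M} (hs : IsLevel s) (hx : x ε s) (hy : y ε s) :
    card (prod (seg x) (seg y)) ε FinSetTheory.pow s := by
  classical
  have h0 : emp ε s := hs.mem_of_le hx (emp_le x)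
  refine hs.pow.card_mem (b := diff (FinSetTheory.pow s) (sing emp)) (p := emp) ?_
    (fun u hu => (mem_diff.1 hu).1) (mem_pow.2 (emp_sub _)) (by simp)
  refine CardLe.intro (fun w => if snd w < fst w then ins (pr (fst w) (snd w)) emp
    else pr (fst w) (snd w)) ?_ ?_
  · intro w hw
    obtain ⟨u, hu, v, hv, rfl⟩ := mem_prod.1 hw
    have hus := (hs.seg_sub hx hu).1
    have hvs := (hs.seg_sub hy hv).1
    have hpr : pr u v ⊑ s := by
      intro z hz
      rcases mem_pr.1 hz with rfl | rfl
      exacts [hus, hvs]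
    have hu' : u ε pr u v := mem_pr.2 (.inl rfl)
    rw [mem_diff, mem_pow, mem_sing]
    simp only [snd_op, fst_op]
    split_ifs
    · exact ⟨ins_sub hpr h0, fun e => not_mem_emp u (e ▸ mem_ins.2 (.inl hu'))⟩
    · exact ⟨hpr, fun e => not_mem_emp u (e ▸ hu')⟩
  · intro w hw w' hw' e
    obtain ⟨u, hu, v, hv, rfl⟩ := mem_prod.1 hw
    obtain ⟨u', hu', v', hv', rfl⟩ := mem_prod.1 hw'
    have hu := (mem_seg.1 hu).2
    have hv := (mem_seg.1 hv).2
    have hu' := (mem_seg.1 hu').2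
    have hv' := (mem_seg.1 hv').2
    simp only [snd_op, fst_op] at e
    have hn : ∀ {u v : M}, u ≠ emp → v ≠ emp → ¬ emp ε pr u v := by
      intro u v hu hv h
      rcases mem_pr.1 h with h | h
      exacts [hu h.symm, hv h.symm]
    rw [op_inj]
    split_ifs at e with h1 h2 h2
    · have : pr u v = pr u' v' := by
        ext z
        have hz : z ε ins (pr u v) emp ↔ z ε ins (pr u' v') emp := by rw [e]
        rw [mem_ins, mem_ins] at hz
        have h3 := hn hu hv
        have h4 := hn hu' hv'
        by_cases hz0 : z = emp
        · subst hz0; tauto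
        · tauto
      rcases pr_eq_pr this with h | h
      · exact h
      · rw [h.1, h.2] at h1
        exact (lt_asymm h1 h2).elim
    · exact (hn hu' hv' (e ▸ mem_ins.2 (.inr rfl))).elim
    · exact (hn hu hv (e ▸ mem_ins.2 (.inr rfl))).elim
    · rcases pr_eq_pr e with h | h
      · exact h
      · rw [h.1, h.2] at h1
        have : u' = v' := le_antisymm (not_lt.1 h2) (not_lt.1 h1)
        exact ⟨h.1.trans this.symm, h.2.trans this⟩

theorem isLevel_maxRank (x y : M) : IsLevel (uni (rk x) (rk y)) :=
  (isLevel_rk x).uni (isLevel_rk y)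

theorem addS_eq (x y : M) : addS x y = plus x y := by
  have hs := isLevel_maxRank x y
  have hx : x ε uni (rk x) (rk y) := mem_uni.2 (.inl (mem_rk x))
  have hy : y ε uni (rk x) (rk y) := mem_uni.2 (.inr (mem_rk y))
  have h1 := hs.sing_emp_mem_pow hx
  rw [addS, ini_ack hs.pow h1 (hs.transitive x hx), ini_ack hs.pow h1 (hs.transitive y hy),
    thee_ini_eq_card hs.pow h1 (hs.card_csum_mem hx hy), card_csum, card_seg, card_seg]

theorem mulS_eq (x y : M) : mulS x y = times x y := by
  have hs := isLevel_maxRank x y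
  have hx : x ε uni (rk x) (rk y) := mem_uni.2 (.inl (mem_rk x))
  have hy : y ε uni (rk x) (rk y) := mem_uni.2 (.inr (mem_rk y))
  have h1 := hs.sing_emp_mem_pow hx
  rw [mulS, ini_ack hs.pow h1 (hs.transitive x hx), ini_ack hs.pow h1 (hs.transitive y hy),
    thee_ini_eq_card hs.pow h1 (hs.card_prod_mem hx hy), card_prod, card_seg, card_seg]

theorem mem_seg_two {u : M} : u ε seg (succ (succ emp)) ↔ u = succ emp ∨ u = succ (succ emp) := by
  rw [mem_seg, ← sing_emp_le_iff, ← succ_emp, le_iff_lt_or_eq, lt_succ_iff]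
  constructor
  · rintro ⟨h | h, h'⟩
    exacts [.inl (h.antisymm h'), .inr h]
  · rintro (rfl | rfl)
    exacts [⟨.inl le_rfl, le_rfl⟩, ⟨.inr rfl, (lt_succ _).le⟩]

/-- A set of predecessors of `x` is sent to its characteristic function, with the values one and
two. -/
theorem pow_cardEq_funs (x : M) :
    CardEq (pow (lower x)) (funs (seg x) (seg (succ (succ emp)))) := by
  have hseg : ∀ {v}, v ε seg x → ∃ u, u ε lower x ∧ succ u = v := by
    intro v hv
    rw [mem_seg] at hv
    obtain ⟨u, hu, e⟩ := exists_eq_succ hv.2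
    exact ⟨u, mem_lower.2 (hu.trans_le hv.1), e⟩
  have hseg' : ∀ {u}, u ε lower x → succ u ε seg x := by
    intro u hu
    exact mem_seg.2 ⟨succ_le (mem_lower.1 hu), emp_lt_iff.1 ((emp_le u).trans_lt (lt_succ u))⟩
  set one : M := succ emp
  set two : M := succ one
  have h12 : one ≠ two := (lt_succ one).ne
  have h1 : one ε seg two := mem_seg_two.2 (.inl rfl)
  have h2 : two ε seg two := mem_seg_two.2 (.inr rfl)
  -- `F w` is the characteristic function of `w`, shifted by one: its value at `u + 1` tells whether
  -- `u` is in `w`.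
  let F : M → M := fun w => sep (prod (seg x) (seg two)) fun p => ∃ u, u ε lower x ∧
    ((u ε w ∧ p = op (succ u) two) ∨ (¬ u ε w ∧ p = op (succ u) one))
  have hF : ∀ w u i, u ε lower x →
      (op (succ u) i ε F w ↔ (u ε w ∧ i = two) ∨ (¬ u ε w ∧ i = one)) := by
    intro w u i hu
    simp only [F]
    rw [mem_sep, op_mem_prod]
    constructor
    · rintro ⟨-, u', -, ⟨h, e⟩ | ⟨h, e⟩⟩ <;> obtain ⟨e1, e2⟩ := op_inj.1 e <;>
        obtain rfl := succ_injective e1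
      exacts [.inl ⟨h, e2⟩, .inr ⟨h, e2⟩]
    · rintro (⟨h, rfl⟩ | ⟨h, rfl⟩)
      · exact ⟨⟨hseg' hu, h2⟩, u, hu, .inl ⟨h, rfl⟩⟩
      · exact ⟨⟨hseg' hu, h1⟩, u, hu, .inr ⟨h, rfl⟩⟩
  have hFfun : ∀ w, IsFun (F w) (seg x) (seg two) := by
    intro w
    refine ⟨fun p hp => (mem_sep.1 hp).1, fun v hv => ?_⟩
    obtain ⟨u, hu, rfl⟩ := hseg hv
    by_cases huw : u ε w
    · refine ⟨two, h2, (hF w u _ hu).2 (.inl ⟨huw, rfl⟩), fun i _ hi => ?_⟩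
      rw [hF w u i hu] at hi
      tauto
    · refine ⟨one, h1, (hF w u _ hu).2 (.inr ⟨huw, rfl⟩), fun i _ hi => ?_⟩
      rw [hF w u i hu] at hi
      tauto
  refine CardEq.intro F (fun w _ => mem_funs.2 (hFfun w)) ?_ ?_
  · intro w hw w' hw' e
    rw [mem_pow] at hw hw'
    have key : ∀ u, u ε lower x → (u ε w ↔ u ε w') := by
      intro u hu
      have h3 := hF w u two hu
      have h4 := hF w' u two hu
      rw [e] at h3
      have := h12.symm
      tauto
    ext u
    exact ⟨fun h => (key u (hw u h)).1 h, fun h => (key u (hw' u h)).2 h⟩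
  · intro f hf
    rw [mem_funs] at hf
    have hw : ∀ {u}, u ε (sep (lower x) fun u => op (succ u) two ε f) ↔
        u ε lower x ∧ op (succ u) two ε f := mem_sep
    refine ⟨sep (lower x) fun u => op (succ u) two ε f,
      mem_pow.2 fun u hu => (hw.1 hu).1, ?_⟩
    set w := sep (lower x) fun u => op (succ u) two ε f
    have key : ∀ u, u ε lower x → ∀ i, (op (succ u) i ε F w ↔ op (succ u) i ε f) := by
      intro u hu i
      rw [hF w u i hu, hw, and_iff_right hu]
      have hval := hf.app_mem (hseg' hu)
      have hop := hf.op_app (hseg' hu)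
      constructor
      · rintro (⟨h, rfl⟩ | ⟨h, rfl⟩)
        · exact h
        · rcases mem_seg_two.1 hval with e | e
          · rwa [e] at hop
          · rw [e] at hop
            exact (h hop).elim
      · intro h
        have e := hf.app_eq h
        rcases mem_seg_two.1 (e ▸ hval) with rfl | rfl
        · refine .inr ⟨fun h' => h12 (e.symm.trans (hf.app_eq h')), rfl⟩
        · exact .inl ⟨h, rfl⟩
    ext p
    constructor
    · intro hp
      obtain ⟨v, hv, i, hi, rfl⟩ := mem_prod.1 ((hFfun w).1 p hp)
      obtain ⟨u, hu, rfl⟩ := hseg hv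
      exact (key u hu i).1 hp
    · intro hp
      obtain ⟨v, hv, i, hi, rfl⟩ := mem_prod.1 (hf.1 p hp)
      obtain ⟨u, hu, rfl⟩ := hseg hv
      exact (key u hu i).2 hp

/-- Powers of two are singletons: functions from `[x]` to `[2]` correspond to sets of predecessors
of `x`, and these are the predecessors of `{x}`. -/
theorem expS_two (x : M) : expS (succ (succ emp)) x = sing x := by
  have hs := isLevel_maxRank (succ (succ emp)) x
  have h2 : succ (succ emp) ε uni (rk (succ (succ emp))) (rk x) := mem_uni.2 (.inl (mem_rk _))
  have hx : x ε uni (rk (succ (succ emp))) (rk x) := mem_uni.2 (.inr (mem_rk x))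
  have h1 := hs.pow.transitive _ (hs.sing_emp_mem_pow hx)
  have hsub : ∀ {z : M}, z ε uni (rk (succ (succ emp))) (rk x) →
      z ε pow (pow (uni (rk (succ (succ emp))) (rk x))) := fun hz =>
    hs.pow.transitive _ (hs.transitive _ hz)
  have hcard : card (funs (seg x) (seg (succ (succ (emp : M))))) = sing x := by
    rw [← card_congr (pow_cardEq_funs x), ← lower_sing, card_lower]
  rw [expS, ini_ack hs.pow.pow h1 (hsub hx), ini_ack hs.pow.pow h1 (hsub h2),
    thee_ini_eq_card hs.pow.pow h1, hcard]
  rw [hcard]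
  exact hs.pow.transitive _ (mem_pow.2 fun u hu => mem_sing.1 hu ▸ hx)

end Operations

/-! ### The interpretation of arithmetic -/

section Interpretation

variable {M : Type} [LSet.Structure M] [M ⊨ EAStar]

/-- The structure for the language of arithmetic that the interpretation `𝔡` defines in a model. -/
noncomputable instance arith : LArith.Structure M where
  funMap {k} f v := (interpD.func (k := k) f).realize v
  RelMap {k} R v := (interpD.rel (k := k) R).Realize v

theorem realize_term {β : Type} (v : β → M) :
    (t : LArith.Term β) → (interpD.term t).realize v = t.realize v
  | .var _ => rfl
  | .func f ts => by
      rw [AtomicMapping.term, Term.substFunc, Term.realize_subst]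
      exact congrArg (fun w => (interpD.func f).realize w)
        (funext fun i => realize_term v (ts i))

theorem realize_substitute {L : FirstOrder.Language.{0, 0}} {N : Type} [L.Structure N] {α : Type}
    {k n : ℕ} (φ : L.Formula (Fin k)) (ts : Fin k → L.Term (α ⊕ Fin n)) (v : α → N)
    (xs : Fin n → N) :
    (substitute φ ts).Realize v xs ↔ φ.Realize fun i => (ts i).realize (Sum.elim v xs) := by
  rw [substitute]
  refine (BoundedFormula.realize_relabel (n := 0)).trans ?_
  rw [BoundedFormula.realize_subst, Formula.Realize]
  exact iff_of_eq (congrArg₂ _ rfl (Subsingleton.elim _ _))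

theorem realize_eq (x y : M) : interpD.eq.Realize ![x, y] ↔ x = y :=
  realize_toFormula _ _

theorem realize_dom (x : M) : (interpD.rel (k := 1) ArithRel.dom).Realize ![x] :=
  (realize_toFormula _ _).2 (dom_holds x)

/-- A translated formula holds in the model iff the formula holds in the arithmetic of the
model. -/
theorem realize_translate {α : Type} : {n : ℕ} → (φ : LArith.BoundedFormula α n) → (v : α → M) →
    (xs : Fin n → M) → ((interpD.translate φ).Realize v xs ↔ φ.Realize v xs)
  | _, .falsum, _, _ => Iff.rfl
  | _, .equal s t, v, xs => by
      rw [AtomicMapping.translate, realize_substitute]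
      have e : (fun i => (![interpD.term s, interpD.term t] i).realize (Sum.elim v xs)) =
          ![s.realize (Sum.elim v xs), t.realize (Sum.elim v xs)] := by
        funext i
        fin_cases i <;> exact realize_term _ _
      rw [e, realize_eq]
      rfl
  | _, .rel R ts, v, xs => by
      rw [AtomicMapping.translate, realize_substitute]
      simp only [realize_term]
      exact Iff.rfl
  | _, .imp φ ψ, v, xs => imp_congr (realize_translate φ v xs) (realize_translate ψ v xs)
  | _, .all φ, v, xs => by
      rw [AtomicMapping.translate, BoundedFormula.realize_all, BoundedFormula.realize_all]
      refine forall_congr' fun x => ?_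
      rw [BoundedFormula.realize_imp, realize_substitute, realize_translate φ,
        forall_prop_of_true]
      convert realize_dom x using 2 with i
      fin_cases i
      simp

section

variable {β : Type} (v : β → M) (s t : LArith.Term β)

@[simp] theorem realize_zeroN : (zeroN : LArith.Term β).realize v = (emp : M) := by
  have : (zeroN : LArith.Term β).realize v = Structure.funMap (L := LArith) (n := 0) ArithFn.zero
    (default : Fin 0 → M) := by rw [zeroN, Term.realize_constants]; rfl
  rw [this]
  exact ev_emptyT _

@[simp] theorem realize_succN : (succN s).realize v = succ (s.realize v) := by
  rw [succN, Term.realize_functions_apply₁]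
  exact ev_succA ![s.realize v] (.var 0)

@[simp] theorem realize_addN : (addN s t).realize v = plus (s.realize v) (t.realize v) := by
  rw [addN, Term.realize_functions_apply₂, ← addS_eq]
  exact ev_addA ![s.realize v, t.realize v] (.var 0) (.var 1)

@[simp] theorem realize_mulN : (mulN s t).realize v = times (s.realize v) (t.realize v) := by
  rw [mulN, Term.realize_functions_apply₂, ← mulS_eq]
  exact ev_mulA ![s.realize v, t.realize v] (.var 0) (.var 1)

@[simp] theorem realize_twoPowN : (twoPowN t).realize v = sing (t.realize v) := by
  rw [twoPowN, expN, Term.realize_functions_apply₂, ← expS_two, realize_succN, realize_succN,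
    realize_zeroN]
  exact ev_expA ![_, t.realize v] (.var 0) (.var 1)

theorem realize_ltN {α : Type} {k : ℕ} (s t : LArith.Term (α ⊕ Fin k)) (v : α → M)
    (xs : Fin k → M) :
    (ltN s t).Realize v xs ↔ s.realize (Sum.elim v xs) < t.realize (Sum.elim v xs) := by
  rw [ltN, BoundedFormula.realize_rel₂]
  refine (realize_toFormula _ _).trans ?_
  rw [sat_ltA]
  rfl

end

theorem realize_bitFormula (v : Fin 2 → M) (xs : Fin 0 → M) :
    BoundedFormula.Realize bitFormula v xs ↔ ∃ n, n < v 1 ∧ ∃ m, m < sing (v 0) ∧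
      v 1 = plus (plus (times (sing (succ (v 0))) n) (sing (v 0))) m := by
  simp only [bitFormula, BoundedFormula.realize_ex, BoundedFormula.realize_inf, realize_ltN,
    BoundedFormula.realize_bdEqual, realize_addN, realize_mulN, realize_twoPowN, realize_succN,
    Term.realize_var, Sum.elim_inl, Sum.elim_inr]
  exact Iff.rfl

end Interpretation

end FinSetTheory

theorem mainTheorem2 :
    FinSetTheory.EAStar ⊨ᵇ
      BoundedFormula.iff FinSetTheory.memFormula
        (FinSetTheory.interpD.translate FinSetTheory.bitFormula) := by
  intro M v xs
  rw [BoundedFormula.realize_iff, FinSetTheory.realize_translate,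
    FinSetTheory.realize_bitFormula]
  refine Iff.trans ?_ FinSetTheory.mem_iff_bit
  have e : xs = default := Subsingleton.elim _ _
  rw [e]
  exact FinSetTheory.realize_toFormula _ v
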